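/- **Setting.** Fix $d\ge 1$. For every $L$ let $T_L=(\mathbb Z/L)^d$ be the discrete torus with its sup-distance. A *gapped phase* is a family of Hamiltonians $H_L=\sum_{x\in T_L}H_{L,x}$ on $\bigotimes_{x\in T_L}\mathbb C^D$, where $H_{L,x}$ is Hermitian, supported on the disk of radius $R$ around $x$, and $\|H_{L,x}\|\le J$, with $D,R,J$ independent of $L$, such that for some $C,c,\alpha,\Delta>0$ and all large $L$ every eigenvalue $\mu$ of $H_L$, with smallest eigenvalue $E_L$, satisfies $\mu\le E_L+Ce^{-cL^\alpha}$ or $\mu\ge E_L+\Delta$. Its ground space is the span of the eigenvectors with eigenvalue at most $E_L+Ce^{-cL^\alpha}$ (ground states up to exponentially small splitting), and its torus ground state degeneracy $G(L)$ is the dimension of this space. The ground states are *locally indistinguishable* if there are $C',c',\alpha'>0$ such that for all large $L$, with $\epsilon=C'e^{-c'L^{\alpha'}}$, any two orthonormal ground states $g,g'$ satisfy $|\langle g|O|g'\rangle|<\epsilon$ and $|\langle g|O|g\rangle-\langle g'|O|g'\rangle|<2\epsilon$ for every $O$ with $\|O\|\le1$ supported on a disk of at most $L^{\alpha'}$ sites.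 A family of unitaries on systems located on $T_{2L}$ is *quasi-local* if each of them is generated by evolution, for a time $T$, by a (possibly time-dependent, continuous) Hamiltonian $K=\sum_x\sum_r K_{x,r}$, where $K_{x,r}$ is Hermitian, supported on the disk of radius $r$ around $x$, and $\|K_{x,r}\|\le f(r)$, with $T$ and $f$ independent of $L$ and $f$ decaying faster than any power. A phase $Q$ is *constructible* from finitely many phases $(P_k)_{k}$ (repetitions allowed) if for all large $L$ there are ground states $\varphi_k$ of $P_k$ of size $L$, a ground state $\psi$ of $Q$ of size $2L$, unentangled (product) states $|a\rangle,|b\rangle$ of auxiliary degrees of freedom on the sites of $T_{2L}$, and a quasi-local $U$ with $$U\Big(\bigotimes_k\varphi_k\otimes|a\rangle\Big)=\psi\otimes|b\rangle ,$$ where the systems $P_k$ are intercalated in $T_{2L}$: site $y\in T_L$ is placed within an $L$-independent distance of $2y$. A phase is an *$s$ source RG fixed point* if it is constructible from $s$ copies of itself. In a family of phases $(P_i)_{i\in\Lambda}$ with numbers $s_{ij}\in\mathbb N$, for each $i$ only finitely many of them nonzero, the phase $i$ is a *generalized $s$ source RG fixed point* if $P_i$ is constructible from $s_{ij}$ copies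 of $P_j$, $j\in\Lambda$. **Lemma (Ground State Degeneracy Lemma).** 1. If an $s$ source RG fixed point has locally indistinguishable ground states, then for all sufficiently large $L$ $$G(2L)=G(L)^s .$$ 2. Let $(P_i)_{i\in\Lambda}$ be a family of phases with locally indistinguishable ground states, and let $i$ be a generalized $s$ source RG fixed point. Then for all sufficiently large $L$ $$G_i(2L)=\prod_{j}G_j(L)^{s_{ij}} .$$ -/

import Mathlib

open scoped Matrix Matrix.Norms.L2Operator

noncomputable section

namespace SourceRG

/-! ### The discrete torus -/

/-- The sites of the `d`-dimensional torus of linear size `L`. -/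
abbrev Torus (d L : ℕ) : Type := Fin d → Fin L

/-- Distance on a cycle of length `L`. -/
def cycleDist {L : ℕ} (a b : Fin L) : ℕ :=
  min (Nat.dist a b) (L - Nat.dist a b)

/-- The sup-distance on the torus (equivalent to the Euclidean one, up to a factor `√d`). -/
def torusDist {d L : ℕ} (x y : Torus d L) : ℕ :=
  Finset.univ.sup fun i => cycleDist (x i) (y i)

/-- The disk of radius `r` around `x`. -/
def disk {d L : ℕ} (x : Torus d L) (r : ℕ) : Finset (Torus d L) :=
  Finset.univ.filter fun y => torusDist x y ≤ r

/-- The point of the torus of size `2L` that lies at the same place in space as the site `y` of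
the torus of size `L`. -/
def double {d L : ℕ} (y : Torus d L) : Torus d (2 * L) :=
  fun i => ⟨2 * (y i : ℕ), by have := (y i).isLt; omega⟩

/-! ### Many-body Hilbert spaces and local operators

The Hilbert space `⨂ x, ℂ ^ (m x)` is the space of functions `ψ : (∀ x, Fin (m x)) → ℂ` on the
product basis, with `⟪ψ, φ⟫ = star ψ ⬝ᵥ φ`. Operators are matrices in the product basis, with
the operator norm of `ℓ²`. -/

/-- The labels of the product basis of `⨂ x, ℂ ^ (m x)`. -/
abbrev Cfg {X : Type*} (m : X → ℕ) : Type _ := ∀ x, Fin (m x)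

/-- Operators on `⨂ x, ℂ ^ (m x)`. -/
abbrev Op {X : Type*} (m : X → ℕ) : Type _ := Matrix (Cfg m) (Cfg m) ℂ

/-- `O` is supported on `A`: it has the form `B ⊗ 1` with `B` acting on the factors in `A`. -/
def SupportedOn {X : Type*} [Fintype X] [DecidableEq X] {m : X → ℕ} (A : Finset X) (O : Op m) :
    Prop :=
  ∃ B : Op (fun x : A => m x), ∀ σ τ : Cfg m,
    O σ τ = if ∀ x, x ∉ A → σ x = τ x then B (fun x => σ x) (fun x => τ x) else 0

/-- `v` is a unit vector. -/
def IsUnitVec {n : Type*} [Fintype n] (v : n → ℂ) : Prop := star v ⬝ᵥ v = 1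

/-- The (real) eigenvalues of a matrix. -/
def energies {n : Type*} [Fintype n] (H : Matrix n n ℂ) : Set ℝ :=
  {μ | ∃ v : n → ℂ, v ≠ 0 ∧ H *ᵥ v = (μ : ℂ) • v}

/-- The smallest eigenvalue. -/
def groundEnergy {n : Type*} [Fintype n] (H : Matrix n n ℂ) : ℝ := sInf (energies H)

/-- The span of all eigenvectors whose energy is at most `w` above the smallest eigenvalue. -/
def lowEnergySpace {n : Type*} [Fintype n] (H : Matrix n n ℂ) (w : ℝ) : Submodule ℂ (n → ℂ) :=
  Submodule.span ℂ {v | ∃ μ : ℝ, μ ≤ groundEnergy H + w ∧ H *ᵥ v = (μ : ℂ) • v}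

/-! ### Gapped phases -/

/-- A family of local Hamiltonians `H_L = ∑ x, term L x` on the `d`-tori of all linear sizes, with
the same local dimension `D`, range `R` and strength `J` of the terms for all sizes. -/
structure LatticeModel (d : ℕ) where
  D : ℕ
  D_pos : 0 < D
  R : ℕ
  J : ℝ
  term : ∀ L : ℕ, Torus d L → Op (fun _ : Torus d L => D)
  isHermitian : ∀ L x, (term L x).IsHermitian
  supportedOn : ∀ L x, SupportedOn (disk x R) (term L x)
  norm_le : ∀ L x, ‖term L x‖ ≤ J

/-- State vectors of the model on the torus of linear size `L`. -/
abbrev LatticeModel.State {d : ℕ} (M : LatticeModel d) (L : ℕ) : Type :=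
  Cfg (fun _ : Torus d L => M.D) → ℂ

/-- The Hamiltonian of the model on the torus of linear size `L`. -/
def LatticeModel.hamiltonian {d : ℕ} (M : LatticeModel d) (L : ℕ) :
    Op (fun _ : Torus d L => M.D) :=
  ∑ x, M.term L x

/-- A gapped phase: a family of local Hamiltonians whose ground states are split by at most the
exponentially small amount `C * exp (-c * L ^ α)`, and which have a gap `Δ`, independent of the
system size, to all other states (for all sizes from some `L₀` on). -/
structure GappedPhase (d : ℕ) extends LatticeModel d where
  C : ℝ
  c : ℝ
  α : ℝ
  Δ : ℝ
  L₀ : ℕ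
  C_pos : 0 < C
  c_pos : 0 < c
  α_pos : 0 < α
  Δ_pos : 0 < Δ
  gap : ∀ L ≥ L₀, ∀ μ ∈ energies (toLatticeModel.hamiltonian L),
    μ ≤ groundEnergy (toLatticeModel.hamiltonian L) + C * Real.exp (-c * (L : ℝ) ^ α) ∨
      groundEnergy (toLatticeModel.hamiltonian L) + Δ ≤ μ

/-- The space of ground states, up to the exponentially small splitting, on the torus of linear
size `L`. -/
def GappedPhase.groundSpace {d : ℕ} (P : GappedPhase d) (L : ℕ) : Submodule ℂ (P.State L) :=
  lowEnergySpace (P.hamiltonian L) (P.C * Real.exp (-P.c * (L : ℝ) ^ P.α))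

/-- The ground state degeneracy `G(L)` on the torus of linear size `L`. -/
def GappedPhase.degeneracy {d : ℕ} (P : GappedPhase d) (L : ℕ) : ℕ :=
  Module.finrank ℂ (P.groundSpace L)

/-- Local indistinguishability: normalized operators supported on a disk of at most `L ^ α` sites
have, up to `ε = C * exp (-c * L ^ α)`, no matrix elements between orthogonal ground states and
equal expectation values in them. -/
def GappedPhase.LocallyIndistinguishable {d : ℕ} (P : GappedPhase d) : Prop :=
  ∃ (C c α : ℝ) (L₀ : ℕ), 0 < C ∧ 0 < c ∧ 0 < α ∧ ∀ L ≥ L₀,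
    ∀ g ∈ P.groundSpace L, ∀ g' ∈ P.groundSpace L,
      IsUnitVec g → IsUnitVec g' → star g ⬝ᵥ g' = 0 →
    ∀ (x : Torus d L) (r : ℕ), ((disk x r).card : ℝ) ≤ (L : ℝ) ^ α →
    ∀ O : Op (fun _ : Torus d L => P.D), SupportedOn (disk x r) O → ‖O‖ ≤ 1 →
      ‖star g ⬝ᵥ (O *ᵥ g')‖ < C * Real.exp (-c * (L : ℝ) ^ α) ∧
      ‖star g ⬝ᵥ (O *ᵥ g) - star g' ⬝ᵥ (O *ᵥ g')‖ < 2 * (C * Real.exp (-c * (L : ℝ) ^ α))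

/-! ### Quasi-local unitaries -/

/-- `f` decays faster than any power. -/
def DecaysFasterThanAnyPower (f : ℕ → ℝ) : Prop :=
  ∀ q : ℕ, ∃ C : ℝ, ∀ r : ℕ, f r * ((r : ℝ) + 1) ^ q ≤ C

/-- `U` is generated by time evolution for a time `T` by a (possibly time dependent) Hamiltonian
`K = ∑ x, ∑ r, K_{x,r}`, where `K_{x,r}` is supported on the disk of radius `r` centered at `x` and
has norm at most `f r`. (Disks of radius `N` are already the whole torus.) -/
def IsQuasiLocalUnitary {d N : ℕ} {m : Torus d N → ℕ} (T : ℝ) (f : ℕ → ℝ) (U : Op m) : Prop :=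
  ∃ (K : ℝ → Torus d N → ℕ → Op m) (V : ℝ → Op m),
    (∀ x r, ContinuousOn (fun t => K t x r) (Set.Icc 0 T)) ∧
    (∀ t ∈ Set.Icc 0 T, ∀ x r,
      (K t x r).IsHermitian ∧ SupportedOn (disk x r) (K t x r) ∧ ‖K t x r‖ ≤ f r) ∧
    V 0 = 1 ∧ V T = U ∧
    ∀ t ∈ Set.Icc 0 T, HasDerivWithinAt V
      (-Complex.I • ((∑ x, ∑ r ∈ Finset.range (N + 1), K t x r) * V t)) (Set.Icc 0 T) t

/-! ### Source RG fixed points -/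

/-- A system of degrees of freedom placed at the sites of the torus of size `2L` (the site `x`
carries `ℂ ^ (dim x)`), read in two ways. At the input it consists of one system of size `L` for
every source `k : ι`, all of them intercalated in the same space (the site `y` of a source sits
within distance `ρ` of `double y`), and of auxiliary degrees of freedom `ℂ ^ (auxIn x)`. At the
output it consists of the system of size `2L` and of auxiliary degrees of freedom
`ℂ ^ (auxOut x)`. -/
structure Intercalation {d : ℕ} {ι : Type*} (P : ι → GappedPhase d) (Q : GappedPhase d)
    (L ρ : ℕ) where
  loc : ι → Torus d L → Torus d (2 * L)
  loc_near : ∀ k y, torusDist (loc k y) (double y) ≤ ρ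
  dim : Torus d (2 * L) → ℕ
  auxIn : Torus d (2 * L) → ℕ
  auxOut : Torus d (2 * L) → ℕ
  input : ∀ x, Fin (dim x) ≃
    (∀ p : {p : ι × Torus d L // loc p.1 p.2 = x}, Fin (P p.1.1).D) × Fin (auxIn x)
  output : ∀ x, Fin (dim x) ≃ Fin Q.D × Fin (auxOut x)

/-- The tensor product of the states `φ k` of the sources and of the states `a x` of the auxiliary
input degrees of freedom. -/
def Intercalation.inputState {d : ℕ} {ι : Type*} [Fintype ι] {P : ι → GappedPhase d}
    {Q : GappedPhase d} {L ρ : ℕ} (S : Intercalation P Q L ρ) (φ : ∀ k, (P k).State L)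
    (a : ∀ x, Fin (S.auxIn x) → ℂ) : Cfg S.dim → ℂ :=
  fun w => (∏ k, φ k fun y => (S.input (S.loc k y) (w (S.loc k y))).1 ⟨(k, y), rfl⟩) *
    ∏ x, a x (S.input x (w x)).2

/-- The tensor product of a state `ψ` of the system of size `2L` and of the states `b x` of the
auxiliary output degrees of freedom. -/
def Intercalation.outputState {d : ℕ} {ι : Type*} {P : ι → GappedPhase d}
    {Q : GappedPhase d} {L ρ : ℕ} (S : Intercalation P Q L ρ) (ψ : Q.State (2 * L))
    (b : ∀ x, Fin (S.auxOut x) → ℂ) : Cfg S.dim → ℂ :=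
  fun w => ψ (fun x => (S.output x (w x)).1) * ∏ x, b x (S.output x (w x)).2

/-- For all large `L`, a ground state of `Q` of linear size `2L` can be constructed from one ground
state of linear size `L` of each of the phases `P k` and unentangled degrees of freedom (which may
be added and removed) by a quasi-local unitary, whose evolution time and tails do not depend
on `L`. -/
def ConstructibleFrom {d : ℕ} {ι : Type*} [Fintype ι] (P : ι → GappedPhase d)
    (Q : GappedPhase d) : Prop :=
  ∃ (L₀ ρ : ℕ) (T : ℝ) (f : ℕ → ℝ), 0 ≤ T ∧ DecaysFasterThanAnyPower f ∧ ∀ L ≥ L₀,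
    ∃ (S : Intercalation P Q L ρ) (U : Op S.dim) (φ : ∀ k, (P k).State L)
      (a : ∀ x, Fin (S.auxIn x) → ℂ) (ψ : Q.State (2 * L)) (b : ∀ x, Fin (S.auxOut x) → ℂ),
      IsQuasiLocalUnitary T f U ∧
      (∀ k, φ k ∈ (P k).groundSpace L ∧ IsUnitVec (φ k)) ∧ (∀ x, IsUnitVec (a x)) ∧
      (ψ ∈ Q.groundSpace (2 * L) ∧ IsUnitVec ψ) ∧ (∀ x, IsUnitVec (b x)) ∧
      U *ᵥ S.inputState φ a = S.outputState ψ b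

/-- `s` source RG fixed points. -/
def IsSourceFixedPoint {d : ℕ} (P : GappedPhase d) (s : ℕ) : Prop :=
  ConstructibleFrom (fun _ : Fin s => P) P

/-- The phase `i` of the family `P` is a generalized `s` source RG fixed point: it is obtained from
`s i j` copies of the phase `j`, for all `j`. -/
def IsGeneralizedSourceFixedPoint {d : ℕ} {Λ : Type*} (P : Λ → GappedPhase d)
    (s : Λ → Λ →₀ ℕ) (i : Λ) : Prop :=
  ConstructibleFrom (fun k : (j : (s i).support) × Fin (s i j) => P k.1) (P i)

end SourceRG

end

/-!
The lemma holds because a quasi-local unitary turns a local energy functional into one that a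
locally indistinguishable space cannot resolve.

Both readings of the intercalated system, as sources with auxiliary product states and as the
output phase with auxiliary product states, single out a subspace: `V`, the product of the ground
spaces of the sources and of `|a⟩`, and `V'`, the product of the ground space of the output phase
and of `|b⟩`. Their dimensions are the two sides of the claim. Each of them is the low energy
space of a gapped sum of polynomially many local terms, those of the Hamiltonians and one
projection onto the complement of the auxiliary state for every site, and is locally
indistinguishable (`Placement.exists_groundSpace`, `eventually_exists_groundSpace`). For the
second property, a local operator is expanded in products of matrix units of the sources, whose
compressions to the ground spaces are nearly scalar (`norm_specProj_compression_le`,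
`Placement.norm_expectation_sub_le`); the number of products is the exponential of a volume, so
the exponentially small error wins only if the region is a small power of `L` wide.

The unitary `U` maps one vector of `V` into `V'`. For a term `h` of the Hamiltonian that belongs
to `V'`, the operator `U* h U` is approximately supported on a disk of radius `L ^ β'` with
arbitrarily small `β'`, hence has nearly the same expectation value in all unit vectors of `V`. So
`U` maps all of them to vectors of low energy; if `dim V > dim V'`, some vector of `U V` would be
orthogonal to `V'` and lie above the gap. This is `finrank_le_of_isGappedSubspace`. The reverse
inequality is the same statement for `U*`, which is generated by the reversed evolution
(`IsQuasiLocalUnitary.conjTranspose`).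

Locality of `U* h U` is a Lieb-Robinson bound, `IsQuasiLocalUnitary.exists_supportedOn_near`. The
terms of range larger than `ℓ = L ^ β` are dropped from the generator, at a superpolynomially
small cost. For the remaining evolution, `norm_mkQ_heisenberg_le` bounds the distance of an
evolved observable to the algebra of a disk: the distance of a commutator `[k, a]` to a subalgebra
is at most `3 (‖k‖ e a + ‖a‖ e k)` in terms of the distances `e` of `k` and `a`, and only the
terms `k` near the support of the initial observable contribute to the derivative, so that an
induction on the number of steps of width `2ℓ` gives `(v t) ^ n / n!`.
-/

noncomputable section

namespace SourceRG

/-! ### Unitary evolution -/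

section Evolution

variable {A : Type*} [CStarAlgebra A]

/-- `V` solves the Schrödinger equation `V' = -i H(t) V` on `[0, T]`, with `V 0 = 1`. -/
def IsEvolution (T : ℝ) (H V : ℝ → A) : Prop :=
  V 0 = 1 ∧ ∀ t ∈ Set.Icc 0 T, HasDerivWithinAt V (-Complex.I • (H t * V t)) (Set.Icc 0 T) t

theorem hasDerivWithinAt_Ici_of_Icc {E : Type*} [NormedAddCommGroup E] [NormedSpace ℝ E]
    {T : ℝ} {V : ℝ → E} {V' : E} {t : ℝ} (ht : t ∈ Set.Ico 0 T)
    (h : HasDerivWithinAt V V' (Set.Icc 0 T) t) : HasDerivWithinAt V V' (Set.Ici t) t :=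
  h.mono_of_mem_nhdsWithin (Filter.mem_of_superset (Icc_mem_nhdsGE ht.2)
    (Set.Icc_subset_Icc_left ht.1))

theorem hasDerivWithinAt_star {s : Set ℝ} {V : ℝ → A} {V' : A} {t : ℝ}
    (h : HasDerivWithinAt V V' s t) :
    HasDerivWithinAt (fun t => star (V t)) (star V') s t := by
  have := ((starL' ℝ : A ≃L[ℝ] A).hasFDerivAt.comp_hasDerivWithinAt t h)
  simpa [Function.comp_def] using this

theorem IsEvolution.continuousOn {T : ℝ} {H V : ℝ → A} (h : IsEvolution T H V) :
    ContinuousOn V (Set.Icc 0 T) := fun t ht => (h.2 t ht).continuousWithinAt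

theorem IsEvolution.star_mul_self {T : ℝ} {H V : ℝ → A} (h : IsEvolution T H V)
    (hH : ∀ t ∈ Set.Icc 0 T, IsSelfAdjoint (H t)) {t : ℝ} (ht : t ∈ Set.Icc 0 T) :
    star (V t) * V t = 1 := by
  have key : ∀ t ∈ Set.Icc 0 T,
      HasDerivWithinAt (fun t => star (V t) * V t) 0 (Set.Icc 0 T) t := by
    intro t ht
    have := (hasDerivWithinAt_star (h.2 t ht)).mul (h.2 t ht)
    refine this.congr_deriv ?_
    simp [(hH t ht).star_eq, mul_assoc]
  have := constant_of_has_deriv_right_zero (f := fun t => star (V t) * V t)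
    (fun t ht => (key t ht).continuousWithinAt)
    (fun t ht => hasDerivWithinAt_Ici_of_Icc ht (key t (Set.Ico_subset_Icc_self ht))) t ht
  simpa [h.1] using this

theorem IsEvolution.mem_unitary [IsDedekindFiniteMonoid A] {T : ℝ} {H V : ℝ → A}
    (h : IsEvolution T H V) (hH : ∀ t ∈ Set.Icc 0 T, IsSelfAdjoint (H t)) {t : ℝ}
    (ht : t ∈ Set.Icc 0 T) : V t ∈ unitary A := by
  have := h.star_mul_self hH ht
  exact Unitary.mem_iff.2 ⟨this, mul_eq_one_symm this⟩

/-- The reversed evolution is generated by the Hamiltonian `-H (T - t)`. -/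
theorem IsEvolution.reverse [IsDedekindFiniteMonoid A] {T : ℝ} (hT : 0 ≤ T) {H V : ℝ → A}
    (h : IsEvolution T H V) (hH : ∀ t ∈ Set.Icc 0 T, IsSelfAdjoint (H t)) :
    IsEvolution T (fun t => -H (T - t)) (fun t => V (T - t) * star (V T)) := by
  refine ⟨by simpa using (Unitary.mem_iff.1 (h.mem_unitary hH ⟨hT, le_rfl⟩)).2, fun t ht => ?_⟩
  have ht' : T - t ∈ Set.Icc 0 T := ⟨by linarith [ht.2], by linarith [ht.1]⟩
  have h1 : HasDerivWithinAt (fun t => T - t) (-1 : ℝ) (Set.Icc 0 T) t := by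
    simpa using (hasDerivWithinAt_id t (Set.Icc 0 T)).const_sub T
  have h2 := (h.2 _ ht').scomp t h1 (fun s hs => ⟨by linarith [hs.2], by linarith [hs.1]⟩)
  have h3 := h2.mul_const (star (V T))
  refine h3.congr_deriv ?_
  simp [mul_assoc]

theorem norm_le_one_of_mem_unitary {U : A} (hU : U ∈ unitary A) : ‖U‖ ≤ 1 := by
  rcases subsingleton_or_nontrivial A with h | h
  · simp [Subsingleton.elim U 0]
  · exact (CStarRing.norm_of_mem_unitary hU).le

theorem norm_star_mul_mul_le {U : A} (hU : U ∈ unitary A) (a : A) : ‖star U * a * U‖ ≤ ‖a‖ := by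
  have h1 := norm_le_one_of_mem_unitary hU
  calc ‖star U * a * U‖ ≤ ‖star U‖ * ‖a‖ * ‖U‖ := norm_mul₃_le
    _ ≤ 1 * ‖a‖ * 1 := by rw [norm_star]; gcongr
    _ = ‖a‖ := by ring

theorem norm_star_mul_mul_sub_le {U W : A} (hU : U ∈ unitary A) (hW : W ∈ unitary A) (a : A) :
    ‖star U * a * U - star W * a * W‖ ≤ 2 * ‖W - U‖ * ‖a‖ := by
  have h1 := norm_le_one_of_mem_unitary hU
  have h2 := norm_le_one_of_mem_unitary hW
  have h3 : star U * a * U - star W * a * W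
      = -(star (W - U) * a * U) - star W * a * (W - U) := by
    simp only [star_sub]; noncomm_ring
  rw [h3]
  calc _ ≤ ‖-(star (W - U) * a * U)‖ + ‖star W * a * (W - U)‖ := norm_sub_le _ _
    _ ≤ ‖star (W - U)‖ * ‖a‖ * ‖U‖ + ‖star W‖ * ‖a‖ * ‖W - U‖ := by
      rw [norm_neg]; exact add_le_add norm_mul₃_le norm_mul₃_le
    _ ≤ ‖W - U‖ * ‖a‖ * 1 + 1 * ‖a‖ * ‖W - U‖ := by
      rw [norm_star, norm_star]; gcongr
    _ = _ := by ring

/-- A small part `P` of the Hamiltonian may be dropped. The evolution without it is `V Y`, where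
`Y' = i V* P V Y`; a single step of the Picard–Lindelöf theorem produces `Y` on all of `[0, T]`
because the generator is small. -/
theorem IsEvolution.exists_sub [IsDedekindFiniteMonoid A] {T : ℝ} (hT : 0 ≤ T)
    {H P V : ℝ → A} (h : IsEvolution T H V) (hH : ∀ t ∈ Set.Icc 0 T, IsSelfAdjoint (H t))
    (hP : ∀ t ∈ Set.Icc 0 T, IsSelfAdjoint (P t)) (hPc : ContinuousOn P (Set.Icc 0 T))
    {η : ℝ} (hη0 : 0 ≤ η) (hη : ∀ t ∈ Set.Icc 0 T, ‖P t‖ ≤ η) (hηT : 2 * η * T ≤ 1) :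
    ∃ W : ℝ → A, IsEvolution T (fun t => H t - P t) W ∧
      ∀ t ∈ Set.Icc 0 T, ‖W t - V t‖ ≤ η * T := by
  set G : ℝ → A := fun t => star (V t) * P t * V t with hG
  have hGn : ∀ t ∈ Set.Icc 0 T, ‖G t‖ ≤ η := fun t ht =>
    (norm_star_mul_mul_le (h.mem_unitary hH ht) _).trans (hη t ht)
  have hGs : ∀ t ∈ Set.Icc 0 T, IsSelfAdjoint (-G t) := fun t ht => by
    simp [IsSelfAdjoint, hG, (hP t ht).star_eq, mul_assoc]
  have hGc : ContinuousOn G (Set.Icc 0 T) :=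
    ((h.continuousOn.star).mul hPc).mul h.continuousOn
  have hpl : IsPicardLindelof (fun t (Y : A) => -Complex.I • (-G t * Y))
      (⟨0, le_rfl, hT⟩ : Set.Icc 0 T) (1 : A) 1 0 (2 * ⟨η, hη0⟩) ⟨η, hη0⟩ := by
    refine ⟨fun t ht => ?_, fun x _ => ?_, fun t ht x hx => ?_, ?_⟩
    · refine LipschitzOnWith.of_dist_le_mul fun x _ y _ => ?_
      rw [dist_eq_norm, dist_eq_norm, ← smul_sub, ← mul_sub, norm_smul]
      simp only [norm_neg, Complex.norm_I, one_mul]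
      refine (norm_mul_le _ _).trans ?_
      rw [norm_neg]
      exact mul_le_mul_of_nonneg_right (hGn t ht) (norm_nonneg _)
    · exact ((hGc.neg).mul continuousOn_const).const_smul _
    · rw [norm_smul]
      simp only [norm_neg, Complex.norm_I, one_mul]
      have hx2 : ‖x‖ ≤ 2 := by
        have h1 : ‖(1 : A)‖ ≤ 1 := norm_le_one_of_mem_unitary (one_mem _)
        have h2 : ‖x - 1‖ ≤ 1 := by simpa [dist_eq_norm] using hx
        calc ‖x‖ = ‖(x - 1) + 1‖ := by simp
          _ ≤ ‖x - 1‖ + ‖(1 : A)‖ := norm_add_le _ _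
          _ ≤ 2 := by linarith
      calc ‖-G t * x‖ ≤ ‖-G t‖ * ‖x‖ := norm_mul_le _ _
        _ ≤ η * 2 := by rw [norm_neg]; gcongr; exact hGn t ht
        _ = _ := by rw [mul_comm]; rfl
    · simpa [hT] using! hηT
  obtain ⟨Y, hY0, hY⟩ := hpl.exists_eq_forall_mem_Icc_hasDerivWithinAt₀
  have hYe : IsEvolution T (fun t => -G t) Y := ⟨hY0, hY⟩
  refine ⟨fun t => V t * Y t, ⟨by simp [h.1, hYe.1], fun t ht => ?_⟩, fun t ht => ?_⟩
  · have hu := (Unitary.mem_iff.1 (h.mem_unitary hH ht)).2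
    have := (h.2 t ht).mul (hY t ht)
    refine this.congr_deriv ?_
    have e : V t * (-G t * Y t) = -(P t * (V t * Y t)) := by
      simp only [hG]
      calc _ = -((V t * star (V t)) * (P t * (V t * Y t))) := by noncomm_ring
        _ = _ := by rw [hu, one_mul]
    rw [mul_smul_comm, e, smul_mul_assoc, ← smul_add]
    congr 1
    noncomm_ring
  · have hd : ‖Y t - Y 0‖ ≤ η * (t - 0) := by
      refine norm_image_sub_le_of_norm_deriv_right_le_segment hYe.continuousOn
        (fun s hs => hasDerivWithinAt_Ici_of_Icc hs (hY s (Set.Ico_subset_Icc_self hs)))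
        (fun s hs => ?_) t ht
      have hs' := Set.Ico_subset_Icc_self hs
      rw [norm_smul]
      simp only [norm_neg, Complex.norm_I, one_mul]
      calc ‖-G s * Y s‖ ≤ ‖-G s‖ * ‖Y s‖ := norm_mul_le _ _
        _ ≤ η * 1 := by
          rw [norm_neg]
          exact mul_le_mul (hGn s hs') (norm_le_one_of_mem_unitary (hYe.mem_unitary hGs hs'))
            (norm_nonneg _) hη0
        _ = η := mul_one _
    have e : V t * Y t - V t = V t * (Y t - Y 0) := by rw [hYe.1]; noncomm_ring
    calc ‖V t * Y t - V t‖ = ‖V t * (Y t - Y 0)‖ := by rw [e]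
      _ ≤ ‖V t‖ * ‖Y t - Y 0‖ := norm_mul_le _ _
      _ ≤ 1 * (η * (t - 0)) :=
        mul_le_mul (norm_le_one_of_mem_unitary (h.mem_unitary hH ht)) hd (norm_nonneg _) zero_le_one
      _ ≤ η * T := by rw [one_mul, sub_zero]; exact mul_le_mul_of_nonneg_left ht.2 hη0

theorem IsEvolution.hasDerivWithinAt_heisenberg {T : ℝ} {H V : ℝ → A} (h : IsEvolution T H V)
    (hH : ∀ t ∈ Set.Icc 0 T, IsSelfAdjoint (H t)) (a : A) {t : ℝ} (ht : t ∈ Set.Icc 0 T) :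
    HasDerivWithinAt (fun t => star (V t) * a * V t)
      (Complex.I • (star (V t) * (H t * a - a * H t) * V t)) (Set.Icc 0 T) t := by
  have := ((hasDerivWithinAt_star (h.2 t ht)).mul_const a).mul (h.2 t ht)
  refine this.congr_deriv ?_
  simp only [star_smul, star_mul, (hH t ht).star_eq, star_neg, Complex.star_def, Complex.conj_I, mul_neg,
    neg_neg, smul_mul_assoc, mul_smul_comm, neg_smul]
  rw [← sub_eq_add_neg, ← smul_sub]
  congr 1
  noncomm_ring

end Evolution

/-! ### Operators supported on a set of sites -/

section Support

variable {X : Type*} [Fintype X] [DecidableEq X] {m : X → ℕ}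

open Kronecker in
theorem supportedOn_iff_exists_kronecker {S : Finset X} {O : Op m} :
    SupportedOn S O ↔ ∃ B : Op (fun x : S => m x),
      O = (B ⊗ₖ (1 : Matrix (∀ x : {x // x ∉ S}, Fin (m x)) _ ℂ)).submatrix
        (Equiv.piEquivPiSubtypeProd (· ∈ S) fun x => Fin (m x))
        (Equiv.piEquivPiSubtypeProd (· ∈ S) fun x => Fin (m x)) := by
  refine exists_congr fun B => ?_
  rw [← Matrix.ext_iff]
  refine forall₂_congr fun σ τ => ?_
  have h : (∀ x, x ∉ S → σ x = τ x) ↔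
      (fun x : {x // x ∉ S} => σ x) = (fun x : {x // x ∉ S} => τ x) := by
    simp [funext_iff]
  simp only [Matrix.submatrix_apply, Matrix.kroneckerMap_apply, Matrix.one_apply,
    Equiv.piEquivPiSubtypeProd_apply, mul_ite, mul_one, mul_zero, h]

/-- A description of `SupportedOn` without the operator on the factors in `S`. -/
theorem supportedOn_iff {S : Finset X} {O : Op m} :
    SupportedOn S O ↔
      (∀ σ τ, (∃ x, x ∉ S ∧ σ x ≠ τ x) → O σ τ = 0) ∧
      ∀ σ τ σ' τ', (∀ x, x ∉ S → σ x = τ x) → (∀ x, x ∉ S → σ' x = τ' x) →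
        (∀ x ∈ S, σ x = σ' x) → (∀ x ∈ S, τ x = τ' x) → O σ τ = O σ' τ' := by
  constructor
  · rintro ⟨B, hB⟩
    refine ⟨fun σ τ ⟨x, hx, h⟩ => ?_, fun σ τ σ' τ' h h' hσ hτ => ?_⟩
    · rw [hB, if_neg fun H => h (H x hx)]
    · rw [hB, hB, if_pos h, if_pos h']
      congr 1
      · funext x; exact hσ x x.2
      · funext x; exact hτ x x.2
  · rintro ⟨h0, h1⟩
    rcases isEmpty_or_nonempty (Cfg m) with he | ⟨⟨w⟩⟩
    · exact ⟨0, fun σ => he.elim σ⟩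
    · let glue : Cfg (fun x : S => m x) → Cfg m := fun ρ x => if h : x ∈ S then ρ ⟨x, h⟩ else w x
      refine ⟨fun ρ κ => O (glue ρ) (glue κ), fun σ τ => ?_⟩
      split_ifs with h
      · refine h1 _ _ _ _ h (fun x hx => ?_) (fun x hx => ?_) (fun x hx => ?_) <;> simp [glue, hx]
      · push Not at h
        exact h0 _ _ h

theorem SupportedOn.mono {S S' : Finset X} (h : S ⊆ S') {O : Op m} (hO : SupportedOn S O) :
    SupportedOn S' O := by
  rw [supportedOn_iff] at hO ⊢
  refine ⟨fun σ τ ⟨x, hx, hne⟩ => hO.1 σ τ ⟨x, fun h' => hx (h h'), hne⟩,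
    fun σ τ σ' τ' h1 h2 h3 h4 => ?_⟩
  by_cases H : ∀ x, x ∉ S → σ x = τ x
  · refine hO.2 _ _ _ _ H (fun x hx => ?_) (fun x hx => h3 x (h hx)) (fun x hx => h4 x (h hx))
    by_cases hx' : x ∈ S'
    · rw [← h3 x hx', ← h4 x hx', H x hx]
    · exact h2 x hx'
  · push Not at H
    obtain ⟨x, hx, hne⟩ := H
    rw [hO.1 σ τ ⟨x, hx, hne⟩, hO.1 σ' τ' ⟨x, hx, ?_⟩]
    have hx' : x ∈ S' := by
      by_contra hx'; exact hne (h1 x hx')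
    rwa [← h3 x hx', ← h4 x hx']

/-- The algebra of the operators supported on `S`. -/
def localAlgebra (m : X → ℕ) (S : Finset X) : Subalgebra ℂ (Op m) where
  carrier := {O | SupportedOn S O}
  mul_mem' := by
    intro O O' hO hO'
    obtain ⟨B, rfl⟩ := supportedOn_iff_exists_kronecker.1 hO
    obtain ⟨B', rfl⟩ := supportedOn_iff_exists_kronecker.1 hO'
    refine supportedOn_iff_exists_kronecker.2 ⟨B * B', ?_⟩
    rw [Matrix.submatrix_mul_equiv, ← Matrix.mul_kronecker_mul, one_mul]
  add_mem' := by
    intro O O' hO hO'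
    obtain ⟨B, rfl⟩ := supportedOn_iff_exists_kronecker.1 hO
    obtain ⟨B', rfl⟩ := supportedOn_iff_exists_kronecker.1 hO'
    refine supportedOn_iff_exists_kronecker.2 ⟨B + B', ?_⟩
    rw [Matrix.add_kronecker, Matrix.submatrix_add]
    rfl
  algebraMap_mem' := by
    intro c
    refine supportedOn_iff_exists_kronecker.2 ⟨c • 1, ?_⟩
    rw [Matrix.smul_kronecker, Matrix.one_kronecker_one, Matrix.submatrix_smul, Pi.smul_apply,
      Pi.smul_apply, Matrix.submatrix_one_equiv, Algebra.algebraMap_eq_smul_one]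

theorem SupportedOn.commute {S S' : Finset X} (h : Disjoint S S') {O O' : Op m}
    (hO : SupportedOn S O) (hO' : SupportedOn S' O') : O * O' = O' * O := by
  rw [supportedOn_iff] at hO hO'
  have hd : ∀ x ∈ S, x ∉ S' := fun x hx => Finset.disjoint_left.1 h hx
  have hd' : ∀ x ∈ S', x ∉ S := fun x hx => Finset.disjoint_right.1 h hx
  ext σ τ
  -- in both products a single intermediate configuration contributes
  set p : Cfg m := fun x => if x ∈ S then τ x else σ x with hp
  set q : Cfg m := fun x => if x ∈ S' then τ x else σ x with hq
  have e1 : (O * O') σ τ = O σ p * O' p τ := by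
    rw [Matrix.mul_apply]
    refine Finset.sum_eq_single p (fun w _ hw => ?_) (by simp)
    obtain ⟨x, hx⟩ := Function.ne_iff.1 hw
    by_cases hxS : x ∈ S
    · rw [hO'.1 w τ ⟨x, hd x hxS, by simpa [hp, hxS] using hx⟩, mul_zero]
    · rw [hO.1 σ w ⟨x, hxS, by simpa [hp, hxS] using hx.symm⟩, zero_mul]
  have e2 : (O' * O) σ τ = O' σ q * O q τ := by
    rw [Matrix.mul_apply]
    refine Finset.sum_eq_single q (fun w _ hw => ?_) (by simp)
    obtain ⟨x, hx⟩ := Function.ne_iff.1 hw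
    by_cases hxS : x ∈ S'
    · rw [hO.1 w τ ⟨x, hd' x hxS, by simpa [hq, hxS] using hx⟩, mul_zero]
    · rw [hO'.1 σ w ⟨x, hxS, by simpa [hq, hxS] using hx.symm⟩, zero_mul]
  rw [e1, e2]
  by_cases H : ∀ x, x ∉ S → x ∉ S' → σ x = τ x
  · have a1 : O σ p = O q τ := by
      refine hO.2 _ _ _ _ (fun x hx => by simp [hp, hx]) (fun x hx => ?_) (fun x hx => ?_)
        (fun x hx => by simp [hp, hx])
      · by_cases hx' : x ∈ S' <;> simp [hq, hx', H x hx]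
      · simp [hq, hd x hx]
    have a2 : O' p τ = O' σ q := by
      refine hO'.2 _ _ _ _ (fun x hx => ?_) (fun x hx => by simp [hq, hx]) (fun x hx => ?_)
        (fun x hx => by simp [hq, hx])
      · by_cases hx' : x ∈ S
        · simp [hp, hx']
        · simp [hp, hx', H x hx' hx]
      · simp [hp, hd' x hx]
    rw [a1, a2, mul_comm]
  · push Not at H
    obtain ⟨x, hx, hx', hne⟩ := H
    rw [hO'.1 p τ ⟨x, hx', by simpa [hp, hx] using hne⟩,
      hO.1 q τ ⟨x, hx, by simpa [hq, hx'] using hne⟩, mul_zero, mul_zero]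

end Support

/-! ### Geometry of the torus -/

section Geometry

variable {d L : ℕ}

theorem cycleDist_comm (a b : Fin L) : cycleDist a b = cycleDist b a := by
  simp [cycleDist, Nat.dist_comm]

theorem cycleDist_self (a : Fin L) : cycleDist a a = 0 := by simp [cycleDist]

theorem cycleDist_triangle (a b c : Fin L) : cycleDist a c ≤ cycleDist a b + cycleDist b c := by
  have := a.isLt; have := b.isLt; have := c.isLt
  simp only [cycleDist, Nat.dist]
  omega

theorem torusDist_comm (x y : Torus d L) : torusDist x y = torusDist y x := by
  simp [torusDist, cycleDist_comm]

theorem torusDist_self (x : Torus d L) : torusDist x x = 0 := by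
  simp [torusDist, cycleDist_self]

theorem torusDist_le_iff {x y : Torus d L} {r : ℕ} :
    torusDist x y ≤ r ↔ ∀ i, cycleDist (x i) (y i) ≤ r := by
  simp [torusDist, Finset.sup_le_iff]

theorem torusDist_triangle (x y z : Torus d L) :
    torusDist x z ≤ torusDist x y + torusDist y z := by
  rw [torusDist_le_iff]
  intro i
  exact (cycleDist_triangle _ (y i) _).trans
    (add_le_add (torusDist_le_iff.1 le_rfl i) (torusDist_le_iff.1 le_rfl i))

theorem mem_disk {x y : Torus d L} {r : ℕ} : y ∈ disk x r ↔ torusDist x y ≤ r := by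
  simp [disk]

theorem disk_subset_disk {x y : Torus d L} {r s : ℕ} (h : torusDist x y + r ≤ s) :
    disk y r ⊆ disk x s := fun z hz => by
  rw [mem_disk] at hz ⊢
  exact (torusDist_triangle x y z).trans (by omega)

theorem card_cycleDist_le (a : Fin L) (r : ℕ) :
    (Finset.univ.filter fun b : Fin L => cycleDist a b ≤ r).card ≤ 2 * r + 1 := by
  have hL : 0 < L := a.pos
  by_cases hr : L ≤ 2 * r + 1
  · exact (Finset.card_le_univ _).trans (by simpa using hr)
  have hsub : (Finset.univ.filter fun b : Fin L => cycleDist a b ≤ r) ⊆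
      (Finset.range (2 * r + 1)).image fun i => (⟨(a + i + (L - r)) % L, Nat.mod_lt _ hL⟩ : Fin L) := by
    intro b hb
    replace hb := (Finset.mem_filter.1 hb).2
    simp only [cycleDist, Nat.dist] at hb
    simp only [Finset.mem_image, Finset.mem_range, Fin.ext_iff]
    have ha := a.isLt; have hb' := b.isLt
    -- the index is `i = b - a + r` modulo `L`
    have : ∃ i < 2 * r + 1, a.1 + i + (L - r) = b ∨ a.1 + i + (L - r) = b + L ∨
        a.1 + i + (L - r) = b + L + L := by
      by_cases h1 : a.1 ≤ b + r ∧ b ≤ a.1 + r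
      · exact ⟨b + r - a, by omega, by omega⟩
      · by_cases h2 : a.1 ≤ b
        · exact ⟨b + r - (a + L), by omega, by omega⟩
        · exact ⟨b + r + L - a, by omega, by omega⟩
    obtain ⟨i, hi, h | h | h⟩ := this
    · exact ⟨i, hi, by rw [h, Nat.mod_eq_of_lt hb']⟩
    · exact ⟨i, hi, by rw [h, Nat.add_mod_right, Nat.mod_eq_of_lt hb']⟩
    · exact ⟨i, hi, by rw [h, Nat.add_mod_right, Nat.add_mod_right, Nat.mod_eq_of_lt hb']⟩
  exact (Finset.card_le_card hsub).trans (Finset.card_image_le.trans (by simp))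

theorem card_disk_le (x : Torus d L) (r : ℕ) : (disk x r).card ≤ (2 * r + 1) ^ d := by
  have hsub : disk x r ⊆ Fintype.piFinset fun i =>
      Finset.univ.filter fun b : Fin L => cycleDist (x i) b ≤ r := by
    intro y hy
    rw [mem_disk, torusDist_le_iff] at hy
    simpa [Fintype.mem_piFinset] using hy
  calc (disk x r).card ≤ _ := Finset.card_le_card hsub
    _ = ∏ i, (Finset.univ.filter fun b : Fin L => cycleDist (x i) b ≤ r).card :=
      Fintype.card_piFinset _
    _ ≤ ∏ _i : Fin d, (2 * r + 1) := Finset.prod_le_prod' fun i _ => card_cycleDist_le _ _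
    _ = _ := by simp

theorem torusDist_double (x y : Torus d L) :
    torusDist (double x) (double y) = 2 * torusDist x y := by
  have h : ∀ i, cycleDist (double x i) (double y i) = 2 * cycleDist (x i) (y i) := fun i => by
    have := (x i).isLt; have := (y i).isLt
    simp only [cycleDist, Nat.dist, double]
    omega
  refine le_antisymm (torusDist_le_iff.2 fun i => ?_) ?_
  · rw [h]
    exact Nat.mul_le_mul_left _ (torusDist_le_iff.1 le_rfl i)
  · have : torusDist x y ≤ torusDist (double x) (double y) / 2 := torusDist_le_iff.2 fun i => by
      have := torusDist_le_iff.1 (le_refl (torusDist (double x) (double y))) i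
      rw [h] at this
      omega
    omega

end Geometry

/-! ### Lieb–Robinson bound -/

section Quotient

variable {A : Type*} [CStarAlgebra A]

/-- The distance of a product to a subalgebra. -/
theorem norm_mkQ_mul_le (S : Subalgebra ℂ A) (a b : A) :
    ‖S.toSubmodule.mkQ (a * b)‖ ≤
      ‖a‖ * ‖S.toSubmodule.mkQ b‖ + ‖S.toSubmodule.mkQ a‖ * (2 * ‖b‖) := by
  set Q := S.toSubmodule.mkQ
  have key : ∀ ε : ℝ, 0 < ε →
      ‖Q (a * b)‖ ≤ ‖a‖ * (‖Q b‖ + ε) + (‖Q a‖ + ε) * (2 * ‖b‖ + ε) := by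
    intro ε hε
    obtain ⟨a', ha', han⟩ := Submodule.Quotient.norm_mk_lt (Q a) hε
    obtain ⟨b', hb', hbn⟩ := Submodule.Quotient.norm_mk_lt (Q b) hε
    have ha : a - a' ∈ S.toSubmodule := (Submodule.Quotient.eq _).1 ha'.symm
    have hb : b - b' ∈ S.toSubmodule := (Submodule.Quotient.eq _).1 hb'.symm
    -- `a'`, `b'` are representatives of nearly minimal norm, so `(a - a') * (b - b')` is in `S`
    have hab : Q (a * b) = Q (a * b' + a' * (b - b')) := by
      refine (Submodule.Quotient.eq _).2 ?_
      have : a * b - (a * b' + a' * (b - b')) = (a - a') * (b - b') := by noncomm_ring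
      rw [this]
      exact S.mul_mem ha hb
    have hQb : ‖Q b‖ ≤ ‖b‖ := Submodule.Quotient.norm_mk_le _ b
    have hbb : ‖b - b'‖ ≤ 2 * ‖b‖ + ε := (norm_sub_le _ _).trans (by linarith)
    calc ‖Q (a * b)‖ ≤ ‖a * b' + a' * (b - b')‖ := hab ▸ Submodule.Quotient.norm_mk_le _ _
      _ ≤ ‖a‖ * ‖b'‖ + ‖a'‖ * ‖b - b'‖ :=
        (norm_add_le _ _).trans (add_le_add (norm_mul_le _ _) (norm_mul_le _ _))
      _ ≤ _ := by gcongr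
  have hc : Continuous fun ε : ℝ => ‖a‖ * (‖Q b‖ + ε) + (‖Q a‖ + ε) * (2 * ‖b‖ + ε) := by
    fun_prop
  have ht : Filter.Tendsto (fun ε : ℝ => ‖a‖ * (‖Q b‖ + ε) + (‖Q a‖ + ε) * (2 * ‖b‖ + ε))
      (nhdsWithin 0 (Set.Ioi 0)) (nhds (‖a‖ * ‖Q b‖ + ‖Q a‖ * (2 * ‖b‖))) := by
    simpa using (hc.tendsto 0).mono_left nhdsWithin_le_nhds
  exact ge_of_tendsto ht (Filter.eventually_of_mem self_mem_nhdsWithin key)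

theorem norm_mkQ_commutator_le (S : Subalgebra ℂ A) (a b : A) :
    ‖S.toSubmodule.mkQ (a * b - b * a)‖ ≤
      3 * (‖a‖ * ‖S.toSubmodule.mkQ b‖ + ‖b‖ * ‖S.toSubmodule.mkQ a‖) := by
  have h1 := norm_mkQ_mul_le S a b
  have h2 := norm_mkQ_mul_le S b a
  rw [map_sub]
  refine (norm_sub_le _ _).trans ?_
  linarith

end Quotient

section LiebRobinson

variable {d N : ℕ} {m : Torus d N → ℕ}

theorem commutator_eq_sum_near {ℓ : ℕ} {s : Finset ℕ} (hs : ∀ r ∈ s, r ≤ ℓ)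
    {k : Torus d N → ℕ → Op m} (hk : ∀ x, ∀ r, SupportedOn (disk x r) (k x r))
    {x : Torus d N} {a : Op m} (ha : SupportedOn (disk x ℓ) a) :
    (∑ y, ∑ r ∈ s, k y r) * a - a * (∑ y, ∑ r ∈ s, k y r) =
      ∑ y ∈ disk x (2 * ℓ), ∑ r ∈ s, (k y r * a - a * k y r) := by
  simp only [Finset.sum_mul, Finset.mul_sum, ← Finset.sum_sub_distrib]
  symm
  refine Finset.sum_subset (Finset.subset_univ _) fun y _ hy => Finset.sum_eq_zero fun r hr => ?_
  rw [sub_eq_zero]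
  refine SupportedOn.commute (Finset.disjoint_left.2 fun z hz hz' => hy ?_) (hk y r) ha
  rw [mem_disk] at hz hz' ⊢
  rw [torusDist_comm] at hz
  have := torusDist_triangle x z y
  have := hs r hr
  omega

/-- **Lieb–Robinson bound** for an evolution generated by terms of range at most `ℓ`. Every term
that does not commute with an operator on `disk x ℓ` is supported on a disk of the same radius with
center at distance at most `2 ℓ`, so each of the `n` steps to the boundary of the region costs
one factor of the velocity times the time, with the factorial from the iterated integration. -/
theorem norm_mkQ_heisenberg_le {T : ℝ} {ℓ : ℕ} {s : Finset ℕ} (hs : ∀ r ∈ s, r ≤ ℓ)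
    {f : ℕ → ℝ} {F : ℝ} (hF : ∑ r ∈ s, f r ≤ F) {k : ℝ → Torus d N → ℕ → Op m}
    (hk : ∀ t ∈ Set.Icc 0 T, ∀ x r,
      (k t x r).IsHermitian ∧ SupportedOn (disk x r) (k t x r) ∧ ‖k t x r‖ ≤ f r)
    {W : ℝ → Op m} (hW : IsEvolution T (fun t => ∑ x, ∑ r ∈ s, k t x r) W)
    (x₀ : Torus d N) (R n : ℕ) :
    ∀ x, torusDist x₀ x + ℓ + 2 * ℓ * n ≤ R → ∀ a, SupportedOn (disk x ℓ) a →
      ∀ t ∈ Set.Icc 0 T,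
        ‖(localAlgebra m (disk x₀ R)).toSubmodule.mkQ (star (W t) * a * W t)‖ ≤
          ‖a‖ * ((6 * (4 * ℓ + 1 : ℕ) ^ d * F * t) ^ n / n.factorial) := by
  set S := localAlgebra m (disk x₀ R)
  set Q := S.toSubmodule.mkQ with hQ
  set v : ℝ := 6 * (4 * ℓ + 1 : ℕ) ^ d * F with hv
  have hH : ∀ t ∈ Set.Icc 0 T, IsSelfAdjoint (∑ x, ∑ r ∈ s, k t x r) := fun t ht =>
    isSelfAdjoint_sum _ fun x _ => isSelfAdjoint_sum _ fun r _ => (hk t ht x r).1.isSelfAdjoint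
  have hWu : ∀ t ∈ Set.Icc 0 T, W t ∈ unitary (Op m) := fun t ht => hW.mem_unitary hH ht
  induction n with
  | zero =>
    intro x _ a _ t ht
    exact (Submodule.Quotient.norm_mk_le _ _).trans
      ((norm_star_mul_mul_le (hWu t ht) a).trans_eq (by simp))
  | succ n ih =>
    intro x hx a ha
    have : IsClosed (S.toSubmodule : Set (Op m)) := Submodule.closed_of_finiteDimensional _
    have hT0 : ∀ t ∈ Set.Icc 0 T, HasDerivWithinAt (fun t => Q (star (W t) * a * W t))
        (Q (Complex.I • (star (W t) * ((∑ x, ∑ r ∈ s, k t x r) * a -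
          a * (∑ x, ∑ r ∈ s, k t x r)) * W t))) (Set.Icc 0 T) t := by
      intro t ht
      have h1 := hW.hasDerivWithinAt_heisenberg hH a ht
      let Ql : Op m →L[ℝ] (Op m ⧸ S.toSubmodule) :=
        LinearMap.mkContinuous (Q.restrictScalars ℝ) 1 fun y => by
          exact (Submodule.Quotient.norm_mk_le _ y).trans_eq (one_mul _).symm
      exact Ql.hasFDerivAt.comp_hasDerivWithinAt t h1
    refine image_norm_le_of_norm_deriv_right_le_deriv_boundary
      (B' := fun t => ‖a‖ * (v * ((v * t) ^ n / n.factorial)))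
      (fun t ht => (hT0 t ht).continuousWithinAt)
      (fun t ht => hasDerivWithinAt_Ici_of_Icc ht (hT0 t (Set.Ico_subset_Icc_self ht))) ?_ ?_ ?_
    · have h0 : Q a = 0 := by
        refine (Submodule.Quotient.mk_eq_zero _).2 (ha.mono (disk_subset_disk ?_))
        exact le_trans (Nat.le_add_right _ _) hx
      simp [hW.1, h0]
    · intro t
      have h1 : HasDerivAt (fun t : ℝ => (v * t) ^ (n + 1)) ((n + 1 : ℕ) * (v * t) ^ n * v) t := by
        refine (((hasDerivAt_id t).const_mul v).pow (n + 1)).congr_deriv ?_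
        simp
      refine ((h1.div_const ((n + 1).factorial : ℝ)).const_mul ‖a‖).congr_deriv ?_
      rw [Nat.factorial_succ]
      push_cast
      have : (n.factorial : ℝ) ≠ 0 := by positivity
      field_simp
    · intro t ht
      replace ht := Set.Ico_subset_Icc_self ht
      obtain ⟨hu1, hu2⟩ := Unitary.mem_iff.1 (hWu t ht)
      rw [map_smul, norm_smul, Complex.norm_I, one_mul,
        commutator_eq_sum_near hs (fun x r => (hk t ht x r).2.1) ha]
      simp only [Finset.mul_sum, Finset.sum_mul, map_sum]
      set b : ℝ := (v * t) ^ n / n.factorial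
      have hterm : ∀ y ∈ disk x (2 * ℓ), ∀ r ∈ s,
          ‖Q (star (W t) * (k t y r * a - a * k t y r) * W t)‖ ≤ f r * (6 * ‖a‖ * b) := by
        intro y hy r hr
        have e : star (W t) * (k t y r * a - a * k t y r) * W t =
            (star (W t) * k t y r * W t) * (star (W t) * a * W t) -
              (star (W t) * a * W t) * (star (W t) * k t y r * W t) := by
          calc _ = star (W t) * k t y r * 1 * a * W t - star (W t) * a * 1 * k t y r * W t := by
                noncomm_ring
            _ = _ := by rw [← hu2]; noncomm_ring
        rw [e]
        have hd : ∀ z, torusDist x z ≤ 2 * ℓ → torusDist x₀ z + ℓ + 2 * ℓ * n ≤ R := by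
          intro z hz
          have := torusDist_triangle x₀ x z
          have e : 2 * ℓ * (n + 1) = 2 * ℓ * n + 2 * ℓ := by ring
          omega
        have h1 := ih x (hd x (by simp [torusDist_self])) a ha t ht
        have h2 := ih y (hd y (mem_disk.1 hy)) (k t y r) ((hk t ht y r).2.1.mono
          (disk_subset_disk (by simpa [torusDist_self] using hs r hr))) t ht
        have h3 := norm_star_mul_mul_le (hWu t ht) (k t y r)
        have h4 := norm_star_mul_mul_le (hWu t ht) a
        have h5 := (hk t ht y r).2.2
        refine (norm_mkQ_commutator_le S _ _).trans ?_
        have hb : 0 ≤ ‖a‖ * b := (norm_nonneg _).trans h1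
        have h6 := mul_le_mul h3 h1 (norm_nonneg _) (norm_nonneg _)
        have h7 := mul_le_mul h4 h2 (norm_nonneg _) (norm_nonneg _)
        have h8 : ‖k t y r‖ * (‖a‖ * b) ≤ f r * (‖a‖ * b) := mul_le_mul_of_nonneg_right h5 hb
        calc _ ≤ 3 * (‖k t y r‖ * (‖a‖ * b) + ‖a‖ * (‖k t y r‖ * b)) := by gcongr
          _ = 6 * (‖k t y r‖ * (‖a‖ * b)) := by ring
          _ ≤ 6 * (f r * (‖a‖ * b)) := by gcongr
          _ = _ := by ring
      have hb0 : 0 ≤ ‖a‖ * b := (norm_nonneg _).trans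
        (ih x (by have e : 2 * ℓ * (n + 1) = 2 * ℓ * n + 2 * ℓ := by ring
                  omega) a ha t ht)
      calc _ ≤ ∑ y ∈ disk x (2 * ℓ), ∑ r ∈ s, f r * (6 * ‖a‖ * b) := by
            refine (norm_sum_le _ _).trans (Finset.sum_le_sum fun y hy => ?_)
            exact (norm_sum_le _ _).trans (Finset.sum_le_sum fun r hr => hterm y hy r hr)
        _ = (disk x (2 * ℓ)).card * ((∑ r ∈ s, f r) * (6 * (‖a‖ * b))) := by
            rw [Finset.sum_const, nsmul_eq_mul, Finset.sum_mul]
            simp only [mul_assoc]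
        _ ≤ ((4 * ℓ + 1 : ℕ) ^ d : ℝ) * (F * (6 * (‖a‖ * b))) := by
            have hc : ((disk x (2 * ℓ)).card : ℝ) ≤ ((4 * ℓ + 1 : ℕ) ^ d : ℝ) := by
              have := card_disk_le x (2 * ℓ)
              rw [show 2 * (2 * ℓ) + 1 = 4 * ℓ + 1 by ring] at this
              exact_mod_cast this
            have hs0 : 0 ≤ ∑ r ∈ s, f r := Finset.sum_nonneg fun r _ =>
              (norm_nonneg _).trans (hk t ht x r).2.2
            have hb6 : 0 ≤ 6 * (‖a‖ * b) := by linarith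
            gcongr
        _ = ‖a‖ * (v * b) := by rw [hv]; ring

/-- The evolved observable `U* a U` of a quasi-local unitary `U` is approximately local. -/
theorem IsQuasiLocalUnitary.exists_supportedOn_near {T : ℝ} (hT : 0 ≤ T) {f : ℕ → ℝ} {U : Op m}
    (hU : IsQuasiLocalUnitary T f U) {ℓ : ℕ} {F η : ℝ}
    (hF : ∑ r ∈ Finset.range (ℓ + 1), f r ≤ F)
    (hη : (N : ℝ) ^ d * ∑ r ∈ Finset.range (N + 1) with ℓ < r, f r ≤ η) (hηT : 2 * η * T ≤ 1)
    (n : ℕ) {x : Torus d N} {a : Op m} (ha : SupportedOn (disk x ℓ) a) {ε : ℝ} (hε : 0 < ε) :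
    ∃ a', SupportedOn (disk x (ℓ + 2 * ℓ * n)) a' ∧ ‖Uᴴ * a * U - a'‖ ≤
      ‖a‖ * ((6 * (4 * ℓ + 1 : ℕ) ^ d * F * T) ^ n / n.factorial + 2 * (η * T)) + ε := by
  obtain ⟨k, V, hkc, hk, hV0, hVT, hV⟩ := hU
  have hf : ∀ r, 0 ≤ f r := fun r =>
    (norm_nonneg _).trans (hk 0 ⟨le_rfl, hT⟩ x r).2.2
  have hVe : IsEvolution T (fun t => ∑ x, ∑ r ∈ Finset.range (N + 1), k t x r) V := ⟨hV0, hV⟩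
  have hsa : ∀ (s : Finset ℕ), ∀ t ∈ Set.Icc 0 T, IsSelfAdjoint (∑ x, ∑ r ∈ s, k t x r) :=
    fun s t ht => isSelfAdjoint_sum _ fun x _ =>
      isSelfAdjoint_sum _ fun r _ => (hk t ht x r).1.isSelfAdjoint
  have hη0 : 0 ≤ η := le_trans (mul_nonneg (by positivity)
    (Finset.sum_nonneg fun r _ => hf r)) hη
  obtain ⟨W, hW, hWV⟩ := hVe.exists_sub hT (hsa _)
    (P := fun t => ∑ x, ∑ r ∈ Finset.range (N + 1) with ℓ < r, k t x r) (hsa _)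
    (continuousOn_finsetSum _ fun x _ => continuousOn_finsetSum _ fun r _ => hkc x r) hη0
    (fun t ht => by
      refine le_trans ?_ hη
      calc _ ≤ ∑ x : Torus d N, ∑ r ∈ Finset.range (N + 1) with ℓ < r, f r :=
            (norm_sum_le _ _).trans (Finset.sum_le_sum fun x _ =>
              (norm_sum_le _ _).trans (Finset.sum_le_sum fun r _ => (hk t ht x r).2.2))
        _ = _ := by simp) hηT
  have hW' : IsEvolution T
      (fun t => ∑ x, ∑ r ∈ Finset.range (N + 1) with ¬ ℓ < r, k t x r) W := by
    convert hW using 2 with t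
    rw [eq_sub_iff_add_eq, ← Finset.sum_add_distrib]
    refine Finset.sum_congr rfl fun x _ => ?_
    rw [add_comm]
    exact Finset.sum_filter_add_sum_filter_not _ _ _
  have hlr := norm_mkQ_heisenberg_le (ℓ := ℓ) (fun r hr => by simpa using (Finset.mem_filter.1 hr).2)
    (le_trans (Finset.sum_le_sum_of_subset_of_nonneg (fun r hr => by
      simp only [Finset.mem_filter, Finset.mem_range] at hr ⊢
      omega) fun r _ _ => hf r) hF) hk hW' x
    (ℓ + 2 * ℓ * n) n x (by simp [torusDist_self]) a ha T ⟨hT, le_rfl⟩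
  obtain ⟨c, hc, hcn⟩ := Submodule.Quotient.norm_mk_lt
    ((localAlgebra m (disk x (ℓ + 2 * ℓ * n))).toSubmodule.mkQ (star (W T) * a * W T)) hε
  refine ⟨star (W T) * a * W T - c, (Submodule.Quotient.eq _).1 hc.symm, ?_⟩
  have hd := norm_star_mul_mul_sub_le (hVe.mem_unitary (hsa _) ⟨hT, le_rfl⟩)
    (hW'.mem_unitary (hsa _) ⟨hT, le_rfl⟩) a
  have hWT := hWV T ⟨hT, le_rfl⟩
  rw [← hVT]
  calc ‖(V T)ᴴ * a * V T - (star (W T) * a * W T - c)‖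
      = ‖(star (V T) * a * V T - star (W T) * a * W T) + c‖ := by
        rw [← Matrix.star_eq_conjTranspose, sub_sub_eq_add_sub, sub_add_eq_add_sub]
    _ ≤ 2 * ‖W T - V T‖ * ‖a‖ + ‖c‖ := (norm_add_le _ _).trans (by gcongr)
    _ ≤ 2 * (η * T) * ‖a‖ + (‖a‖ * ((6 * (4 * ℓ + 1 : ℕ) ^ d * F * T) ^ n / n.factorial) + ε) := by
        gcongr
        exact hcn.le.trans (by gcongr)
    _ = _ := by ring

theorem IsQuasiLocalUnitary.mem_unitary {T : ℝ} (hT : 0 ≤ T) {f : ℕ → ℝ} {U : Op m}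
    (hU : IsQuasiLocalUnitary T f U) : U ∈ unitary (Op m) := by
  obtain ⟨k, V, hkc, hk, hV0, hVT, hV⟩ := hU
  rw [← hVT]
  exact IsEvolution.mem_unitary ⟨hV0, hV⟩ (fun t ht => isSelfAdjoint_sum _ fun x _ =>
      isSelfAdjoint_sum _ fun r _ => (hk t ht x r).1.isSelfAdjoint) ⟨hT, le_rfl⟩

theorem IsQuasiLocalUnitary.conjTranspose {T : ℝ} (hT : 0 ≤ T) {f : ℕ → ℝ} {U : Op m}
    (hU : IsQuasiLocalUnitary T f U) : IsQuasiLocalUnitary T f Uᴴ := by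
  obtain ⟨k, V, hkc, hk, hV0, hVT, hV⟩ := hU
  have hmap : ∀ t ∈ Set.Icc 0 T, T - t ∈ Set.Icc 0 T := fun t ht =>
    ⟨by linarith [ht.2], by linarith [ht.1]⟩
  have hr := IsEvolution.reverse (A := Op m) hT ⟨hV0, hV⟩ (fun t ht => isSelfAdjoint_sum _ fun x _ =>
      isSelfAdjoint_sum _ fun r _ => (hk t ht x r).1.isSelfAdjoint)
  refine ⟨fun t x r => -k (T - t) x r, fun t => V (T - t) * star (V T), fun x r => ?_,
    fun t ht x r => ?_, hr.1, by simp [hV0, hVT, Matrix.star_eq_conjTranspose], fun t ht => ?_⟩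
  · exact ((hkc x r).comp (by fun_prop) hmap).neg
  · obtain ⟨h1, h2, h3⟩ := hk _ (hmap t ht) x r
    refine ⟨h1.neg, ?_, by rwa [norm_neg]⟩
    exact (localAlgebra m (disk x r)).neg_mem h2
  · have := hr.2 t ht
    simpa only [Finset.sum_neg_distrib] using this

end LiebRobinson

/-! ### Matrix elements and operator norms -/

section MatrixElements

variable {n : Type*} [Fintype n]

theorem inner_toLp_eq (x y : n → ℂ) :
    inner ℂ (WithLp.toLp 2 x : EuclideanSpace ℂ n) (WithLp.toLp 2 y) = star x ⬝ᵥ y := by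
  rw [EuclideanSpace.inner_toLp_toLp, dotProduct_comm]

theorem star_dotProduct_self_eq (x : n → ℂ) :
    star x ⬝ᵥ x = ((‖(WithLp.toLp 2 x : EuclideanSpace ℂ n)‖ ^ 2 : ℝ) : ℂ) := by
  rw [← inner_toLp_eq, inner_self_eq_norm_sq_to_K]
  simp

theorem isUnitVec_iff (x : n → ℂ) :
    IsUnitVec x ↔ ‖(WithLp.toLp 2 x : EuclideanSpace ℂ n)‖ = 1 := by
  rw [IsUnitVec, star_dotProduct_self_eq, ← Complex.ofReal_one, Complex.ofReal_inj,
    pow_eq_one_iff_of_nonneg (norm_nonneg _) two_ne_zero]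

variable [DecidableEq n]

theorem norm_dotProduct_mulVec_le' (O : Matrix n n ℂ) (x y : n → ℂ) :
    ‖star x ⬝ᵥ (O *ᵥ y)‖ ≤ ‖O‖ * (‖(WithLp.toLp 2 x : EuclideanSpace ℂ n)‖ *
      ‖(WithLp.toLp 2 y : EuclideanSpace ℂ n)‖) := by
  rw [← inner_toLp_eq]
  refine (norm_inner_le_norm _ _).trans ?_
  have := O.l2_opNorm_mulVec (WithLp.toLp 2 y)
  calc _ ≤ ‖(WithLp.toLp 2 x : EuclideanSpace ℂ n)‖ *
        (‖O‖ * ‖(WithLp.toLp 2 y : EuclideanSpace ℂ n)‖) := by gcongr; exact this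
    _ = _ := by ring

theorem norm_dotProduct_mulVec_le (O : Matrix n n ℂ) {x y : n → ℂ} (hx : IsUnitVec x)
    (hy : IsUnitVec y) : ‖star x ⬝ᵥ (O *ᵥ y)‖ ≤ ‖O‖ := by
  have := norm_dotProduct_mulVec_le' O x y
  rwa [(isUnitVec_iff x).1 hx, (isUnitVec_iff y).1 hy, mul_one, mul_one] at this

theorem l2_opNorm_le_of_forall {O : Matrix n n ℂ} {δ : ℝ} (hδ : 0 ≤ δ)
    (h : ∀ x y : n → ℂ, ‖star x ⬝ᵥ (O *ᵥ y)‖ ≤ δ *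
      (‖(WithLp.toLp 2 x : EuclideanSpace ℂ n)‖ * ‖(WithLp.toLp 2 y : EuclideanSpace ℂ n)‖)) :
    ‖O‖ ≤ δ := by
  rw [Matrix.cstar_norm_def]
  refine ContinuousLinearMap.opNorm_le_bound _ hδ fun y => ?_
  set z := Matrix.toEuclideanCLM (n := n) (𝕜 := ℂ) O y
  have h1 := h z.ofLp y.ofLp
  rw [← inner_toLp_eq] at h1
  have h2 : ‖z‖ * ‖z‖ ≤ δ * (‖z‖ * ‖y‖) := by
    have e : inner ℂ z z = ((‖z‖ : ℂ) ^ 2) := inner_self_eq_norm_sq_to_K z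
    have h3 : ‖inner ℂ z z‖ ≤ δ * (‖z‖ * ‖y‖) := h1
    rw [e, norm_pow, Complex.norm_real, norm_norm] at h3
    nlinarith
  by_cases hz : ‖z‖ = 0
  · rw [hz]; positivity
  · have : 0 < ‖z‖ := lt_of_le_of_ne (norm_nonneg _) (Ne.symm hz)
    nlinarith

end MatrixElements

section NumericalRange

variable {E : Type*} [NormedAddCommGroup E] [InnerProductSpace ℂ E]

/-- If an operator has, up to `ε`, no matrix elements between orthogonal unit vectors of `V` and
equal expectation values in them, then its compression to `V` is nearly scalar. -/
theorem norm_inner_sub_le_of_orthonormal {V : Submodule ℂ E} {T : E →ₗ[ℂ] E} {ε : ℝ}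
    (h : ∀ g ∈ V, ∀ g' ∈ V, ‖g‖ = 1 → ‖g'‖ = 1 → inner ℂ g g' = 0 →
      ‖inner ℂ g (T g')‖ ≤ ε ∧ ‖inner ℂ g (T g) - inner ℂ g' (T g')‖ ≤ 2 * ε)
    (hε : 0 ≤ ε) {g : E} (hg : g ∈ V) (hg1 : ‖g‖ = 1) {x y : E} (hx : x ∈ V) (hy : y ∈ V) :
    ‖inner ℂ x (T y) - inner ℂ g (T g) * inner ℂ x y‖ ≤ 8 * ε * (‖x‖ * ‖y‖) := by
  set c₀ := inner ℂ g (T g) with hc₀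
  have hgg : inner ℂ g g = 1 := by rw [inner_self_eq_norm_sq_to_K, hg1]; simp
  -- the quadratic form
  have hquad : ∀ v ∈ V, ‖inner ℂ v (T v) - c₀ * inner ℂ v v‖ ≤ 4 * ε * ‖v‖ ^ 2 := by
    intro v hv
    set c := inner ℂ g v with hc
    set u := v - c • g with hu
    have hgu : inner ℂ g u = 0 := by rw [hu, inner_sub_right, inner_smul_right, hgg]; simp [hc]
    have hug : inner ℂ u g = 0 := inner_eq_zero_symm.1 hgu
    have huV : u ∈ V := V.sub_mem hv (V.smul_mem _ hg)
    have hvu : v = c • g + u := by simp [hu]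
    have hnorm : ‖v‖ ^ 2 = ‖c‖ ^ 2 + ‖u‖ ^ 2 := by
      have := norm_add_sq_eq_norm_sq_add_norm_sq_of_inner_eq_zero (𝕜 := ℂ) (c • g) u
        (by rw [inner_smul_left, hgu, mul_zero])
      rw [← hvu, norm_smul, hg1, mul_one] at this
      nlinarith
    have hfac : (∃ w ∈ V, ‖w‖ = 1 ∧ inner ℂ g w = 0 ∧ u = (‖u‖ : ℂ) • w) ∨ u = 0 := by
      by_cases h0 : u = 0
      · exact Or.inr h0
      · have hn : (‖u‖ : ℂ) ≠ 0 := by simpa using h0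
        refine Or.inl ⟨(‖u‖ : ℂ)⁻¹ • u, V.smul_mem _ huV, ?_, ?_, ?_⟩
        · rw [norm_smul, norm_inv, Complex.norm_real, norm_norm, inv_mul_cancel₀ (by simpa using h0)]
        · rw [inner_smul_right, hgu, mul_zero]
        · rw [smul_smul, mul_inv_cancel₀ hn, one_smul]
    have hexp : inner ℂ v (T v) - c₀ * inner ℂ v v =
        starRingEnd ℂ c * inner ℂ g (T u) + c * inner ℂ u (T g) +
          (inner ℂ u (T u) - c₀ * inner ℂ u u) := by
      rw [hvu]
      simp only [map_add, map_smul, inner_add_left, inner_add_right, inner_smul_left,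
        inner_smul_right, hgg, hgu, hug, ← hc₀]
      ring
    have huu : inner ℂ u u = ((‖u‖ : ℂ) ^ 2) := inner_self_eq_norm_sq_to_K u
    have hb : ‖inner ℂ g (T u)‖ ≤ ε * ‖u‖ ∧ ‖inner ℂ u (T g)‖ ≤ ε * ‖u‖ ∧
        ‖inner ℂ u (T u) - c₀ * inner ℂ u u‖ ≤ 2 * ε * ‖u‖ ^ 2 := by
      obtain ⟨w, hw, hw1, hgw, huw⟩ | h0 := hfac
      · obtain ⟨b1, b2⟩ := h g hg w hw hg1 hw1 hgw
        obtain ⟨b3, -⟩ := h w hw g hg hw1 hg1 (inner_eq_zero_symm.1 hgw)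
        refine ⟨?_, ?_, ?_⟩
        · rw [huw, map_smul, inner_smul_right, norm_mul, norm_smul, hw1]
          simp only [Complex.norm_real, norm_norm, mul_one]
          rw [mul_comm]; gcongr
        · rw [huw, inner_smul_left, norm_mul, norm_smul, hw1, RCLike.norm_conj]
          simp only [Complex.norm_real, norm_norm, mul_one]
          rw [mul_comm]; gcongr
        · have e : inner ℂ u (T u) - c₀ * inner ℂ u u =
              (‖u‖ : ℂ) ^ 2 * (inner ℂ w (T w) - c₀) := by
            have e1 : inner ℂ u (T u) = (‖u‖ : ℂ) ^ 2 * inner ℂ w (T w) := by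
              conv_lhs => rw [huw]
              rw [map_smul, inner_smul_left, inner_smul_right, Complex.conj_ofReal]
              ring
            rw [e1, huu]; ring
          rw [e, norm_mul, norm_pow, Complex.norm_real, norm_norm, mul_comm, norm_sub_rev]
          gcongr
      · rw [h0]; simp
    obtain ⟨b1, b2, b3⟩ := hb
    rw [hexp, hnorm]
    calc _ ≤ ‖c‖ * (ε * ‖u‖) + ‖c‖ * (ε * ‖u‖) + 2 * ε * ‖u‖ ^ 2 := by
          refine (norm_add_le _ _).trans (add_le_add ((norm_add_le _ _).trans ?_) b3)
          rw [norm_mul, norm_mul, RCLike.norm_conj]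
          gcongr
      _ ≤ _ := by
          have h1 := mul_nonneg hε (sq_nonneg (‖c‖ - ‖u‖))
          have h2 := mul_nonneg hε (sq_nonneg ‖c‖)
          have h3 := mul_nonneg hε (sq_nonneg ‖u‖)
          nlinarith
  -- polarization, for unit vectors
  have hunit : ∀ x ∈ V, ∀ y ∈ V, ‖x‖ = 1 → ‖y‖ = 1 →
      ‖inner ℂ x (T y) - c₀ * inner ℂ x y‖ ≤ 8 * ε := by
    intro x hx y hy hx1 hy1
    have q : ∀ z : ℂ, ‖z‖ = 1 → ‖inner ℂ (x + z • y) (T (x + z • y)) -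
        c₀ * inner ℂ (x + z • y) (x + z • y)‖ ≤ 4 * ε * ‖x + z • y‖ ^ 2 := fun z _ =>
      hquad _ (V.add_mem hx (V.smul_mem _ hy))
    have p1 := parallelogram_law_with_norm ℂ x y
    have p2 := parallelogram_law_with_norm ℂ x (Complex.I • y)
    have q1 := q 1 (by simp)
    have q2 := q (-1) (by simp)
    have q3 := q Complex.I (by simp)
    have q4 := q (-Complex.I) (by simp)
    rw [norm_smul, Complex.norm_I, one_mul, hx1, hy1] at p2
    rw [hx1, hy1] at p1
    simp only [one_smul, neg_smul, ← sub_eq_add_neg] at q1 q2 q3 q4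
    set S : E → ℂ := fun v => inner ℂ v (T v) - c₀ * inner ℂ v v with hS
    have e : 4 * (inner ℂ x (T y) - c₀ * inner ℂ x y) = S (x + y) - S (x - y)
        - Complex.I * S (x + Complex.I • y) + Complex.I * S (x - Complex.I • y) := by
      simp only [hS, map_add, map_sub, map_smul, inner_add_left, inner_add_right, inner_sub_left,
        inner_sub_right, inner_smul_left, inner_smul_right, Complex.conj_I]
      ring_nf
      simp only [Complex.I_sq]
      ring
    have e2 : 4 * ‖inner ℂ x (T y) - c₀ * inner ℂ x y‖ ≤
        ‖S (x + y)‖ + ‖S (x - y)‖ + ‖S (x + Complex.I • y)‖ + ‖S (x - Complex.I • y)‖ := by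
      calc _ = ‖4 * (inner ℂ x (T y) - c₀ * inner ℂ x y)‖ := by rw [norm_mul]; simp
        _ ≤ ‖S (x + y)‖ + ‖S (x - y)‖ + ‖Complex.I * S (x + Complex.I • y)‖
            + ‖Complex.I * S (x - Complex.I • y)‖ := by
          rw [e]
          refine (norm_add_le _ _).trans (add_le_add ((norm_sub_le _ _).trans
            (add_le_add (norm_sub_le _ _) le_rfl)) le_rfl)
        _ = _ := by simp
    have : 4 * ‖inner ℂ x (T y) - c₀ * inner ℂ x y‖ ≤ 4 * ε * (‖x + y‖ ^ 2 + ‖x - y‖ ^ 2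
        + ‖x + Complex.I • y‖ ^ 2 + ‖x - Complex.I • y‖ ^ 2) := by
      linarith
    have e3 : ‖x + y‖ ^ 2 + ‖x - y‖ ^ 2 + ‖x + Complex.I • y‖ ^ 2 + ‖x - Complex.I • y‖ ^ 2 = 8 := by
      nlinarith
    rw [e3] at this
    linarith
  rcases eq_or_ne x 0 with rfl | hx0
  · simp
  rcases eq_or_ne y 0 with rfl | hy0
  · simp
  have hxn : (‖x‖ : ℂ) ≠ 0 := by simpa using hx0
  have hyn : (‖y‖ : ℂ) ≠ 0 := by simpa using hy0
  have := hunit ((‖x‖ : ℂ)⁻¹ • x) (V.smul_mem _ hx) ((‖y‖ : ℂ)⁻¹ • y) (V.smul_mem _ hy)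
    (by rw [norm_smul, norm_inv, Complex.norm_real, norm_norm, inv_mul_cancel₀ (by simpa using hx0)])
    (by rw [norm_smul, norm_inv, Complex.norm_real, norm_norm, inv_mul_cancel₀ (by simpa using hy0)])
  have e : inner ℂ x (T y) - c₀ * inner ℂ x y = (‖x‖ * ‖y‖ : ℂ) *
      (inner ℂ ((‖x‖ : ℂ)⁻¹ • x) (T ((‖y‖ : ℂ)⁻¹ • y)) -
        c₀ * inner ℂ ((‖x‖ : ℂ)⁻¹ • x) ((‖y‖ : ℂ)⁻¹ • y)) := by
    simp only [map_smul, inner_smul_left, inner_smul_right, map_inv₀, Complex.conj_ofReal]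
    field_simp
  rw [e, norm_mul, norm_mul, Complex.norm_real, Complex.norm_real, norm_norm, norm_norm, mul_comm]
  gcongr

end NumericalRange

/-! ### Product operators -/

section PiMat

variable {ι : Type*} [Fintype ι] {B : ι → Type*}

/-- The tensor product `⨂ k, M k`, in the product basis. -/
def piMat (M : ∀ k, Matrix (B k) (B k) ℂ) : Matrix (∀ k, B k) (∀ k, B k) ℂ :=
  fun w w' => ∏ k, M k (w k) (w' k)

/-- The tensor product `⨂ k, φ k` of vectors, in the product basis. -/
def piVec (φ : ∀ k, B k → ℂ) : (∀ k, B k) → ℂ := fun w => ∏ k, φ k (w k)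

theorem piMat_conjTranspose (M : ∀ k, Matrix (B k) (B k) ℂ) :
    (piMat M)ᴴ = piMat fun k => (M k)ᴴ := by
  ext w w'
  simp [piMat, Matrix.conjTranspose_apply]

theorem piMat_diagonal [∀ k, DecidableEq (B k)] (D : ∀ k, B k → ℂ) :
    piMat (fun k => Matrix.diagonal (D k)) = Matrix.diagonal fun w => ∏ k, D k (w k) := by
  ext w w'
  by_cases h : w = w'
  · subst h; simp [piMat]
  · obtain ⟨k, hk⟩ := Function.ne_iff.1 h
    rw [Matrix.diagonal_apply_ne _ h]
    exact Finset.prod_eq_zero (Finset.mem_univ k) (Matrix.diagonal_apply_ne _ hk)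

theorem piMat_one [∀ k, DecidableEq (B k)] : piMat (fun k => (1 : Matrix (B k) (B k) ℂ)) = 1 := by
  have := piMat_diagonal (fun k (_ : B k) => (1 : ℂ))
  simpa using this

theorem piMat_smul (c : ι → ℂ) (M : ∀ k, Matrix (B k) (B k) ℂ) :
    piMat (fun k => c k • M k) = (∏ k, c k) • piMat M := by
  ext w w'
  simp [piMat, Finset.prod_mul_distrib]

variable [DecidableEq ι]

theorem piMat_update_apply (M : ∀ k, Matrix (B k) (B k) ℂ) (k : ι) (A : Matrix (B k) (B k) ℂ)
    (w w' : ∀ k, B k) : piMat (Function.update M k A) w w' =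
      A (w k) (w' k) * ∏ j ∈ Finset.univ.erase k, M j (w j) (w' j) := by
  rw [piMat, ← Finset.mul_prod_erase Finset.univ _ (Finset.mem_univ k), Function.update_self]
  congr 1
  refine Finset.prod_congr rfl fun j hj => ?_
  rw [Function.update_of_ne (Finset.ne_of_mem_erase hj)]

variable [∀ k, Fintype (B k)]

theorem star_piVec_dotProduct (φ ψ : ∀ k, B k → ℂ) :
    star (piVec φ) ⬝ᵥ piVec ψ = ∏ k, star (φ k) ⬝ᵥ ψ k := by
  simp only [dotProduct, Finset.prod_univ_sum, Fintype.piFinset_univ, Pi.star_apply, piVec,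
    ← Finset.prod_mul_distrib, star_prod]

theorem piMat_mulVec_piVec (M : ∀ k, Matrix (B k) (B k) ℂ) (φ : ∀ k, B k → ℂ) :
    piMat M *ᵥ piVec φ = piVec fun k => M k *ᵥ φ k := by
  ext w
  simp only [Matrix.mulVec, dotProduct, piVec, piMat, Finset.prod_univ_sum, Fintype.piFinset_univ,
    ← Finset.prod_mul_distrib]

theorem piMat_mul (M M' : ∀ k, Matrix (B k) (B k) ℂ) :
    piMat M * piMat M' = piMat fun k => M k * M' k := by
  ext w w'
  simp only [Matrix.mul_apply, piMat, Finset.prod_univ_sum, Fintype.piFinset_univ,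
    ← Finset.prod_mul_distrib]

variable [∀ k, DecidableEq (B k)]

/-- The operator `A` acting on the factor `k`. -/
def piEmbed (k : ι) : Matrix (B k) (B k) ℂ →⋆ₙₐ[ℂ] Matrix (∀ k, B k) (∀ k, B k) ℂ where
  toFun A := piMat (Function.update (fun _ => 1) k A)
  map_smul' c A := by
    ext w w'
    simp [piMat_update_apply, mul_assoc]
  map_zero' := by
    ext w w'
    simp [piMat_update_apply]
  map_add' A A' := by
    ext w w'
    simp [piMat_update_apply, add_mul]
  map_mul' A A' := by
    rw [piMat_mul]
    congr 1
    funext j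
    by_cases h : j = k
    · subst h; simp
    · simp [h]
  map_star' A := by
    rw [Matrix.star_eq_conjTranspose, Matrix.star_eq_conjTranspose, piMat_conjTranspose]
    congr 1
    funext j
    by_cases h : j = k
    · subst h; simp
    · simp [h]

theorem piEmbed_apply (k : ι) (A : Matrix (B k) (B k) ℂ) :
    piEmbed k A = piMat (Function.update (fun _ => 1) k A) := rfl

theorem norm_piEmbed_le (k : ι) (A : Matrix (B k) (B k) ℂ) : ‖piEmbed k A‖ ≤ ‖A‖ :=
  NonUnitalStarAlgHom.norm_apply_le _ A

theorem piEmbed_entry (k : ι) (A : Matrix (B k) (B k) ℂ) (w w' : ∀ k, B k) :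
    piEmbed k A w w' = if ∀ j, j ≠ k → w j = w' j then A (w k) (w' k) else 0 := by
  rw [piEmbed_apply, piMat_update_apply]
  split_ifs with h
  · rw [Finset.prod_eq_one, mul_one]
    intro j hj
    rw [h j (Finset.ne_of_mem_erase hj), Matrix.one_apply_eq]
  · push Not at h
    obtain ⟨j, hj, hne⟩ := h
    have hz : ∏ j ∈ Finset.univ.erase k, (1 : Matrix (B j) (B j) ℂ) (w j) (w' j) = 0 :=
      Finset.prod_eq_zero (Finset.mem_erase.2 ⟨hj, Finset.mem_univ j⟩) (Matrix.one_apply_ne hne)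
    exact (congrArg _ hz).trans (mul_zero _)

theorem norm_piMat_le (M : ∀ k, Matrix (B k) (B k) ℂ) : ‖piMat M‖ ≤ ∏ k, ‖M k‖ := by
  have key : ∀ s : Finset ι, ‖piMat (s.piecewise M fun _ => 1)‖ ≤ ∏ k ∈ s, ‖M k‖ := by
    intro s
    induction s using Finset.induction_on with
    | empty =>
      simp only [Finset.piecewise_empty, Finset.prod_empty, piMat_one]
      exact norm_le_one_of_mem_unitary (one_mem _)
    | insert a s ha ih =>
      have e : piMat ((insert a s).piecewise M fun _ => 1) =
          piEmbed a (M a) * piMat (s.piecewise M fun _ => 1) := by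
        rw [piEmbed_apply, piMat_mul]
        congr 1
        funext j
        by_cases h : j = a
        · subst h; simp [ha]
        · simp [h, Finset.piecewise]
      rw [e, Finset.prod_insert ha]
      exact (norm_mul_le _ _).trans (mul_le_mul (norm_piEmbed_le _ _) ih (norm_nonneg _)
        (norm_nonneg _))
  simpa using key Finset.univ

theorem norm_piMat_sub_le {M M' : ∀ k, Matrix (B k) (B k) ℂ} (hM : ∀ k, ‖M k‖ ≤ 1)
    (hM' : ∀ k, ‖M' k‖ ≤ 1) : ‖piMat M - piMat M'‖ ≤ ∑ k, ‖M k - M' k‖ := by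
  -- the factors are exchanged one by one
  have key : ∀ s : Finset ι, ‖piMat (s.piecewise M M') - piMat M'‖ ≤ ∑ k ∈ s, ‖M k - M' k‖ := by
    intro s
    induction s using Finset.induction_on with
    | empty => simp
    | insert a s ha ih =>
      have e : piMat ((insert a s).piecewise M M') - piMat (s.piecewise M M') =
          piMat (Function.update (s.piecewise M M') a (M a - M' a)) := by
        have e1 : s.piecewise M M' = Function.update (s.piecewise M M') a (M' a) := by
          rw [eq_comm, Function.update_eq_self_iff]; simp [ha]
        conv_lhs => rw [Finset.piecewise_insert]; arg 2; rw [e1]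
        ext w w'
        simp only [Matrix.sub_apply, piMat_update_apply, sub_mul]
      have hn : ‖piMat (Function.update (s.piecewise M M') a (M a - M' a))‖ ≤ ‖M a - M' a‖ := by
        refine (norm_piMat_le _).trans ?_
        rw [← Finset.mul_prod_erase Finset.univ _ (Finset.mem_univ a), Function.update_self]
        refine mul_le_of_le_one_right (norm_nonneg _) (Finset.prod_le_one (fun _ _ => norm_nonneg _)
          fun j hj => ?_)
        rw [Function.update_of_ne (Finset.ne_of_mem_erase hj)]
        by_cases h : j ∈ s <;> simp [h, hM, hM']
      rw [Finset.sum_insert ha]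
      calc _ = ‖(piMat ((insert a s).piecewise M M') - piMat (s.piecewise M M')) +
            (piMat (s.piecewise M M') - piMat M')‖ := by rw [sub_add_sub_cancel]
        _ ≤ _ := (norm_add_le _ _).trans (add_le_add (e ▸ hn) ih)
  simpa using key Finset.univ

end PiMat

/-! ### Spectral subspaces -/

section Spectral

variable {n : Type*} [Fintype n]

/-- The span of the columns `j ∈ S` of the unitary matrix `B`, described by the vanishing of the
coefficients with respect to the other columns. -/
def specSpace (B : Matrix n n ℂ) (S : Finset n) : Submodule ℂ (n → ℂ) where
  carrier := {v | ∀ j, j ∉ S → (Bᴴ *ᵥ v) j = 0}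
  add_mem' := by
    intro v w hv hw j hj
    rw [Matrix.mulVec_add, Pi.add_apply, hv j hj, hw j hj, add_zero]
  zero_mem' := by intro j _; simp
  smul_mem' := by
    intro c v hv j hj
    rw [Matrix.mulVec_smul, Pi.smul_apply, hv j hj, smul_zero]

variable [DecidableEq n]

theorem finrank_specSpace {B : Matrix n n ℂ} (hB : B ∈ unitary (Matrix n n ℂ)) (S : Finset n) :
    Module.finrank ℂ (specSpace B S) = S.card := by
  obtain ⟨h1, h2⟩ := Unitary.mem_iff.1 hB
  rw [Matrix.star_eq_conjTranspose] at h1 h2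
  let ext : (S → ℂ) → n → ℂ := fun c j => if h : j ∈ S then c ⟨j, h⟩ else 0
  have hext : ∀ c, Bᴴ *ᵥ (B *ᵥ ext c) = ext c := fun c => by
    rw [Matrix.mulVec_mulVec, h1, Matrix.one_mulVec]
  let e : specSpace B S ≃ₗ[ℂ] (S → ℂ) :=
    { toFun := fun v j => (Bᴴ *ᵥ v.1) j
      map_add' := fun v w => by ext j; simp [Matrix.mulVec_add]
      map_smul' := fun c v => by ext j; simp [Matrix.mulVec_smul]
      invFun := fun c => ⟨B *ᵥ ext c, fun j hj => by rw [hext]; simp [ext, hj]⟩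
      left_inv := fun v => by
        refine Subtype.ext ?_
        have : ext (fun j => (Bᴴ *ᵥ v.1) j) = Bᴴ *ᵥ v.1 := by
          funext j
          by_cases h : j ∈ S
          · simp [ext, h]
          · simp [ext, h, v.2 j h]
        change B *ᵥ ext (fun j => (Bᴴ *ᵥ v.1) j) = v.1
        rw [this, Matrix.mulVec_mulVec, h2, Matrix.one_mulVec]
      right_inv := fun c => by
        ext j
        change (Bᴴ *ᵥ (B *ᵥ ext c)) j = c j
        rw [hext]
        simp [ext] }
  rw [e.finrank_eq]
  simp

theorem star_dotProduct_mulVec_eq_sum {B : Matrix n n ℂ} {ev : n → ℝ} (v : n → ℂ) :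
    star v ⬝ᵥ ((B * Matrix.diagonal (fun j => (ev j : ℂ)) * Bᴴ) *ᵥ v) =
      ((∑ j, ev j * ‖(Bᴴ *ᵥ v) j‖ ^ 2 : ℝ) : ℂ) := by
  rw [← Matrix.mulVec_mulVec, ← Matrix.mulVec_mulVec, Matrix.dotProduct_mulVec,
    show star v ᵥ* B = star (Bᴴ *ᵥ v) by rw [Matrix.star_mulVec, Matrix.conjTranspose_conjTranspose]]
  simp only [dotProduct, Matrix.mulVec_diagonal, Pi.star_apply]
  push_cast
  refine Finset.sum_congr rfl fun j _ => ?_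
  rw [← Complex.conj_mul', Complex.star_def]
  ring

theorem star_dotProduct_self_eq_sum {B : Matrix n n ℂ} (hB : B ∈ unitary (Matrix n n ℂ))
    (v : n → ℂ) : star v ⬝ᵥ v = ((∑ j, ‖(Bᴴ *ᵥ v) j‖ ^ 2 : ℝ) : ℂ) := by
  have := star_dotProduct_mulVec_eq_sum (B := B) (ev := fun _ => 1) v
  simp only [Complex.ofReal_one, Matrix.diagonal_one, mul_one, one_mul] at this
  rw [← this, ← Matrix.star_eq_conjTranspose, (Unitary.mem_iff.1 hB).2, Matrix.one_mulVec]

theorem eq_conj_diagonal {H : Matrix n n ℂ} (hH : H.IsHermitian) :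
    H = hH.eigenvectorUnitary * Matrix.diagonal (fun j => (hH.eigenvalues j : ℂ)) *
      (hH.eigenvectorUnitary : Matrix n n ℂ)ᴴ := by
  conv_lhs => rw [hH.spectral_theorem]
  rfl

theorem mulVec_eigenvector {B : Matrix n n ℂ} (hB : B ∈ unitary (Matrix n n ℂ)) {ev : n → ℝ}
    {v : n → ℂ} (j : n) :
    (Bᴴ *ᵥ ((B * Matrix.diagonal (fun j => (ev j : ℂ)) * Bᴴ) *ᵥ v)) j = ev j * (Bᴴ *ᵥ v) j := by
  have h1 := (Unitary.mem_iff.1 hB).1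
  rw [Matrix.star_eq_conjTranspose] at h1
  rw [Matrix.mulVec_mulVec, ← mul_assoc, ← mul_assoc, h1, one_mul, ← Matrix.mulVec_mulVec,
    Matrix.mulVec_diagonal]

theorem eigenvalues_mem_energies {H : Matrix n n ℂ} (hH : H.IsHermitian) (j : n) :
    hH.eigenvalues j ∈ energies H := by
  refine ⟨hH.eigenvectorBasis j, ?_, ?_⟩
  · intro h0
    have := hH.eigenvectorBasis.orthonormal.ne_zero j
    exact this (by ext i; exact congrFun h0 i)
  · rw [hH.mulVec_eigenvectorBasis]
    rfl

theorem energies_subset_range {H : Matrix n n ℂ} (hH : H.IsHermitian) :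
    energies H ⊆ Set.range hH.eigenvalues := by
  rintro μ ⟨v, hv, hμ⟩
  by_contra hne
  apply hv
  set B : Matrix n n ℂ := hH.eigenvectorUnitary.1
  have hB : B ∈ unitary (Matrix n n ℂ) := hH.eigenvectorUnitary.2
  have h0 : Bᴴ *ᵥ v = 0 := by
    funext j
    have := mulVec_eigenvector hB (ev := hH.eigenvalues) (v := v) j
    rw [← eq_conj_diagonal hH, hμ, Matrix.mulVec_smul, Pi.smul_apply, smul_eq_mul] at this
    have h2 : ((μ : ℂ) - hH.eigenvalues j) * (Bᴴ *ᵥ v) j = 0 := by rw [sub_mul, this, sub_self]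
    rcases mul_eq_zero.1 h2 with h | h
    · exact absurd ⟨j, by exact_mod_cast (sub_eq_zero.1 h).symm⟩ hne
    · exact h
  have h2 := (Unitary.mem_iff.1 hB).2
  rw [Matrix.star_eq_conjTranspose] at h2
  rw [← Matrix.one_mulVec v, ← h2, ← Matrix.mulVec_mulVec, h0, Matrix.mulVec_zero]

theorem groundEnergy_le {H : Matrix n n ℂ} (hH : H.IsHermitian) (j : n) :
    groundEnergy H ≤ hH.eigenvalues j :=
  csInf_le ((Set.finite_range _).subset (energies_subset_range hH)).bddBelow
    (eigenvalues_mem_energies hH j)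

theorem lowEnergySpace_eq_specSpace {H : Matrix n n ℂ} (hH : H.IsHermitian) (w : ℝ) :
    lowEnergySpace H w = specSpace hH.eigenvectorUnitary
      (Finset.univ.filter fun j => hH.eigenvalues j ≤ groundEnergy H + w) := by
  set B : Matrix n n ℂ := hH.eigenvectorUnitary.1 with hBdef
  have hB : B ∈ unitary (Matrix n n ℂ) := hH.eigenvectorUnitary.2
  have h2 := (Unitary.mem_iff.1 hB).2
  rw [Matrix.star_eq_conjTranspose] at h2
  apply le_antisymm
  · refine Submodule.span_le.2 ?_
    rintro v ⟨μ, hμ, hv⟩ j hj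
    have := mulVec_eigenvector hB (ev := hH.eigenvalues) (v := v) j
    rw [← eq_conj_diagonal hH, hv, Matrix.mulVec_smul, Pi.smul_apply, smul_eq_mul] at this
    have h3 : ((μ : ℂ) - hH.eigenvalues j) * (Bᴴ *ᵥ v) j = 0 := by rw [sub_mul, this, sub_self]
    rcases mul_eq_zero.1 h3 with h | h
    · have h4 : μ = hH.eigenvalues j := by exact_mod_cast sub_eq_zero.1 h
      simp [← h4, hμ] at hj
    · exact h
  · intro v hv
    have hexp : v = ∑ j, (Bᴴ *ᵥ v) j • (hH.eigenvectorBasis j : n → ℂ) := by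
      conv_lhs => rw [← Matrix.one_mulVec v, ← h2, ← Matrix.mulVec_mulVec]
      rw [Matrix.mulVec_eq_sum]
      refine Finset.sum_congr rfl fun j _ => ?_
      ext i
      simp only [hBdef, Pi.smul_apply, Matrix.transpose_apply, op_smul_eq_smul, smul_eq_mul]
      rfl
    rw [hexp]
    refine Submodule.sum_mem _ fun j _ => ?_
    by_cases hj : hH.eigenvalues j ≤ groundEnergy H + w
    · refine Submodule.smul_mem _ _ (Submodule.subset_span ⟨_, hj, ?_⟩)
      rw [hH.mulVec_eigenvectorBasis]
      rfl
    · rw [hv j (by simpa using hj), zero_smul]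
      exact Submodule.zero_mem _

end Spectral

/-! ### Operators on a tensor factor -/

section Amplify

open Kronecker

variable {n α β : Type*}

/-- The operator `A ⊗ A'`, for an identification of the product basis with `α × β`. -/
def tensMat (e : n ≃ α × β) (A : Matrix α α ℂ) (A' : Matrix β β ℂ) : Matrix n n ℂ :=
  (A ⊗ₖ A').submatrix e e

theorem tensMat_apply (e : n ≃ α × β) (A : Matrix α α ℂ) (A' : Matrix β β ℂ) (w w' : n) :
    tensMat e A A' w w' = A (e w).1 (e w').1 * A' (e w).2 (e w').2 := rfl

theorem tensMat_conjTranspose (e : n ≃ α × β) (A : Matrix α α ℂ) (A' : Matrix β β ℂ) :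
    (tensMat e A A')ᴴ = tensMat e Aᴴ A'ᴴ := by
  rw [tensMat, tensMat, Matrix.conjTranspose_submatrix, Matrix.conjTranspose_kronecker]

theorem tensMat_one [DecidableEq n] [DecidableEq α] [DecidableEq β] (e : n ≃ α × β) :
    tensMat e (1 : Matrix α α ℂ) (1 : Matrix β β ℂ) = 1 := by
  rw [tensMat, Matrix.one_kronecker_one, Matrix.submatrix_one_equiv]

/-- The vector `g ⊗ ψ`. -/
def tensVec (e : n ≃ α × β) (g : α → ℂ) (ψ : β → ℂ) : n → ℂ := fun w => g (e w).1 * ψ (e w).2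

variable [Fintype n] [Fintype α] [Fintype β]

/-- The partial expectation of `O` in the state `ψ` of the second factor. -/
def partialExpectation (e : n ≃ α × β) (ψ : β → ℂ) (O : Matrix n n ℂ) : Matrix α α ℂ :=
  fun s s' => ∑ b, ∑ b', star (ψ b) * O (e.symm (s, b)) (e.symm (s', b')) * ψ b'

theorem tensMat_mul (e : n ≃ α × β) (A B : Matrix α α ℂ) (A' B' : Matrix β β ℂ) :
    tensMat e A A' * tensMat e B B' = tensMat e (A * B) (A' * B') := by
  rw [tensMat, tensMat, tensMat, Matrix.submatrix_mul_equiv, ← Matrix.mul_kronecker_mul]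

theorem star_tensVec_dotProduct (e : n ≃ α × β) (g g' : α → ℂ) (ψ ψ' : β → ℂ) :
    star (tensVec e g ψ) ⬝ᵥ tensVec e g' ψ' = (star g ⬝ᵥ g') * (star ψ ⬝ᵥ ψ') := by
  simp only [dotProduct, Finset.sum_mul_sum, ← Finset.sum_product']
  refine Fintype.sum_equiv e _ _ fun w => ?_
  simp only [tensVec, Pi.star_apply, star_mul']
  ring

theorem tensMat_mulVec_tensVec (e : n ≃ α × β) (A : Matrix α α ℂ) (A' : Matrix β β ℂ) (g : α → ℂ)
    (ψ : β → ℂ) : tensMat e A A' *ᵥ tensVec e g ψ = tensVec e (A *ᵥ g) (A' *ᵥ ψ) := by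
  ext w
  simp only [tensVec, Matrix.mulVec, dotProduct, Finset.sum_mul_sum,
    ← Finset.sum_product']
  refine Fintype.sum_equiv e _ _ fun w' => ?_
  rw [tensMat_apply]
  ring

theorem star_tensVec_dotProduct_mulVec (e : n ≃ α × β) (g g' : α → ℂ) (ψ : β → ℂ)
    (O : Matrix n n ℂ) : star (tensVec e g ψ) ⬝ᵥ (O *ᵥ tensVec e g' ψ) =
      star g ⬝ᵥ (partialExpectation e ψ O *ᵥ g') := by
  have h : ∀ f : n → ℂ, ∑ w, f w = ∑ s, ∑ b, f (e.symm (s, b)) := fun f => by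
    rw [← Equiv.sum_comp e.symm, Fintype.sum_prod_type]
  simp only [dotProduct, Matrix.mulVec, partialExpectation, h, tensVec, Pi.star_apply,
    Equiv.apply_symm_apply, Finset.mul_sum, Finset.sum_mul]
  refine Finset.sum_congr rfl fun s _ => ?_
  rw [Finset.sum_comm]
  refine Finset.sum_congr rfl fun s' _ => ?_
  refine Finset.sum_congr rfl fun b _ => Finset.sum_congr rfl fun b' _ => ?_
  simp only [star_mul']
  ring

variable [DecidableEq n] [DecidableEq α]

theorem norm_partialExpectation_apply_le (e : n ≃ α × β) {ψ : β → ℂ} (hψ : IsUnitVec ψ)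
    (O : Matrix n n ℂ) (s s' : α) : ‖partialExpectation e ψ O s s'‖ ≤ ‖O‖ := by
  have hu : ∀ s : α, IsUnitVec (tensVec e (Pi.single s 1) ψ) := fun s => by
    have h1 : star ψ ⬝ᵥ ψ = 1 := hψ
    rw [IsUnitVec, star_tensVec_dotProduct, h1, mul_one, dotProduct_single]
    simp
  have := norm_dotProduct_mulVec_le O (hu s) (hu s')
  rw [star_tensVec_dotProduct_mulVec, Matrix.mulVec_single_one] at this
  have e1 : star (Pi.single s 1 : α → ℂ) = Pi.single s 1 := by
    rw [← Pi.single_star, star_one]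
  rw [e1, single_dotProduct, one_mul] at this
  exact this

variable [DecidableEq β]

/-- The operator `A ⊗ 1`. -/
def amplify (e : n ≃ α × β) : Matrix α α ℂ →⋆ₙₐ[ℂ] Matrix n n ℂ where
  toFun A := tensMat e A 1
  map_smul' c A := by ext w w'; simp [tensMat_apply, mul_assoc]
  map_zero' := by ext w w'; simp [tensMat_apply]
  map_add' A A' := by ext w w'; simp [tensMat_apply, add_mul]
  map_mul' A A' := by rw [tensMat_mul, one_mul]
  map_star' A := by
    rw [Matrix.star_eq_conjTranspose, Matrix.star_eq_conjTranspose, tensMat_conjTranspose,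
      Matrix.conjTranspose_one]

theorem amplify_apply (e : n ≃ α × β) (A : Matrix α α ℂ) : amplify e A = tensMat e A 1 := rfl

theorem amplify_entry (e : n ≃ α × β) (A : Matrix α α ℂ) (w w' : n) :
    amplify e A w w' = if (e w).2 = (e w').2 then A (e w).1 (e w').1 else 0 := by
  rw [amplify_apply, tensMat_apply, Matrix.one_apply]
  simp

theorem norm_amplify_le (e : n ≃ α × β) (A : Matrix α α ℂ) : ‖amplify e A‖ ≤ ‖A‖ :=
  NonUnitalStarAlgHom.norm_apply_le _ A

theorem amplify_prodComm (e : n ≃ α × β) (A' : Matrix β β ℂ) :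
    amplify (e.trans (Equiv.prodComm α β)) A' = tensMat e 1 A' := by
  ext w w'
  rw [amplify_apply, tensMat_apply, tensMat_apply, mul_comm]
  rfl

end Amplify

/-! ### Spectral projections and products of nearly scalar operators -/

section Projection

variable {n : Type*} [Fintype n] [DecidableEq n]

theorem norm_conj_le {B : Matrix n n ℂ} (hB : B ∈ unitary (Matrix n n ℂ)) (A : Matrix n n ℂ) :
    ‖B * A * Bᴴ‖ ≤ ‖A‖ := by
  have := norm_star_mul_mul_le (Unitary.star_mem hB) A
  rwa [star_star] at this

/-- The orthogonal projection onto `specSpace B S`. -/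
def specProj (B : Matrix n n ℂ) (S : Finset n) : Matrix n n ℂ :=
  B * Matrix.diagonal (fun j => if j ∈ S then 1 else 0) * Bᴴ

theorem specProj_conjTranspose (B : Matrix n n ℂ) (S : Finset n) :
    (specProj B S)ᴴ = specProj B S := by
  rw [specProj, Matrix.conjTranspose_mul, Matrix.conjTranspose_mul, Matrix.conjTranspose_conjTranspose,
    Matrix.diagonal_conjTranspose, mul_assoc]
  congr 3
  funext j
  simp only [Pi.star_apply]
  split_ifs <;> simp

theorem norm_specProj_le {B : Matrix n n ℂ} (hB : B ∈ unitary (Matrix n n ℂ)) (S : Finset n) :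
    ‖specProj B S‖ ≤ 1 := by
  refine (norm_conj_le hB _).trans ?_
  rw [Matrix.l2_opNorm_diagonal]
  refine (pi_norm_le_iff_of_nonneg zero_le_one).2 fun j => ?_
  split_ifs <;> simp

theorem conjTranspose_mulVec_specProj {B : Matrix n n ℂ} (hB : B ∈ unitary (Matrix n n ℂ))
    (S : Finset n) (v : n → ℂ) (j : n) :
    (Bᴴ *ᵥ (specProj B S *ᵥ v)) j = if j ∈ S then (Bᴴ *ᵥ v) j else 0 := by
  have h1 := (Unitary.mem_iff.1 hB).1
  rw [Matrix.star_eq_conjTranspose] at h1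
  rw [specProj, Matrix.mulVec_mulVec, ← mul_assoc, ← mul_assoc, h1, one_mul, ← Matrix.mulVec_mulVec,
    Matrix.mulVec_diagonal]
  simp

theorem specProj_mulVec_mem {B : Matrix n n ℂ} (hB : B ∈ unitary (Matrix n n ℂ)) (S : Finset n)
    (v : n → ℂ) : specProj B S *ᵥ v ∈ specSpace B S := fun j hj => by
  rw [conjTranspose_mulVec_specProj hB, if_neg hj]

theorem specProj_mulVec_of_mem {B : Matrix n n ℂ} (hB : B ∈ unitary (Matrix n n ℂ)) {S : Finset n}
    {v : n → ℂ} (hv : v ∈ specSpace B S) : specProj B S *ᵥ v = v := by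
  have h2 := (Unitary.mem_iff.1 hB).2
  rw [Matrix.star_eq_conjTranspose] at h2
  have : Bᴴ *ᵥ (specProj B S *ᵥ v) = Bᴴ *ᵥ v := by
    funext j
    rw [conjTranspose_mulVec_specProj hB]
    split_ifs with h
    · rfl
    · exact (hv j h).symm
  have := congrArg (B *ᵥ ·) this
  simpa only [Matrix.mulVec_mulVec, h2, ← mul_assoc, one_mul, Matrix.one_mulVec] using this

theorem specProj_mul_self {B : Matrix n n ℂ} (hB : B ∈ unitary (Matrix n n ℂ)) (S : Finset n) :
    specProj B S * specProj B S = specProj B S := by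
  refine Matrix.ext_of_mulVec_single fun j => ?_
  rw [← Matrix.mulVec_mulVec]
  exact specProj_mulVec_of_mem hB (specProj_mulVec_mem hB S _)

/-- Matrix elements that are nearly scalar on `specSpace B S` give a compression of small
norm. -/
theorem norm_specProj_compression_le {B : Matrix n n ℂ} (hB : B ∈ unitary (Matrix n n ℂ))
    {S : Finset n} {E : Matrix n n ℂ} {c : ℂ} {δ : ℝ} (hδ : 0 ≤ δ)
    (h : ∀ x ∈ specSpace B S, ∀ y ∈ specSpace B S,
      ‖star x ⬝ᵥ (E *ᵥ y) - c * (star x ⬝ᵥ y)‖ ≤ δ *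
        (‖(WithLp.toLp 2 x : EuclideanSpace ℂ n)‖ * ‖(WithLp.toLp 2 y : EuclideanSpace ℂ n)‖)) :
    ‖specProj B S * E * specProj B S - c • specProj B S‖ ≤ δ := by
  set Q := specProj B S with hQ
  refine l2_opNorm_le_of_forall hδ fun x y => ?_
  have hn : ∀ z : n → ℂ, ‖(WithLp.toLp 2 (Q *ᵥ z) : EuclideanSpace ℂ n)‖ ≤
      ‖(WithLp.toLp 2 z : EuclideanSpace ℂ n)‖ := fun z => by
    have h1 := Q.l2_opNorm_mulVec (WithLp.toLp 2 z)
    exact h1.trans (mul_le_of_le_one_left (norm_nonneg _) (norm_specProj_le hB S))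
  have hs : ∀ z : n → ℂ, star x ⬝ᵥ (Q *ᵥ z) = star (Q *ᵥ x) ⬝ᵥ z := fun z => by
    rw [Matrix.dotProduct_mulVec, Matrix.star_mulVec, hQ, specProj_conjTranspose]
  have e : star x ⬝ᵥ ((Q * E * Q - c • Q) *ᵥ y) =
      star (Q *ᵥ x) ⬝ᵥ (E *ᵥ (Q *ᵥ y)) - c * (star (Q *ᵥ x) ⬝ᵥ (Q *ᵥ y)) := by
    have h3 : Q *ᵥ y = Q *ᵥ (Q *ᵥ y) := by rw [Matrix.mulVec_mulVec, hQ, specProj_mul_self hB]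
    rw [Matrix.sub_mulVec, dotProduct_sub, mul_assoc, ← Matrix.mulVec_mulVec, hs,
      ← Matrix.mulVec_mulVec, Matrix.smul_mulVec, dotProduct_smul, smul_eq_mul]
    congr 2
    conv_lhs => rw [h3]
    exact hs _
  rw [e]
  refine (h _ (specProj_mulVec_mem hB S x) _ (specProj_mulVec_mem hB S y)).trans ?_
  gcongr
  · exact hn x
  · exact hn y

end Projection

section ProductProjection

variable {ι : Type*} [Fintype ι] [DecidableEq ι] {α : ι → Type*} [∀ k, Fintype (α k)]
  [∀ k, DecidableEq (α k)]

theorem piMat_mem_unitary {B : ∀ k, Matrix (α k) (α k) ℂ}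
    (hB : ∀ k, B k ∈ unitary (Matrix (α k) (α k) ℂ)) :
    piMat B ∈ unitary (Matrix (∀ k, α k) (∀ k, α k) ℂ) := by
  rw [Unitary.mem_iff, Matrix.star_eq_conjTranspose, piMat_conjTranspose, piMat_mul, piMat_mul]
  constructor
  · rw [← piMat_one]; congr 1; funext k; exact (Unitary.mem_iff.1 (hB k)).1
  · rw [← piMat_one]; congr 1; funext k; exact (Unitary.mem_iff.1 (hB k)).2

theorem piMat_specProj (B : ∀ k, Matrix (α k) (α k) ℂ) (S : ∀ k, Finset (α k)) :
    piMat (fun k => specProj (B k) (S k)) = specProj (piMat B) (Fintype.piFinset S) := by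
  rw [specProj, piMat_conjTranspose]
  have e : Matrix.diagonal (fun j : ∀ k, α k => if j ∈ Fintype.piFinset S then (1 : ℂ) else 0) =
      piMat fun k => Matrix.diagonal fun j => if j ∈ S k then (1 : ℂ) else 0 := by
    rw [piMat_diagonal]
    congr 1
    funext j
    rw [Finset.prod_ite_zero]
    simp
  rw [e, piMat_mul, piMat_mul]
  rfl

/-- If the factors of a product operator are nearly scalar on the factors of a product space, the
operator has nearly the same expectation value in all (possibly entangled) unit vectors. -/
theorem norm_dotProduct_piMat_sub_le {B : ∀ k, Matrix (α k) (α k) ℂ}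
    (hB : ∀ k, B k ∈ unitary (Matrix (α k) (α k) ℂ)) {S : ∀ k, Finset (α k)}
    {E : ∀ k, Matrix (α k) (α k) ℂ} (hE : ∀ k, ‖E k‖ ≤ 1) {c : ι → ℂ} (hc : ∀ k, ‖c k‖ ≤ 1)
    {δ : ι → ℝ} (h : ∀ k, ‖specProj (B k) (S k) * E k * specProj (B k) (S k) -
      c k • specProj (B k) (S k)‖ ≤ δ k)
    {g : (∀ k, α k) → ℂ} (hg : g ∈ specSpace (piMat B) (Fintype.piFinset S)) (hg1 : IsUnitVec g) :
    ‖star g ⬝ᵥ (piMat E *ᵥ g) - ∏ k, c k‖ ≤ ∑ k, δ k := by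
  set Q : ∀ k, Matrix (α k) (α k) ℂ := fun k => specProj (B k) (S k) with hQ
  have hQg : piMat Q *ᵥ g = g := by
    rw [hQ, piMat_specProj]
    exact specProj_mulVec_of_mem (piMat_mem_unitary hB) hg
  have hQs : ∀ z, star g ⬝ᵥ (piMat Q *ᵥ z) = star g ⬝ᵥ z := fun z => by
    rw [Matrix.dotProduct_mulVec, ← Matrix.conjTranspose_conjTranspose (piMat Q),
      ← Matrix.star_mulVec, hQ, piMat_specProj, specProj_conjTranspose, ← piMat_specProj]
    exact congrArg (fun u => star u ⬝ᵥ z) hQg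
  have e1 : star g ⬝ᵥ (piMat E *ᵥ g) = star g ⬝ᵥ (piMat (fun k => Q k * E k * Q k) *ᵥ g) := by
    rw [← piMat_mul, ← piMat_mul, ← Matrix.mulVec_mulVec, hQg, ← Matrix.mulVec_mulVec, hQs]
  have e2 : (∏ k, c k) = star g ⬝ᵥ (piMat (fun k => c k • Q k) *ᵥ g) := by
    have h1 : star g ⬝ᵥ g = 1 := hg1
    rw [piMat_smul, Matrix.smul_mulVec, hQg, dotProduct_smul, h1, smul_eq_mul, mul_one]
  rw [e1, e2, ← dotProduct_sub, ← Matrix.sub_mulVec]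
  have hQn : ∀ k, ‖Q k‖ ≤ 1 := fun k => norm_specProj_le (hB k) _
  refine (norm_dotProduct_mulVec_le _ hg1 hg1).trans ((norm_piMat_sub_le (fun k => ?_)
    fun k => ?_).trans (Finset.sum_le_sum fun k _ => h k))
  · calc _ ≤ ‖Q k‖ * ‖E k‖ * ‖Q k‖ := norm_mul₃_le
      _ ≤ 1 * 1 * 1 := by gcongr <;> simp [hQn, hE]
      _ = 1 := by norm_num
  · rw [norm_smul]
    exact mul_le_one₀ (hc k) (norm_nonneg _) (hQn k)

end ProductProjection

/-! ### Dimension bound from energies -/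

section Energy

variable {n : Type*} [Fintype n] [DecidableEq n]

/-- If a unitary maps every unit vector of `V` to a vector with energy below the gap, then the
dimension of `V` is at most that of the low-energy space: otherwise some image would be orthogonal
to all the eigenvectors of low energy. -/
theorem finrank_le_card_of_energy_lt {B : Matrix n n ℂ} (hB : B ∈ unitary (Matrix n n ℂ))
    {S : Finset n} {ev : n → ℝ} {e₁ : ℝ} (hev : ∀ j, j ∉ S → e₁ ≤ ev j)
    {U : Matrix n n ℂ} (hU : U ∈ unitary (Matrix n n ℂ)) {V : Submodule ℂ (n → ℂ)}
    (h : ∀ v ∈ V, IsUnitVec v →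
      (star v ⬝ᵥ ((Uᴴ * (B * Matrix.diagonal (fun j => (ev j : ℂ)) * Bᴴ) * U) *ᵥ v)).re < e₁) :
    Module.finrank ℂ V ≤ S.card := by
  by_contra hlt
  push Not at hlt
  let F : V →ₗ[ℂ] (S → ℂ) :=
    { toFun := fun v j => (Bᴴ *ᵥ (U *ᵥ v.1)) j
      map_add' := fun v w => by ext j; simp [Matrix.mulVec_add]
      map_smul' := fun c v => by ext j; simp [Matrix.mulVec_smul] }
  have hker : LinearMap.ker F ≠ ⊥ := LinearMap.ker_ne_bot_of_finrank_lt (by simpa using hlt)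
  obtain ⟨v, hv, hv0⟩ := (Submodule.ne_bot_iff _).1 hker
  have hn0 : ‖(WithLp.toLp 2 v.1 : EuclideanSpace ℂ n)‖ ≠ 0 := by
    rw [norm_ne_zero_iff]
    intro h0
    exact hv0 (Subtype.ext (by simpa using h0))
  set a : ℂ := ((‖(WithLp.toLp 2 v.1 : EuclideanSpace ℂ n)‖ : ℂ))⁻¹ with ha
  set u : n → ℂ := a • v.1 with hu
  have hu1 : IsUnitVec u := by
    rw [isUnitVec_iff, hu, WithLp.toLp_smul, norm_smul, ha, norm_inv, Complex.norm_real, norm_norm,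
      inv_mul_cancel₀ hn0]
  have hzero : ∀ j ∈ S, (Bᴴ *ᵥ (U *ᵥ u)) j = 0 := fun j hj => by
    have : F v = 0 := hv
    have := congrFun this ⟨j, hj⟩
    rw [hu, Matrix.mulVec_smul, Matrix.mulVec_smul, Pi.smul_apply]
    exact (congrArg (a • ·) this).trans (smul_zero a)
  have hlow := h u (V.smul_mem _ v.2) hu1
  have hUu : star (U *ᵥ u) ⬝ᵥ (U *ᵥ u) = 1 := by
    have h1 : Uᴴ * U = 1 := (Unitary.mem_iff.1 hU).1
    rw [Matrix.star_mulVec, ← Matrix.dotProduct_mulVec, Matrix.mulVec_mulVec, h1, Matrix.one_mulVec]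
    exact hu1
  rw [star_dotProduct_self_eq_sum hB] at hUu
  rw [← Matrix.mulVec_mulVec, ← Matrix.mulVec_mulVec, Matrix.dotProduct_mulVec, ← Matrix.star_mulVec,
    star_dotProduct_mulVec_eq_sum, Complex.ofReal_re] at hlow
  have hge : e₁ * ∑ j, ‖(Bᴴ *ᵥ (U *ᵥ u)) j‖ ^ 2 ≤ ∑ j, ev j * ‖(Bᴴ *ᵥ (U *ᵥ u)) j‖ ^ 2 := by
    rw [Finset.mul_sum]
    refine Finset.sum_le_sum fun j _ => ?_
    by_cases hj : j ∈ S
    · simp [hzero j hj]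
    · exact mul_le_mul_of_nonneg_right (hev j hj) (sq_nonneg _)
  have h1 : ∑ j, ‖(Bᴴ *ᵥ (U *ᵥ u)) j‖ ^ 2 = 1 := by exact_mod_cast hUu
  rw [h1, mul_one] at hge
  linarith

theorem energy_le_of_mem_specSpace {B : Matrix n n ℂ} (hB : B ∈ unitary (Matrix n n ℂ))
    {S : Finset n} {ev : n → ℝ} {e₀ : ℝ} (hev : ∀ j ∈ S, ev j ≤ e₀) {v : n → ℂ}
    (hv : v ∈ specSpace B S) (hv1 : IsUnitVec v) :
    (star v ⬝ᵥ ((B * Matrix.diagonal (fun j => (ev j : ℂ)) * Bᴴ) *ᵥ v)).re ≤ e₀ := by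
  have h1 : star v ⬝ᵥ v = 1 := hv1
  rw [star_dotProduct_self_eq_sum hB] at h1
  have h2 : ∑ j, ‖(Bᴴ *ᵥ v) j‖ ^ 2 = 1 := by exact_mod_cast h1
  rw [star_dotProduct_mulVec_eq_sum, Complex.ofReal_re, ← mul_one e₀, ← h2, Finset.mul_sum]
  refine Finset.sum_le_sum fun j _ => ?_
  by_cases hj : j ∈ S
  · exact mul_le_mul_of_nonneg_right (hev j hj) (sq_nonneg _)
  · simp [hv j hj]

end Energy

/-! ### Matrix units -/

section MatUnit

variable {X : Type*} [Fintype X] [DecidableEq X] {m : X → ℕ}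

theorem norm_single_le {n : Type*} [Fintype n] [DecidableEq n] (i j : n) :
    ‖(Matrix.single i j 1 : Matrix n n ℂ)‖ ≤ 1 := by
  have h : ‖(Matrix.single i j 1 : Matrix n n ℂ)‖ * ‖(Matrix.single i j 1 : Matrix n n ℂ)‖ ≤ 1 := by
    rw [← Matrix.l2_opNorm_conjTranspose_mul_self, Matrix.conjTranspose_single,
      Matrix.single_mul_single_same, star_one, one_mul, ← Matrix.diagonal_single,
      Matrix.l2_opNorm_diagonal]
    refine (pi_norm_le_iff_of_nonneg zero_le_one).2 fun k => ?_
    by_cases hk : k = j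
    · subst hk; simp
    · simp [hk]
  nlinarith [norm_nonneg (Matrix.single i j 1 : Matrix n n ℂ)]

/-- The operator `|σ⟩⟨τ| ⊗ 1`, with `|σ⟩⟨τ|` acting on the factors in `S`. -/
def matUnit (S : Finset X) (σ τ : Cfg fun x : S => m x) : Op m :=
  amplify (Equiv.piEquivPiSubtypeProd (· ∈ S) fun x => Fin (m x)) (Matrix.single σ τ 1)

theorem norm_matUnit_le (S : Finset X) (σ τ : Cfg fun x : S => m x) : ‖matUnit S σ τ‖ ≤ 1 :=
  (norm_amplify_le _ _).trans (norm_single_le _ _)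

theorem supportedOn_matUnit (S : Finset X) (σ τ : Cfg fun x : S => m x) :
    SupportedOn S (matUnit S σ τ) :=
  supportedOn_iff_exists_kronecker.2 ⟨_, rfl⟩

theorem matUnit_apply_self (S : Finset X) {w w' : Cfg m} (h : ∀ x, x ∉ S → w x = w' x) :
    matUnit S (fun x => w x) (fun x => w' x) w w' = 1 := by
  rw [matUnit, amplify_entry, if_pos]
  · exact Matrix.single_apply_same _ _ _
  · funext x
    exact h x x.2

theorem matUnit_apply_of_ne (S : Finset X) (σ τ : Cfg fun x : S => m x) {w w' : Cfg m}
    (h : ¬ ((∀ x, x ∉ S → w x = w' x) ∧ (fun x : S => w x) = σ ∧ (fun x : S => w' x) = τ)) :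
    matUnit S σ τ w w' = 0 := by
  rw [matUnit, amplify_entry]
  split_ifs with h1
  · refine Matrix.single_apply_of_ne _ _ _ _ _ ?_
    rintro ⟨rfl, rfl⟩
    exact h ⟨fun x hx => congrFun h1 ⟨x, hx⟩, rfl, rfl⟩
  · rfl

end MatUnit

/-! ### Systems placed on the torus -/

/-- Systems of linear size `N`, one for every `k : ι`, and auxiliary degrees of freedom, placed at
the sites of the torus of linear size `M`, such that distances are distorted by bounded factors
and shifts only. The site `x` carries `ℂ ^ (dim x)`, which `equiv x` factorizes into the systems at
`x` and the auxiliary space `ℂ ^ (aux x)`. Both readings of an `Intercalation` are of this form. -/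
structure Placement {d : ℕ} {ι : Type*} (D : ι → ℕ) (N M ρ : ℕ) where
  loc : ι → Torus d N → Torus d M
  dist_loc_le : ∀ k y y', torusDist (loc k y) (loc k y') ≤ 2 * torusDist y y' + ρ
  le_dist_loc : ∀ k y y', torusDist y y' ≤ torusDist (loc k y) (loc k y') + ρ
  dim : Torus d M → ℕ
  aux : Torus d M → ℕ
  equiv : ∀ x, Fin (dim x) ≃
    (∀ p : {p : ι × Torus d N // loc p.1 p.2 = x}, Fin (D p.1.1)) × Fin (aux x)

namespace Placement

variable {d : ℕ} {ι : Type*} {D : ι → ℕ} {N M ρ : ℕ} (pl : Placement (d := d) D N M ρ)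

/-- The product basis of the whole system is the product of those of the single systems and of the
auxiliary degrees of freedom. -/
def split : Cfg pl.dim ≃ (∀ k, Cfg fun _ : Torus d N => D k) × Cfg pl.aux where
  toFun w := (fun k y => (pl.equiv (pl.loc k y) (w (pl.loc k y))).1 ⟨(k, y), rfl⟩,
    fun x => (pl.equiv x (w x)).2)
  invFun s := fun x => (pl.equiv x).symm (fun p => s.1 p.1.1 p.1.2, s.2 x)
  left_inv w := by
    funext x
    rw [Equiv.symm_apply_eq]
    refine Prod.ext ?_ rfl
    funext ⟨⟨k, y⟩, h⟩
    subst h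
    rfl
  right_inv s := by
    refine Prod.ext ?_ ?_
    · funext k y
      simp
    · funext x
      simp

theorem split_fst_congr {w w' : Cfg pl.dim} {k : ι} {y : Torus d N}
    (h : w (pl.loc k y) = w' (pl.loc k y)) : (pl.split w).1 k y = (pl.split w').1 k y := by
  simp only [split, Equiv.coe_fn_mk, h]

theorem split_snd_congr {w w' : Cfg pl.dim} {x : Torus d M} (h : w x = w' x) :
    (pl.split w).2 x = (pl.split w').2 x := by
  simp only [split, Equiv.coe_fn_mk, h]

theorem eq_of_split {w w' : Cfg pl.dim} {x : Torus d M}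
    (h1 : ∀ k y, pl.loc k y = x → (pl.split w).1 k y = (pl.split w').1 k y)
    (h2 : (pl.split w).2 x = (pl.split w').2 x) : w x = w' x := by
  apply (pl.equiv x).injective
  refine Prod.ext ?_ h2
  funext ⟨⟨k, y⟩, h⟩
  have := h1 k y h
  subst h
  exact this

/-- The sites of the system `k` that are placed in `S`. -/
def sites (S : Finset (Torus d M)) (k : ι) : Finset (Torus d N) :=
  Finset.univ.filter fun y => pl.loc k y ∈ S

theorem exists_sites_subset_disk (hN : 0 < N) (x : Torus d M) (r : ℕ) (k : ι) :
    ∃ y, pl.sites (disk x r) k ⊆ disk y (2 * r + ρ) := by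
  rcases (pl.sites (disk x r) k).eq_empty_or_nonempty with h | ⟨y, hy⟩
  · exact ⟨fun _ => ⟨0, hN⟩, by simp [h]⟩
  · refine ⟨y, fun z hz => ?_⟩
    simp only [sites, Finset.mem_filter, Finset.mem_univ, true_and, mem_disk] at hy hz
    rw [mem_disk]
    have h1 := pl.le_dist_loc k y z
    have h2 := torusDist_triangle (pl.loc k y) x (pl.loc k z)
    rw [torusDist_comm (pl.loc k y) x] at h2
    omega

section Support

variable [Fintype ι] [DecidableEq ι]

theorem supportedOn_amplify_sys {k : ι} {A₀ : Finset (Torus d N)}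
    {A : Op (fun _ : Torus d N => D k)} (hA : SupportedOn A₀ A) {S : Finset (Torus d M)}
    (hS : ∀ y ∈ A₀, pl.loc k y ∈ S) :
    SupportedOn S (amplify pl.split (piEmbed (B := fun k => Cfg fun _ : Torus d N => D k) k A)) := by
  have hA' : SupportedOn (Finset.univ.filter fun y => pl.loc k y ∈ S) A :=
    hA.mono fun y hy => by simpa using hS y hy
  rw [supportedOn_iff] at hA'
  refine supportedOn_iff.2 ⟨fun w w' ⟨x, hx, hne⟩ => ?_, fun w w' z z' h1 h2 h3 h4 => ?_⟩
  · rw [amplify_entry]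
    split_ifs with haux
    · rw [piEmbed_entry]
      split_ifs with hsys
      · refine hA'.1 _ _ ?_
        by_contra hcon
        push Not at hcon
        refine hne (pl.eq_of_split (fun k' y hy => ?_) (congrFun haux x))
        by_cases hk : k' = k
        · subst hk
          exact hcon y (by simpa [hy] using hx)
        · exact congrFun (hsys k' hk) y
      · rfl
    · rfl
  · have haux : (pl.split w).2 = (pl.split w').2 ↔ (pl.split z).2 = (pl.split z').2 := by
      rw [funext_iff, funext_iff]
      refine forall_congr' fun x => ?_
      by_cases hx : x ∈ S
      · rw [pl.split_snd_congr (h3 x hx), pl.split_snd_congr (h4 x hx)]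
      · simp [pl.split_snd_congr (h1 x hx), pl.split_snd_congr (h2 x hx)]
    have hsys : (∀ j, j ≠ k → (pl.split w).1 j = (pl.split w').1 j) ↔
        (∀ j, j ≠ k → (pl.split z).1 j = (pl.split z').1 j) := by
      refine forall₂_congr fun j _ => ?_
      rw [funext_iff, funext_iff]
      refine forall_congr' fun y => ?_
      by_cases hx : pl.loc j y ∈ S
      · rw [pl.split_fst_congr (h3 _ hx), pl.split_fst_congr (h4 _ hx)]
      · simp [pl.split_fst_congr (h1 _ hx), pl.split_fst_congr (h2 _ hx)]
    have hent : A ((pl.split w).1 k) ((pl.split w').1 k) =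
        A ((pl.split z).1 k) ((pl.split z').1 k) := by
      refine hA'.2 _ _ _ _ (fun y hy => ?_) (fun y hy => ?_) (fun y hy => ?_) (fun y hy => ?_)
      · exact pl.split_fst_congr (h1 _ (by simpa using hy))
      · exact pl.split_fst_congr (h2 _ (by simpa using hy))
      · exact pl.split_fst_congr (h3 _ (by simpa using hy))
      · exact pl.split_fst_congr (h4 _ (by simpa using hy))
    rw [amplify_entry, amplify_entry, piEmbed_entry, piEmbed_entry]
    simp only [haux, hsys, hent]

theorem supportedOn_amplify_aux {x : Torus d M} {A : Matrix (Fin (pl.aux x)) (Fin (pl.aux x)) ℂ}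
    {S : Finset (Torus d M)} (hS : x ∈ S) :
    SupportedOn S (amplify (pl.split.trans (Equiv.prodComm _ _))
      (piEmbed (B := fun x => Fin (pl.aux x)) x A)) := by
  refine supportedOn_iff.2 ⟨fun w w' ⟨x', hx, hne⟩ => ?_, fun w w' z z' h1 h2 h3 h4 => ?_⟩
  · rw [amplify_entry]
    split_ifs with hsys
    · rw [piEmbed_entry, if_neg]
      intro haux
      refine hne (pl.eq_of_split (fun k y _ => congrFun (congrFun hsys k) y) (haux x' ?_))
      rintro rfl
      exact hx hS
    · rfl
  · have hsys : (pl.split w).1 = (pl.split w').1 ↔ (pl.split z).1 = (pl.split z').1 := by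
      simp only [funext_iff]
      refine forall₂_congr fun k y => ?_
      by_cases hx : pl.loc k y ∈ S
      · rw [pl.split_fst_congr (h3 _ hx), pl.split_fst_congr (h4 _ hx)]
      · simp [pl.split_fst_congr (h1 _ hx), pl.split_fst_congr (h2 _ hx)]
    have haux : (∀ j, j ≠ x → (pl.split w).2 j = (pl.split w').2 j) ↔
        (∀ j, j ≠ x → (pl.split z).2 j = (pl.split z').2 j) := by
      refine forall₂_congr fun j _ => ?_
      by_cases hx : j ∈ S
      · rw [pl.split_snd_congr (h3 _ hx), pl.split_snd_congr (h4 _ hx)]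
      · simp [pl.split_snd_congr (h1 _ hx), pl.split_snd_congr (h2 _ hx)]
    rw [amplify_entry, amplify_entry, piEmbed_entry, piEmbed_entry]
    simp only [Equiv.trans_apply, Equiv.prodComm_apply, Prod.fst_swap, Prod.snd_swap, hsys, haux,
      pl.split_snd_congr (h3 x hS), pl.split_snd_congr (h4 x hS)]
    rfl

/-- The partial expectation of an operator supported on `S` is a combination of products of matrix
units, with as many terms as there are matrix elements on the sites placed in `S`. -/
theorem partialExpectation_eq_sum (hD : ∀ k, 0 < D k) (ψ : Cfg pl.aux → ℂ)
    {S : Finset (Torus d M)} {O : Op pl.dim} (hO : SupportedOn S O) :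
    ∃ c : (∀ k, Cfg fun _ : pl.sites S k => D k) → (∀ k, Cfg fun _ : pl.sites S k => D k) → ℂ,
      (∀ σ τ, ∃ s s', c σ τ = partialExpectation pl.split ψ O s s') ∧
      partialExpectation pl.split ψ O = ∑ σ, ∑ τ, c σ τ • piMat (fun k =>
        matUnit (m := fun _ : Torus d N => D k) (pl.sites S k) (σ k) (τ k)) := by
  rw [supportedOn_iff] at hO
  -- the matrix elements do not depend on the labels outside `S` once these agree, so `glue` may
  -- fill them with zeros
  let glue : (∀ k, Cfg fun _ : pl.sites S k => D k) → ∀ k, Cfg fun _ : Torus d N => D k :=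
    fun σ k y => if h : y ∈ pl.sites S k then σ k ⟨y, h⟩ else ⟨0, hD k⟩
  refine ⟨fun σ τ => partialExpectation pl.split ψ O (glue σ) (glue τ), fun σ τ => ⟨_, _, rfl⟩, ?_⟩
  have hmem : ∀ k y, y ∈ pl.sites S k ↔ pl.loc k y ∈ S := fun k y => by simp [sites]
  have hloc : ∀ (s s' : ∀ k, Cfg fun _ : Torus d N => D k) (b b' : Cfg pl.aux) (x : Torus d M),
      (∀ k y, pl.loc k y = x → s k y = s' k y) → b x = b' x →
      pl.split.symm (s, b) x = pl.split.symm (s', b') x := by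
    intro s s' b b' x h1 h2
    exact pl.eq_of_split (fun k y hy => by simpa using h1 k y hy) (by simpa using h2)
  ext s s'
  rw [Matrix.sum_apply]
  simp only [Matrix.sum_apply, Matrix.smul_apply, smul_eq_mul]
  have hprod : ∀ σ τ, ¬ ((∀ k y, y ∉ pl.sites S k → s k y = s' k y) ∧
      (fun k (y : pl.sites S k) => s k y) = σ ∧ (fun k (y : pl.sites S k) => s' k y) = τ) →
      piMat (fun k => matUnit (m := fun _ : Torus d N => D k) (pl.sites S k) (σ k) (τ k)) s s' = 0 := by
    intro σ τ h
    have hk : ∃ k, ¬ ((∀ y, y ∉ pl.sites S k → s k y = s' k y) ∧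
        (fun y : pl.sites S k => s k y) = σ k ∧ (fun y : pl.sites S k => s' k y) = τ k) := by
      by_contra hcon
      push Not at hcon
      exact h ⟨fun k => (hcon k).1, funext fun k => (hcon k).2.1, funext fun k => (hcon k).2.2⟩
    obtain ⟨k, hk⟩ := hk
    exact Finset.prod_eq_zero (Finset.mem_univ k) (matUnit_apply_of_ne _ _ _ hk)
  by_cases H : ∀ k y, y ∉ pl.sites S k → s k y = s' k y
  · rw [Finset.sum_eq_single (fun k (y : pl.sites S k) => s k y)
      (fun σ _ hσ => Finset.sum_eq_zero fun τ _ => by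
        rw [hprod σ τ fun h => hσ h.2.1.symm, mul_zero]) (by simp),
      Finset.sum_eq_single (fun k (y : pl.sites S k) => s' k y)
      (fun τ _ hτ => by rw [hprod _ τ fun h => hτ h.2.2.symm, mul_zero]) (by simp)]
    have h1 : piMat (fun k => matUnit (m := fun _ : Torus d N => D k) (pl.sites S k)
        (fun y : pl.sites S k => s k y) (fun y : pl.sites S k => s' k y)) s s' = 1 :=
      Finset.prod_eq_one fun k _ => matUnit_apply_self _ (H k)
    rw [h1, mul_one]
    refine Finset.sum_congr rfl fun b _ => Finset.sum_congr rfl fun b' _ => ?_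
    congr 2
    by_cases hb : ∀ x, x ∉ S → b x = b' x
    · refine hO.2 _ _ _ _ (fun x hx => ?_) (fun x hx => ?_) (fun x hx => ?_) (fun x hx => ?_)
      · exact hloc _ _ _ _ x (fun k y hy => H k y (by rwa [hmem, hy])) (hb x hx)
      · refine hloc _ _ _ _ x (fun k y hy => ?_) (hb x hx)
        have : y ∉ pl.sites S k := by rwa [hmem, hy]
        simp [glue, this]
      · refine hloc _ _ _ _ x (fun k y hy => ?_) rfl
        have : y ∈ pl.sites S k := by rwa [hmem, hy]
        simp [glue, this]
      · refine hloc _ _ _ _ x (fun k y hy => ?_) rfl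
        have : y ∈ pl.sites S k := by rwa [hmem, hy]
        simp [glue, this]
    · push Not at hb
      obtain ⟨x, hx, hne⟩ := hb
      have hne' : ∀ t t' : ∀ k, Cfg fun _ : Torus d N => D k,
          pl.split.symm (t, b) x ≠ pl.split.symm (t', b') x := fun t t' h => hne (by
        simpa using pl.split_snd_congr h)
      rw [hO.1 _ _ ⟨x, hx, hne' _ _⟩, hO.1 _ _ ⟨x, hx, hne' _ _⟩]
  · rw [Finset.sum_eq_zero fun σ _ => Finset.sum_eq_zero fun τ _ => by
      rw [hprod σ τ fun h => H h.1, mul_zero]]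
    refine Finset.sum_eq_zero fun b _ => Finset.sum_eq_zero fun b' _ => ?_
    push Not at H
    obtain ⟨k, y, hy, hne⟩ := H
    rw [hO.1 _ _ ⟨pl.loc k y, by rwa [hmem] at hy, fun h => hne (by
      simpa using pl.split_fst_congr h)⟩, mul_zero, zero_mul]

theorem card_cfg_sites_le (hD : ∀ k, 0 < D k) (hN : 0 < N) (x : Torus d M) (r : ℕ) :
    Fintype.card (∀ k, Cfg fun _ : pl.sites (disk x r) k => D k) ≤
      (∏ k, D k) ^ ((2 * (2 * r + ρ) + 1) ^ d) := by
  rw [Fintype.card_pi, ← Finset.prod_pow]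
  refine Finset.prod_le_prod' fun k _ => ?_
  obtain ⟨y, hy⟩ := pl.exists_sites_subset_disk hN x r k
  rw [Fintype.card_pi]
  simp only [Fintype.card_fin, Finset.prod_const, Finset.card_univ, Fintype.card_coe]
  exact Nat.pow_le_pow_right (hD k) ((Finset.card_le_card hy).trans (card_disk_le _ _))

/-- Local indistinguishability of the states in a product of spaces, if the compression of local
operators to each of the spaces is nearly scalar. Expanding in matrix units costs a factor that is
exponential in the number of sites of the disk only. -/
theorem norm_expectation_sub_le (hD : ∀ k, 0 < D k) (hN : 0 < N)
    {B : ∀ k, Op fun _ : Torus d N => D k} (hB : ∀ k, B k ∈ unitary (Op fun _ : Torus d N => D k))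
    {S : ∀ k, Finset (Cfg fun _ : Torus d N => D k)} {ψ : Cfg pl.aux → ℂ} (hψ : IsUnitVec ψ)
    {r : ℕ} {δ : ι → ℝ}
    (h : ∀ k y (E : Op fun _ : Torus d N => D k), SupportedOn (disk y (2 * r + ρ)) E → ‖E‖ ≤ 1 →
      ∃ c : ℂ, ‖c‖ ≤ 1 ∧ ‖specProj (B k) (S k) * E * specProj (B k) (S k) -
        c • specProj (B k) (S k)‖ ≤ δ k)
    {x : Torus d M} {O : Op pl.dim} (hO : SupportedOn (disk x r) O) :
    ∃ μ : ℂ, ∀ g ∈ specSpace (piMat B) (Fintype.piFinset S), IsUnitVec g →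
      ‖star (tensVec pl.split g ψ) ⬝ᵥ (O *ᵥ tensVec pl.split g ψ) - μ‖ ≤
        (((∏ k, D k : ℕ) : ℝ) ^ ((2 * (2 * r + ρ) + 1) ^ d)) ^ 2 * ((∑ k, δ k) * ‖O‖) := by
  obtain ⟨c, hc, hsum⟩ := pl.partialExpectation_eq_sum hD ψ hO
  have hcn : ∀ σ τ, ‖c σ τ‖ ≤ ‖O‖ := fun σ τ => by
    obtain ⟨s, s', hs⟩ := hc σ τ
    rw [hs]
    exact norm_partialExpectation_apply_le _ hψ _ _ _
  choose y hy using fun k => pl.exists_sites_subset_disk hN x r k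
  choose a ha1 ha2 using fun k (σ τ : Cfg fun _ : pl.sites (disk x r) k => D k) =>
    h k (y k) (matUnit (m := fun _ : Torus d N => D k) (pl.sites (disk x r) k) σ τ)
      ((supportedOn_matUnit _ _ _).mono (hy k)) (norm_matUnit_le _ _ _)
  refine ⟨∑ σ, ∑ τ, c σ τ * ∏ k, a k (σ k) (τ k), fun g hg hg1 => ?_⟩
  rw [star_tensVec_dotProduct_mulVec, hsum]
  simp only [Matrix.sum_mulVec, dotProduct_sum, Matrix.smul_mulVec, dotProduct_smul, smul_eq_mul,
    ← Finset.sum_sub_distrib, ← mul_sub]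
  have hδ : 0 ≤ (∑ k, δ k) * ‖O‖ := by
    refine mul_nonneg (Finset.sum_nonneg fun k _ => ?_) (norm_nonneg _)
    obtain ⟨c, -, hc⟩ := h k (y k) 0 (localAlgebra (fun _ => D k) _).zero_mem (by simp)
    exact (norm_nonneg _).trans hc
  have hterm : ∀ σ τ, ‖c σ τ * (star g ⬝ᵥ (piMat (fun k =>
      matUnit (m := fun _ : Torus d N => D k) (pl.sites (disk x r) k) (σ k) (τ k)) *ᵥ g) -
        ∏ k, a k (σ k) (τ k))‖ ≤ (∑ k, δ k) * ‖O‖ := fun σ τ => by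
    rw [norm_mul, mul_comm]
    exact mul_le_mul (norm_dotProduct_piMat_sub_le hB (fun k => norm_matUnit_le _ _ _)
      (fun k => ha1 k _ _) (fun k => ha2 k _ _) hg hg1) (hcn σ τ) (norm_nonneg _)
      ((norm_nonneg _).trans (norm_dotProduct_piMat_sub_le hB (fun k => norm_matUnit_le _ _ _)
      (fun k => ha1 k (σ k) (τ k)) (fun k => ha2 k _ _) hg hg1))
  calc _ ≤ ∑ _σ : (∀ k, Cfg fun _ : pl.sites (disk x r) k => D k),
        ∑ _τ : (∀ k, Cfg fun _ : pl.sites (disk x r) k => D k), (∑ k, δ k) * ‖O‖ :=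
        (norm_sum_le _ _).trans (Finset.sum_le_sum fun σ _ =>
          (norm_sum_le _ _).trans (Finset.sum_le_sum fun τ _ => hterm σ τ))
    _ = (Fintype.card (∀ k, Cfg fun _ : pl.sites (disk x r) k => D k) : ℝ) ^ 2 *
          ((∑ k, δ k) * ‖O‖) := by
        simp only [Finset.sum_const, Finset.card_univ, nsmul_eq_mul]
        ring
    _ ≤ _ := by
        gcongr
        exact_mod_cast pl.card_cfg_sites_le hD hN x r

end Support

end Placement

/-! ### Spectral subspaces of tensor products -/

section TensorSpectral

variable {n α β : Type*}

/-- The labels of the product vectors whose first factor is labelled by `S` and whose second factor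
is `b`. -/
def prodLabels (e : n ≃ α × β) (S : Finset α) (b : β) : Finset n :=
  (S ×ˢ {b}).map e.symm.toEmbedding

theorem mem_prodLabels {e : n ≃ α × β} {S : Finset α} {b : β} {w : n} :
    w ∈ prodLabels e S b ↔ (e w).1 ∈ S ∧ (e w).2 = b := by
  rw [prodLabels, Finset.mem_map_equiv, Equiv.symm_symm, Finset.mem_product, Finset.mem_singleton]

theorem card_prodLabels (e : n ≃ α × β) (S : Finset α) (b : β) :
    (prodLabels e S b).card = S.card := by
  rw [prodLabels, Finset.card_map, Finset.card_product, Finset.card_singleton, mul_one]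

variable [Fintype n] [Fintype α] [Fintype β] [DecidableEq β]

theorem tensVec_mem_specSpace (e : n ≃ α × β) {B : Matrix α α ℂ} {B' : Matrix β β ℂ}
    (hB' : B' ∈ unitary (Matrix β β ℂ)) {S : Finset α} {b : β} {g : α → ℂ}
    (hg : g ∈ specSpace B S) :
    tensVec e g (B' *ᵥ Pi.single b 1) ∈ specSpace (tensMat e B B') (prodLabels e S b) := by
  intro w hw
  have h3 := (Unitary.mem_iff.1 hB').1
  rw [Matrix.star_eq_conjTranspose] at h3
  rw [tensMat_conjTranspose, tensMat_mulVec_tensVec, Matrix.mulVec_mulVec, h3, Matrix.one_mulVec,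
    tensVec]
  rw [mem_prodLabels] at hw
  by_cases h : (e w).1 ∈ S
  · rw [Pi.single_eq_of_ne (fun h' => hw ⟨h, h'⟩), mul_zero]
  · rw [hg _ h, zero_mul]

variable [DecidableEq n] [DecidableEq α]

theorem tensMat_mem_unitary (e : n ≃ α × β) {B : Matrix α α ℂ} {B' : Matrix β β ℂ}
    (hB : B ∈ unitary (Matrix α α ℂ)) (hB' : B' ∈ unitary (Matrix β β ℂ)) :
    tensMat e B B' ∈ unitary (Matrix n n ℂ) := by
  obtain ⟨h1, h2⟩ := Unitary.mem_iff.1 hB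
  obtain ⟨h3, h4⟩ := Unitary.mem_iff.1 hB'
  rw [Matrix.star_eq_conjTranspose] at h1 h2 h3 h4
  rw [Unitary.mem_iff, Matrix.star_eq_conjTranspose, tensMat_conjTranspose, tensMat_mul, tensMat_mul,
    h1, h2, h3, h4, tensMat_one]
  exact ⟨rfl, rfl⟩

theorem exists_eq_tensVec_of_mem_specSpace (e : n ≃ α × β) {B : Matrix α α ℂ} {B' : Matrix β β ℂ}
    (hB : B ∈ unitary (Matrix α α ℂ)) (hB' : B' ∈ unitary (Matrix β β ℂ)) {S : Finset α} {b : β}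
    {v : n → ℂ} (hv : v ∈ specSpace (tensMat e B B') (prodLabels e S b)) :
    ∃ g ∈ specSpace B S, v = tensVec e g (B' *ᵥ Pi.single b 1) := by
  set c := (tensMat e B B')ᴴ *ᵥ v with hc
  set γ : α → ℂ := fun s => c (e.symm (s, b)) with hγ
  have hcγ : c = tensVec e γ (Pi.single b 1) := by
    funext w
    rw [tensVec]
    by_cases h : (e w).2 = b
    · rw [h, Pi.single_eq_same, mul_one, hγ]
      simp only
      rw [← h, Prod.mk.eta, Equiv.symm_apply_apply]
    · rw [Pi.single_eq_of_ne h, mul_zero]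
      exact hv w fun hw => h (mem_prodLabels.1 hw).2
  have h1 := (Unitary.mem_iff.1 hB).1
  rw [Matrix.star_eq_conjTranspose] at h1
  have h2 := (Unitary.mem_iff.1 (tensMat_mem_unitary e hB hB')).2
  rw [Matrix.star_eq_conjTranspose] at h2
  refine ⟨B *ᵥ γ, fun s hs => ?_, ?_⟩
  · rw [Matrix.mulVec_mulVec, h1, Matrix.one_mulVec]
    refine hv _ fun hw => hs ?_
    have := (mem_prodLabels.1 hw).1
    simpa using this
  · rw [← tensMat_mulVec_tensVec, ← hcγ, hc, Matrix.mulVec_mulVec, h2, Matrix.one_mulVec]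

/-- A unit vector is a column of a unitary matrix. -/
theorem exists_unitary_mulVec_single_eq {a : n → ℂ} (ha : IsUnitVec a) :
    ∃ B ∈ unitary (Matrix n n ℂ), ∃ i, B *ᵥ Pi.single i 1 = a := by
  have hne : Nonempty n := by
    by_contra h
    rw [not_nonempty_iff] at h
    have h1 : star a ⬝ᵥ a = 1 := ha
    simp at h1
  obtain ⟨i⟩ := hne
  let v : n → EuclideanSpace ℂ n := fun _ => WithLp.toLp 2 a
  have hv : Orthonormal ℂ (({i} : Set n).domRestrict v) := by
    refine ⟨fun _ => (isUnitVec_iff a).1 ha, fun x y hxy => ?_⟩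
    exact absurd (Subsingleton.elim x y) hxy
  obtain ⟨b, hb⟩ := hv.exists_orthonormalBasis_extension_of_card_eq (by simp)
  refine ⟨(EuclideanSpace.basisFun n ℂ).toBasis.toMatrix b.toBasis, ?_, i, ?_⟩
  · simpa using (EuclideanSpace.basisFun n ℂ).toMatrix_orthonormalBasis_mem_unitary b
  · rw [Matrix.mulVec_single_one]
    ext j
    have := congrArg (fun w : EuclideanSpace ℂ n => w j) (hb i rfl)
    simpa [Module.Basis.toMatrix_apply, v] using this

end TensorSpectral

section ProductHamiltonian

variable {ι : Type*} [Fintype ι] [DecidableEq ι] {α : ι → Type*} [∀ k, Fintype (α k)]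
  [∀ k, DecidableEq (α k)]

theorem piMat_conj_piEmbed {B : ∀ k, Matrix (α k) (α k) ℂ}
    (hB : ∀ k, B k ∈ unitary (Matrix (α k) (α k) ℂ)) (k : ι) (A : Matrix (α k) (α k) ℂ) :
    piMat B * piEmbed k A * (piMat B)ᴴ = piEmbed k (B k * A * (B k)ᴴ) := by
  rw [piEmbed_apply, piEmbed_apply, piMat_conjTranspose, piMat_mul, piMat_mul]
  congr 1
  funext j
  by_cases h : j = k
  · subst h; simp
  · simp only [Function.update_of_ne h, mul_one]
    exact (Unitary.mem_iff.1 (hB j)).2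

theorem piEmbed_diagonal (k : ι) (D : α k → ℂ) :
    piEmbed k (Matrix.diagonal D) = Matrix.diagonal fun w => D (w k) := by
  ext w w'
  rw [piEmbed_entry]
  by_cases h : w = w'
  · subst h; simp
  · rw [Matrix.diagonal_apply_ne _ h]
    split_ifs with h1
    · refine Matrix.diagonal_apply_ne _ fun h2 => h (funext fun j => ?_)
      by_cases hj : j = k
      · subst hj; exact h2
      · exact h1 j hj
    · rfl

theorem amplify_diagonal {n β γ : Type*} [Fintype n] [DecidableEq n] [Fintype β] [DecidableEq β]
    [Fintype γ] [DecidableEq γ] (e : n ≃ β × γ) (D : β → ℂ) :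
    amplify e (Matrix.diagonal D) = Matrix.diagonal fun w => D (e w).1 := by
  ext w w'
  rw [amplify_entry]
  by_cases h : w = w'
  · subst h; simp
  · rw [Matrix.diagonal_apply_ne _ h]
    split_ifs with h1
    · exact Matrix.diagonal_apply_ne _ fun h2 => h (e.injective (Prod.ext h2 h1))
    · rfl

theorem sum_conj_diagonal {n κ : Type*} [Fintype n] [DecidableEq n] [Fintype κ] (B : Matrix n n ℂ)
    (D : κ → n → ℂ) : ∑ i, B * Matrix.diagonal (D i) * Bᴴ =
      B * Matrix.diagonal (fun j => ∑ i, D i j) * Bᴴ := by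
  rw [← Finset.sum_mul, ← Finset.mul_sum]
  congr 2
  ext j j'
  rw [Matrix.sum_apply]
  by_cases h : j = j'
  · subst h; simp
  · simp [h]

end ProductHamiltonian

/-! ### Gapped subspaces and the dimension bound -/

section Gapped

universe u

variable {d M : ℕ} {m : Torus d M → ℕ}

/-- `V` is the space of the eigenvectors with energy at most `E + Δ / 2` of a Hamiltonian that is a
sum of at most `n` terms of norm at most `J`, supported on disks of radius `R`, and whose other
eigenvalues are at least `E + Δ`. The Hamiltonian is given by its diagonalization, with the
eigenvectors as columns of `B`. -/
def IsGappedSubspace (V : Submodule ℂ (Cfg m → ℂ)) (R : ℕ) (J Δ : ℝ) (n : ℕ) : Prop :=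
  ∃ (B : Op m) (S : Finset (Cfg m)) (ev : Cfg m → ℝ) (E : ℝ) (κ : Type u) (_ : Fintype κ)
    (h : κ → Op m) (c : κ → Torus d M),
    B ∈ unitary (Op m) ∧ V = specSpace B S ∧ (∀ j ∈ S, ev j ≤ E + Δ / 2) ∧
    (∀ j, j ∉ S → E + Δ ≤ ev j) ∧ Fintype.card κ ≤ n ∧
    (∀ i, SupportedOn (disk (c i) R) (h i) ∧ ‖h i‖ ≤ J) ∧
    ∑ i, h i = B * Matrix.diagonal (fun j => (ev j : ℂ)) * Bᴴ

theorem isUnitVec_mulVec {n : Type*} [Fintype n] [DecidableEq n] {U : Matrix n n ℂ}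
    (hU : U ∈ unitary (Matrix n n ℂ)) {v : n → ℂ} (hv : IsUnitVec v) : IsUnitVec (U *ᵥ v) := by
  have h1 : Uᴴ * U = 1 := (Unitary.mem_iff.1 hU).1
  rw [IsUnitVec, Matrix.star_mulVec, ← Matrix.dotProduct_mulVec, Matrix.mulVec_mulVec, h1,
    Matrix.one_mulVec]
  exact hv

/-- A unitary that keeps local operators approximately local and maps one vector of a locally
indistinguishable space `V` into a gapped space `V'` maps all unit vectors of `V` to vectors of
low energy, so `V` is not larger than `V'`. -/
theorem finrank_le_of_isGappedSubspace {V V' : Submodule ℂ (Cfg m → ℂ)} {R r n : ℕ}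
    {J Δ δ ε : ℝ} (hV' : IsGappedSubspace.{u} V' R J Δ n) (hδ : 0 ≤ δ) (hJ : 0 ≤ J)
    (hV : ∀ x (O : Op m), SupportedOn (disk x r) O → ∃ μ : ℂ, ∀ v ∈ V, IsUnitVec v →
      ‖star v ⬝ᵥ (O *ᵥ v) - μ‖ ≤ δ * ‖O‖)
    {U : Op m} (hU : U ∈ unitary (Op m))
    (hloc : ∀ x (A : Op m), SupportedOn (disk x R) A → ‖A‖ ≤ J →
      ∃ A', SupportedOn (disk x r) A' ∧ ‖Uᴴ * A * U - A'‖ ≤ ε)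
    {v₁ : Cfg m → ℂ} (hv₁ : v₁ ∈ V) (hv₁u : IsUnitVec v₁) (hUv₁ : U *ᵥ v₁ ∈ V')
    (hε : 0 ≤ ε) (hsmall : n * (2 * ε + 2 * (δ * (J + ε))) < Δ / 2) :
    Module.finrank ℂ V ≤ Module.finrank ℂ V' := by
  obtain ⟨B, S, ev, E, κ, _, h, c, hB, rfl, hlow, hhigh, hn, hh, hsum⟩ := hV'
  rw [finrank_specSpace hB]
  refine finrank_le_card_of_energy_lt hB hhigh hU fun v hv hvu => ?_
  have hterm : ∀ i, ‖star v ⬝ᵥ ((Uᴴ * h i * U) *ᵥ v) - star v₁ ⬝ᵥ ((Uᴴ * h i * U) *ᵥ v₁)‖ ≤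
      2 * ε + 2 * (δ * (J + ε)) := by
    intro i
    obtain ⟨A', hA', hnear⟩ := hloc (c i) (h i) (hh i).1 (hh i).2
    obtain ⟨μ, hμ⟩ := hV (c i) A' hA'
    have hA'n : ‖A'‖ ≤ J + ε := by
      have h1 : ‖Uᴴ * h i * U‖ ≤ ‖h i‖ := norm_star_mul_mul_le hU (h i)
      calc ‖A'‖ = ‖Uᴴ * h i * U - (Uᴴ * h i * U - A')‖ := by rw [sub_sub_cancel]
        _ ≤ ‖Uᴴ * h i * U‖ + ‖Uᴴ * h i * U - A'‖ := norm_sub_le _ _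
        _ ≤ J + ε := add_le_add (h1.trans (hh i).2) hnear
    have hone : ∀ w ∈ V, IsUnitVec w →
        ‖star w ⬝ᵥ ((Uᴴ * h i * U) *ᵥ w) - μ‖ ≤ ε + δ * (J + ε) := by
      intro w hw hwu
      have e : star w ⬝ᵥ ((Uᴴ * h i * U) *ᵥ w) - μ =
          star w ⬝ᵥ ((Uᴴ * h i * U - A') *ᵥ w) + (star w ⬝ᵥ (A' *ᵥ w) - μ) := by
        rw [Matrix.sub_mulVec, dotProduct_sub]; ring
      rw [e]
      refine (norm_add_le _ _).trans (add_le_add ?_ ?_)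
      · exact (norm_dotProduct_mulVec_le _ hwu hwu).trans hnear
      · exact (hμ w hw hwu).trans (mul_le_mul_of_nonneg_left hA'n hδ)
    have e : star v ⬝ᵥ ((Uᴴ * h i * U) *ᵥ v) - star v₁ ⬝ᵥ ((Uᴴ * h i * U) *ᵥ v₁) =
        (star v ⬝ᵥ ((Uᴴ * h i * U) *ᵥ v) - μ) - (star v₁ ⬝ᵥ ((Uᴴ * h i * U) *ᵥ v₁) - μ) := by ring
    rw [e]
    refine (norm_sub_le _ _).trans ?_
    have a1 := hone v hv hvu
    have a2 := hone v₁ hv₁ hv₁u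
    linarith
  have hexp : ∀ w : Cfg m → ℂ, star w ⬝ᵥ ((Uᴴ * (∑ i, h i) * U) *ᵥ w) =
      ∑ i, star w ⬝ᵥ ((Uᴴ * h i * U) *ᵥ w) := fun w => by
    rw [Finset.mul_sum, Finset.sum_mul, Matrix.sum_mulVec, dotProduct_sum]
  have h1 : (star v₁ ⬝ᵥ ((Uᴴ * (∑ i, h i) * U) *ᵥ v₁)).re ≤ E + Δ / 2 := by
    have := energy_le_of_mem_specSpace hB hlow hUv₁ (isUnitVec_mulVec hU hv₁u)
    rw [← hsum] at this
    rwa [← Matrix.mulVec_mulVec, ← Matrix.mulVec_mulVec, Matrix.dotProduct_mulVec,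
      ← Matrix.star_mulVec]
  have h2 : ‖star v ⬝ᵥ ((Uᴴ * (∑ i, h i) * U) *ᵥ v) -
      star v₁ ⬝ᵥ ((Uᴴ * (∑ i, h i) * U) *ᵥ v₁)‖ < Δ / 2 := by
    rw [hexp, hexp, ← Finset.sum_sub_distrib]
    refine lt_of_le_of_lt ((norm_sum_le _ _).trans (Finset.sum_le_sum fun i _ => hterm i)) ?_
    rw [Finset.sum_const, nsmul_eq_mul, Finset.card_univ]
    refine lt_of_le_of_lt ?_ hsmall
    have hη : 0 ≤ 2 * ε + 2 * (δ * (J + ε)) := by positivity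
    gcongr
  have h3 := Complex.re_le_norm (star v ⬝ᵥ ((Uᴴ * (∑ i, h i) * U) *ᵥ v) -
      star v₁ ⬝ᵥ ((Uᴴ * (∑ i, h i) * U) *ᵥ v₁))
  rw [Complex.sub_re] at h3
  rw [← hsum]
  linarith

end Gapped

/-! ### Ground spaces of phases and of placed systems -/

section Phase

variable {d : ℕ}

theorem LatticeModel.isHermitian_hamiltonian (P : LatticeModel d) (N : ℕ) :
    (P.hamiltonian N).IsHermitian :=
  isSelfAdjoint_sum _ fun x _ => (P.isHermitian N x).isSelfAdjoint

/-- The unitary matrix whose columns are the eigenvectors of the Hamiltonian. -/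
def GappedPhase.eigenBasis (P : GappedPhase d) (N : ℕ) : Op fun _ : Torus d N => P.D :=
  (P.isHermitian_hamiltonian N).eigenvectorUnitary.1

/-- The energy splitting that is allowed in the ground space. -/
def GappedPhase.splitting (P : GappedPhase d) (N : ℕ) : ℝ :=
  P.C * Real.exp (-P.c * (N : ℝ) ^ P.α)

/-- The labels of the eigenvectors that span the ground space. -/
def GappedPhase.lowLabels (P : GappedPhase d) (N : ℕ) : Finset (Cfg fun _ : Torus d N => P.D) :=
  Finset.univ.filter fun j => (P.isHermitian_hamiltonian N).eigenvalues j ≤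
    groundEnergy (P.hamiltonian N) + P.splitting N

theorem GappedPhase.eigenBasis_mem_unitary (P : GappedPhase d) (N : ℕ) :
    P.eigenBasis N ∈ unitary (Op fun _ : Torus d N => P.D) :=
  (P.isHermitian_hamiltonian N).eigenvectorUnitary.2

theorem GappedPhase.groundSpace_eq (P : GappedPhase d) (N : ℕ) :
    P.groundSpace N = specSpace (P.eigenBasis N) (P.lowLabels N) :=
  lowEnergySpace_eq_specSpace (P.isHermitian_hamiltonian N) _

theorem GappedPhase.degeneracy_eq (P : GappedPhase d) (N : ℕ) :
    P.degeneracy N = (P.lowLabels N).card := by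
  rw [GappedPhase.degeneracy, groundSpace_eq, finrank_specSpace (P.eigenBasis_mem_unitary N)]

/-- In a locally indistinguishable ground space, the compression of a local operator is nearly
scalar. -/
theorem GappedPhase.exists_norm_compression_le (P : GappedPhase d) {N : ℕ} {ε : ℝ} (hε : 0 ≤ ε)
    {r : ℕ}
    (h : ∀ g ∈ P.groundSpace N, ∀ g' ∈ P.groundSpace N, IsUnitVec g → IsUnitVec g' →
      star g ⬝ᵥ g' = 0 → ∀ (x : Torus d N) (O : Op fun _ : Torus d N => P.D),
      SupportedOn (disk x r) O → ‖O‖ ≤ 1 → ‖star g ⬝ᵥ (O *ᵥ g')‖ < ε ∧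
        ‖star g ⬝ᵥ (O *ᵥ g) - star g' ⬝ᵥ (O *ᵥ g')‖ < 2 * ε)
    {g : P.State N} (hg : g ∈ P.groundSpace N) (hg1 : IsUnitVec g) (x : Torus d N)
    (O : Op fun _ : Torus d N => P.D) (hO : SupportedOn (disk x r) O) (hO1 : ‖O‖ ≤ 1) :
    ∃ c : ℂ, ‖c‖ ≤ 1 ∧
      ‖specProj (P.eigenBasis N) (P.lowLabels N) * O * specProj (P.eigenBasis N) (P.lowLabels N) -
        c • specProj (P.eigenBasis N) (P.lowLabels N)‖ ≤ 8 * ε := by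
  refine ⟨star g ⬝ᵥ (O *ᵥ g), (norm_dotProduct_mulVec_le O hg1 hg1).trans hO1,
    norm_specProj_compression_le (P.eigenBasis_mem_unitary N) (by positivity) fun y hy z hz => ?_⟩
  rw [← P.groundSpace_eq] at hy hz
  let V : Submodule ℂ (EuclideanSpace ℂ (Cfg fun _ : Torus d N => P.D)) :=
    (P.groundSpace N).comap (WithLp.linearEquiv 2 ℂ _).toLinearMap
  have key := norm_inner_sub_le_of_orthonormal (V := V) (T := Matrix.toEuclideanLin O) (ε := ε)
    (fun u hu u' hu' hu1 hu1' huu' => by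
      obtain ⟨h1, h2⟩ := h u.ofLp hu u'.ofLp hu' ((isUnitVec_iff _).2 hu1) ((isUnitVec_iff _).2 hu1')
        (by rw [← inner_toLp_eq]; exact huu') x O hO hO1
      rw [← inner_toLp_eq] at h1
      rw [← inner_toLp_eq, ← inner_toLp_eq] at h2
      exact ⟨h1.le, h2.le⟩) hε (g := WithLp.toLp 2 g) hg ((isUnitVec_iff g).1 hg1)
    (x := WithLp.toLp 2 y) (y := WithLp.toLp 2 z) hy hz
  rw [← inner_toLp_eq, ← inner_toLp_eq, ← inner_toLp_eq]
  exact key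

end Phase

section Composite

universe u

variable {d : ℕ} {ι : Type u} [Fintype ι] [DecidableEq ι] {P : ι → GappedPhase d} {N M ρ : ℕ}

theorem piVec_single {κ : Type*} [Fintype κ] [DecidableEq κ] {α : κ → Type*}
    [∀ k, DecidableEq (α k)] (i : ∀ k, α k) :
    piVec (fun k => (Pi.single (i k) 1 : α k → ℂ)) = Pi.single i 1 := by
  ext w
  by_cases h : w = i
  · subst h; simp [piVec]
  · obtain ⟨k, hk⟩ := Function.ne_iff.1 h
    rw [Pi.single_eq_of_ne h]
    exact Finset.prod_eq_zero (Finset.mem_univ k) (Pi.single_eq_of_ne hk _)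

/-- The product of the ground spaces of placed systems and of a product state of the auxiliary
degrees of freedom: its dimension, the states in it, a gapped Hamiltonian that has it as its ground
space, and its local indistinguishability. -/
theorem Placement.exists_groundSpace (pl : Placement (d := d) (fun k => (P k).D) N M ρ)
    {a : ∀ x, Fin (pl.aux x) → ℂ} (ha : ∀ x, IsUnitVec (a x)) :
    ∃ V : Submodule ℂ (Cfg pl.dim → ℂ),
      Module.finrank ℂ V = ∏ k, (P k).degeneracy N ∧
      (∀ φ : ∀ k, (P k).State N, (∀ k, φ k ∈ (P k).groundSpace N) →
        tensVec pl.split (piVec φ) (piVec a) ∈ V) ∧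
      (∀ (Δ J : ℝ) (R : ℕ), Δ ≤ 1 → 1 ≤ J →
        (∀ k, (P k).L₀ ≤ N ∧ Δ ≤ (P k).Δ ∧ (P k).J ≤ J ∧ 2 * (P k).R + ρ ≤ R) →
        ∑ k, (P k).splitting N ≤ Δ / 2 →
        IsGappedSubspace.{u} V R J Δ (Fintype.card ι * N ^ d + M ^ d)) ∧
      ∀ (r : ℕ) (δ : ι → ℝ), 0 < N →
        (∀ k y (E : Op fun _ : Torus d N => (P k).D), SupportedOn (disk y (2 * r + ρ)) E →
          ‖E‖ ≤ 1 → ∃ c : ℂ, ‖c‖ ≤ 1 ∧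
          ‖specProj ((P k).eigenBasis N) ((P k).lowLabels N) * E *
            specProj ((P k).eigenBasis N) ((P k).lowLabels N) -
            c • specProj ((P k).eigenBasis N) ((P k).lowLabels N)‖ ≤ δ k) →
        ∀ x (O : Op pl.dim), SupportedOn (disk x r) O → ∃ μ : ℂ, ∀ v ∈ V, IsUnitVec v →
          ‖star v ⬝ᵥ (O *ᵥ v) - μ‖ ≤
            ((((∏ k, (P k).D : ℕ) : ℝ) ^ ((2 * (2 * r + ρ) + 1) ^ d)) ^ 2 * ∑ k, δ k) * ‖O‖ := by
  choose Ba hBa i₀ hi₀ using fun x => exists_unitary_mulVec_single_eq (ha x)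
  set Bs : ∀ k, Op fun _ : Torus d N => (P k).D := fun k => (P k).eigenBasis N with hBs
  have hBsu : ∀ k, Bs k ∈ unitary (Op fun _ : Torus d N => (P k).D) := fun k =>
    (P k).eigenBasis_mem_unitary N
  set S : ∀ k, Finset (Cfg fun _ : Torus d N => (P k).D) := fun k => (P k).lowLabels N with hS
  have hBsU := piMat_mem_unitary hBsu
  have hBaU := piMat_mem_unitary hBa
  have hψ : piMat Ba *ᵥ Pi.single i₀ 1 = piVec a := by
    rw [← piVec_single, piMat_mulVec_piVec]
    congr 1
    funext x
    exact hi₀ x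
  have hψu : IsUnitVec (piVec a) := by
    rw [IsUnitVec, star_piVec_dotProduct]
    exact Finset.prod_eq_one fun x _ => ha x
  set Bt := tensMat pl.split (piMat Bs) (piMat Ba) with hBt
  have hBtU := tensMat_mem_unitary pl.split hBsU hBaU
  set St := prodLabels pl.split (Fintype.piFinset S) i₀ with hSt
  refine ⟨specSpace Bt St, ?_, fun φ hφ => ?_, fun Δ J R hΔ hJ hP hw => ?_,
    fun r δ hN hδ x O hO => ?_⟩
  · rw [finrank_specSpace hBtU, card_prodLabels, Fintype.card_piFinset]
    exact Finset.prod_congr rfl fun k _ => ((P k).degeneracy_eq N).symm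
  · rw [← hψ]
    refine tensVec_mem_specSpace pl.split hBaU fun j hj => ?_
    rw [piMat_conjTranspose, piMat_mulVec_piVec]
    rw [Fintype.mem_piFinset] at hj
    push Not at hj
    obtain ⟨k, hk⟩ := hj
    have := hφ k
    rw [(P k).groundSpace_eq] at this
    exact Finset.prod_eq_zero (Finset.mem_univ k) (this _ hk)
  · set ev₁ : ∀ k, (Cfg fun _ : Torus d N => (P k).D) → ℝ := fun k =>
      ((P k).isHermitian_hamiltonian N).eigenvalues with hev₁
    set ev₂ : ∀ x, Fin (pl.aux x) → ℝ := fun x i => if i = i₀ x then 0 else 1 with hev₂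
    -- the terms: those of the placed systems, and projections onto the complement of `a x`
    let h : (ι × Torus d N) ⊕ Torus d M → Op pl.dim := Sum.elim
      (fun p => amplify pl.split (piEmbed (B := fun k => Cfg fun _ : Torus d N => (P k).D) p.1
        ((P p.1).term N p.2)))
      (fun x => amplify (pl.split.trans (Equiv.prodComm _ _))
        (piEmbed (B := fun x => Fin (pl.aux x)) x
          (Ba x * Matrix.diagonal (fun i => (ev₂ x i : ℂ)) * (Ba x)ᴴ)))
    let κ : Type u := ULift.{u} ((ι × Torus d N) ⊕ Torus d M)
    refine ⟨Bt, St, fun w => (∑ k, ev₁ k ((pl.split w).1 k)) + ∑ x, ev₂ x ((pl.split w).2 x),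
      ∑ k, groundEnergy ((P k).hamiltonian N), κ, inferInstance, fun i => h i.down,
      fun i => Sum.elim (fun p : ι × Torus d N => pl.loc p.1 p.2) (fun x => x) i.down,
      hBtU, rfl, fun w hwS => ?_, fun w hwS => ?_, ?_, ?_, ?_⟩
    · rw [hSt, mem_prodLabels, Fintype.mem_piFinset] at hwS
      have h0 : ∑ x, ev₂ x ((pl.split w).2 x) = 0 :=
        Finset.sum_eq_zero fun x _ => by rw [hwS.2]; simp [hev₂]
      change (∑ k, ev₁ k ((pl.split w).1 k)) + ∑ x, ev₂ x ((pl.split w).2 x) ≤ _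
      rw [h0, add_zero]
      calc _ ≤ ∑ k, (groundEnergy ((P k).hamiltonian N) + (P k).splitting N) :=
            Finset.sum_le_sum fun k _ => (Finset.mem_filter.1 (hwS.1 k)).2
        _ ≤ _ := by rw [Finset.sum_add_distrib]; linarith
    · change _ ≤ (∑ k, ev₁ k ((pl.split w).1 k)) + ∑ x, ev₂ x ((pl.split w).2 x)
      have hge : ∀ k, groundEnergy ((P k).hamiltonian N) ≤ ev₁ k ((pl.split w).1 k) := fun k =>
        groundEnergy_le _ _
      have hge2 : ∀ x, 0 ≤ ev₂ x ((pl.split w).2 x) := fun x => by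
        simp only [hev₂]; split_ifs <;> norm_num
      have hs1 := Finset.sum_le_sum fun k (_ : k ∈ Finset.univ) => hge k
      have hs2 := Finset.sum_nonneg fun x (_ : x ∈ Finset.univ) => hge2 x
      rw [hSt, mem_prodLabels, Fintype.mem_piFinset] at hwS
      by_cases hlow : ∀ k, (pl.split w).1 k ∈ S k
      · obtain ⟨x, hx⟩ := Function.ne_iff.1 fun h => hwS ⟨hlow, h⟩
        have h1 : ev₂ x ((pl.split w).2 x) = 1 := if_neg hx
        have := Finset.single_le_sum (fun x _ => hge2 x) (Finset.mem_univ x)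
        linarith
      · push Not at hlow
        obtain ⟨k, hk⟩ := hlow
        have hk' : groundEnergy ((P k).hamiltonian N) + Δ ≤ ev₁ k ((pl.split w).1 k) := by
          rcases (P k).gap N (hP k).1 _ (eigenvalues_mem_energies
            ((P k).isHermitian_hamiltonian N) ((pl.split w).1 k)) with h1 | h1
          · exact absurd (show (pl.split w).1 k ∈ (P k).lowLabels N from
              Finset.mem_filter.2 ⟨Finset.mem_univ _, h1⟩) hk
          · exact le_trans (by linarith [(hP k).2.1]) h1
        have hs3 : ∑ j, (groundEnergy ((P j).hamiltonian N) + if j = k then Δ else 0) ≤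
            ∑ j, ev₁ j ((pl.split w).1 j) := by
          refine Finset.sum_le_sum fun j _ => ?_
          split_ifs with hj
          · subst hj; exact hk'
          · rw [add_zero]; exact hge j
        rw [Finset.sum_add_distrib, Finset.sum_ite_eq' Finset.univ k, if_pos (Finset.mem_univ k)]
          at hs3
        linarith
    · simp [κ, Fintype.card_sum]
    · rintro ⟨⟨k, y⟩ | x⟩
      · refine ⟨pl.supportedOn_amplify_sys ((P k).supportedOn N y) fun z hz => ?_, ?_⟩
        · rw [mem_disk] at hz ⊢
          have h1 := pl.dist_loc_le k y z
          have h2 := (hP k).2.2.2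
          simp only [Sum.elim_inl]
          omega
        · exact (norm_amplify_le _ _).trans ((norm_piEmbed_le _ _).trans
            (((P k).norm_le N y).trans (hP k).2.2.1))
      · refine ⟨pl.supportedOn_amplify_aux (by simp [mem_disk, torusDist_self]), ?_⟩
        refine (norm_amplify_le _ _).trans ((norm_piEmbed_le _ _).trans
          ((norm_conj_le (hBa x) _).trans (le_trans ?_ hJ)))
        rw [Matrix.l2_opNorm_diagonal]
        refine (pi_norm_le_iff_of_nonneg zero_le_one).2 fun i => ?_
        simp only [hev₂]
        split_ifs <;> simp
    · have hsys : ∀ k, ∑ y, h (Sum.inl (k, y)) =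
          Bt * Matrix.diagonal (fun w => (ev₁ k ((pl.split w).1 k) : ℂ)) * Btᴴ := by
        intro k
        have e1 : ∑ y, h (Sum.inl (k, y)) = amplify pl.split
            (piEmbed (B := fun k => Cfg fun _ : Torus d N => (P k).D) k ((P k).hamiltonian N)) := by
          rw [LatticeModel.hamiltonian, map_sum, map_sum]
          rfl
        rw [e1, eq_conj_diagonal ((P k).isHermitian_hamiltonian N)]
        change amplify pl.split (piEmbed (B := fun k => Cfg fun _ : Torus d N => (P k).D) k
          (Bs k * Matrix.diagonal (fun j => (ev₁ k j : ℂ)) * (Bs k)ᴴ)) = _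
        rw [← piMat_conj_piEmbed hBsu, piEmbed_diagonal, amplify_apply]
        rw [← amplify_diagonal pl.split fun w => (ev₁ k (w k) : ℂ), amplify_apply, hBt,
          tensMat_conjTranspose, tensMat_mul, tensMat_mul, mul_one]
        congr 1
        exact (Unitary.mem_iff.1 hBaU).2.symm
      have haux : ∀ x, h (Sum.inr x) =
          Bt * Matrix.diagonal (fun w => (ev₂ x ((pl.split w).2 x) : ℂ)) * Btᴴ := by
        intro x
        change amplify (pl.split.trans (Equiv.prodComm _ _))
          (piEmbed (B := fun x => Fin (pl.aux x)) x
            (Ba x * Matrix.diagonal (fun i => (ev₂ x i : ℂ)) * (Ba x)ᴴ)) = _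
        rw [← piMat_conj_piEmbed hBa, piEmbed_diagonal, amplify_prodComm]
        have e2 := amplify_diagonal (pl.split.trans (Equiv.prodComm _ _))
          fun w => (ev₂ x (w x) : ℂ)
        rw [amplify_prodComm] at e2
        simp only [Equiv.trans_apply, Equiv.prodComm_apply, Prod.fst_swap] at e2
        rw [← e2, hBt, tensMat_conjTranspose, tensMat_mul, tensMat_mul, mul_one]
        congr 1
        exact (Unitary.mem_iff.1 hBsU).2.symm
      have e3 : ∑ i : κ, h i.down = ∑ i, h i := Fintype.sum_equiv Equiv.ulift _ _ fun _ => rfl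
      rw [e3, Fintype.sum_sum_type, Fintype.sum_prod_type]
      simp only [hsys, haux]
      rw [sum_conj_diagonal, sum_conj_diagonal, ← add_mul, ← mul_add, Matrix.diagonal_add]
      push_cast
      rfl
  · obtain ⟨μ, hμ⟩ := pl.norm_expectation_sub_le (fun k => (P k).D_pos) hN hBsu hψu hδ hO
    refine ⟨μ, fun v hv hv1 => ?_⟩
    obtain ⟨g, hg, rfl⟩ := exists_eq_tensVec_of_mem_specSpace pl.split hBsU hBaU hv
    rw [hψ] at hv1 ⊢
    have hg1 : IsUnitVec g := by
      have h1 : star (piVec a) ⬝ᵥ piVec a = 1 := hψu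
      rwa [IsUnitVec, star_tensVec_dotProduct, h1, mul_one] at hv1
    exact (hμ g hg hg1).trans_eq (mul_assoc _ _ _).symm

end Composite

/-! ### Choice of the length scales -/

section Asymptotics

open Filter Topology Asymptotics

theorem tendsto_natCast_rpow_atTop {β : ℝ} (hβ : 0 < β) :
    Tendsto (fun L : ℕ => (L : ℝ) ^ β) atTop atTop :=
  (tendsto_rpow_atTop hβ).comp tendsto_natCast_atTop_atTop

theorem superpolynomialDecay_exp_neg_mul_rpow {c β : ℝ} (hc : 0 < c) (hβ : 0 < β) :
    SuperpolynomialDecay atTop (fun L : ℕ => (L : ℝ))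
      (fun L : ℕ => Real.exp (-c * (L : ℝ) ^ β)) := by
  intro q
  have h := (tendsto_rpow_mul_exp_neg_mul_atTop_nhds_zero ((q : ℝ) / β) c hc).comp
    (tendsto_natCast_rpow_atTop hβ)
  refine h.congr fun L => ?_
  rw [Function.comp_apply, ← Real.rpow_mul (Nat.cast_nonneg L), mul_div_cancel₀ _ hβ.ne',
    Real.rpow_natCast]

theorem DecaysFasterThanAnyPower.exists_le {f : ℕ → ℝ} (hf : DecaysFasterThanAnyPower f) (p : ℕ) :
    ∃ C : ℝ, 0 ≤ C ∧ ∀ r : ℕ, max (f r) 0 ≤ C / ((r : ℝ) + 1) ^ p := by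
  obtain ⟨C, hC⟩ := hf p
  refine ⟨|C|, abs_nonneg C, fun r => max_le ?_ (by positivity)⟩
  rw [le_div_iff₀ (by positivity)]
  exact (hC r).trans (le_abs_self C)

theorem DecaysFasterThanAnyPower.exists_sum_le {f : ℕ → ℝ} (hf : DecaysFasterThanAnyPower f) :
    ∃ F : ℝ, 0 ≤ F ∧ ∀ n, ∑ r ∈ Finset.range n, f r ≤ F := by
  obtain ⟨C, hC0, hC⟩ := hf.exists_le 2
  have hs : Summable fun r : ℕ => C / ((r : ℝ) + 1) ^ 2 := by
    have := ((summable_nat_add_iff 1).2 (Real.summable_one_div_nat_pow.2 one_lt_two)).mul_left C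
    refine this.congr fun r => ?_
    push_cast
    ring
  refine ⟨∑' r : ℕ, C / ((r : ℝ) + 1) ^ 2, tsum_nonneg fun r => by positivity, fun n => ?_⟩
  exact (Finset.sum_le_sum fun r _ => (le_max_left _ _).trans (hC r)).trans
    (hs.sum_le_tsum _ fun r _ => by positivity)

/-- The tail, beyond a distance `L ^ β`, of the interactions that generate a quasi-local unitary
is superpolynomially small in `L`. -/
theorem DecaysFasterThanAnyPower.superpolynomialDecay_tail {f : ℕ → ℝ}
    (hf : DecaysFasterThanAnyPower f) (d : ℕ) {β : ℝ} (hβ : 0 < β) :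
    SuperpolynomialDecay atTop (fun L : ℕ => (L : ℝ)) fun L : ℕ => ((2 * L : ℕ) : ℝ) ^ d *
      ∑ r ∈ Finset.range (2 * L + 1) with ⌊(L : ℝ) ^ β⌋₊ < r, max (f r) 0 := by
  intro q
  -- the volume factor, the number of terms and one spare power cost `L ^ (d + 2)`
  obtain ⟨p, hp⟩ := exists_nat_ge (((q : ℝ) + d + 2) / β)
  obtain ⟨C, hC0, hC⟩ := hf.exists_le p
  rw [div_le_iff₀ hβ] at hp
  have hlim : Tendsto (fun L : ℕ => (2 ^ d * 3 * C) * ((L : ℝ))⁻¹) atTop (𝓝 0) := by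
    simpa using tendsto_inv_atTop_nhds_zero_nat (𝕜 := ℝ) |>.const_mul (2 ^ d * 3 * C)
  refine squeeze_zero' (Eventually.of_forall fun L => mul_nonneg (by positivity)
    (mul_nonneg (by positivity) (Finset.sum_nonneg fun r _ => le_max_right _ _))) ?_ hlim
  filter_upwards [eventually_ge_atTop 1] with L hL
  have hL1 : (1 : ℝ) ≤ L := by exact_mod_cast hL
  have hL0 : (0 : ℝ) < L := by linarith
  have hterm : ∀ r ∈ (Finset.range (2 * L + 1)).filter (⌊(L : ℝ) ^ β⌋₊ < ·),
      max (f r) 0 ≤ C / (L : ℝ) ^ (q + d + 2) := by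
    intro r hr
    refine (hC r).trans (div_le_div_of_nonneg_left hC0 (by positivity) ?_)
    have h1 : (L : ℝ) ^ β ≤ (r : ℝ) + 1 := by
      have h2 := (Finset.mem_filter.1 hr).2
      have h3 : (⌊(L : ℝ) ^ β⌋₊ : ℝ) ≤ r := by exact_mod_cast h2.le
      linarith [Nat.lt_floor_add_one ((L : ℝ) ^ β)]
    calc (L : ℝ) ^ (q + d + 2) = (L : ℝ) ^ ((q : ℝ) + d + 2) := by
          rw [← Real.rpow_natCast]; push_cast; rfl
      _ ≤ (L : ℝ) ^ (β * p) := Real.rpow_le_rpow_of_exponent_le hL1 (by linarith)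
      _ = ((L : ℝ) ^ β) ^ p := by rw [Real.rpow_mul hL0.le, Real.rpow_natCast]
      _ ≤ _ := by gcongr
  have hcard : (((Finset.range (2 * L + 1)).filter (⌊(L : ℝ) ^ β⌋₊ < ·)).card : ℝ) ≤ 3 * L := by
    have h1 := Finset.card_filter_le (Finset.range (2 * L + 1)) (⌊(L : ℝ) ^ β⌋₊ < ·)
    rw [Finset.card_range] at h1
    have h2 : ((Finset.range (2 * L + 1)).filter (⌊(L : ℝ) ^ β⌋₊ < ·)).card ≤ 3 * L := by omega
    exact_mod_cast h2
  have hsum := Finset.sum_le_card_nsmul _ _ _ hterm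
  rw [nsmul_eq_mul] at hsum
  calc _ ≤ (L : ℝ) ^ q * (((2 * L : ℕ) : ℝ) ^ d * (3 * L * (C / (L : ℝ) ^ (q + d + 2)))) := by
        gcongr
        exact hsum.trans (by gcongr)
    _ = _ := by
        push_cast
        field_simp
        ring

/-- The radius of the region that an observable of bounded range spreads to. The Lieb-Robinson
bound is used for the range `L ^ β` and at order `L ^ (β * (d + 1))`, which exceeds the velocity,
of order `L ^ (β * d)`, by far. -/
def spreadRadius (d : ℕ) (β : ℝ) (L : ℕ) : ℕ :=
  ⌊(L : ℝ) ^ β⌋₊ + 2 * ⌊(L : ℝ) ^ β⌋₊ * ⌊(L : ℝ) ^ β⌋₊ ^ (d + 1)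

/-- The Lieb-Robinson bound is exponentially small once the order exceeds `exp 2` times `x`, the
velocity times the time. -/
theorem pow_div_factorial_le_exp_neg {x : ℝ} (hx : 0 ≤ x) {n : ℕ} (h : Real.exp 2 * x ≤ n) :
    x ^ n / n.factorial ≤ Real.exp (-n) := by
  have h1 := Real.pow_div_factorial_le_exp (Real.exp 2 * x) (by positivity) n
  rw [mul_pow, mul_div_assoc] at h1
  have h2 : Real.exp 2 ^ n = Real.exp (2 * n) := by rw [← Real.exp_nat_mul, mul_comm]
  rw [h2] at h1
  have h3 : Real.exp (2 * n) * (x ^ n / n.factorial) ≤ Real.exp (2 * n) * Real.exp (-n) := by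
    refine h1.trans ?_
    rw [← Real.exp_add]
    exact Real.exp_le_exp.2 (by linarith)
  exact le_of_mul_le_mul_left h3 (Real.exp_pos _)

/-- Quasi-local unitaries map local observables to local ones, on a length scale `L ^ β` with
arbitrarily small `β` and up to a superpolynomially small error. -/
theorem exists_superpolynomialDecay_of_isQuasiLocalUnitary (d : ℕ) {T : ℝ} (hT : 0 ≤ T) {f : ℕ → ℝ}
    (hf : DecaysFasterThanAnyPower f) {β : ℝ} (hβ : 0 < β) (R : ℕ) {J : ℝ} (hJ : 0 ≤ J) :
    ∃ e : ℕ → ℝ, (∀ L, 0 ≤ e L) ∧ SuperpolynomialDecay atTop (fun L : ℕ => (L : ℝ)) e ∧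
      ∀ᶠ L in atTop, ∀ (m : Torus d (2 * L) → ℕ) (U : Op m), IsQuasiLocalUnitary T f U →
        ∀ x (A : Op m), SupportedOn (disk x R) A → ‖A‖ ≤ J →
          ∃ A', SupportedOn (disk x (spreadRadius d β L)) A' ∧ ‖Uᴴ * A * U - A'‖ ≤ e L := by
  obtain ⟨F, hF0, hF⟩ := hf.exists_sum_le
  set η : ℕ → ℝ := fun L : ℕ => ((2 * L : ℕ) : ℝ) ^ d *
      ∑ r ∈ Finset.range (2 * L + 1) with ⌊(L : ℝ) ^ β⌋₊ < r, max (f r) 0 with hη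
  have hηd : SuperpolynomialDecay atTop (fun L : ℕ => (L : ℝ)) η :=
    hf.superpolynomialDecay_tail d hβ
  have hη0 : ∀ L, 0 ≤ η L := fun L => mul_nonneg (by positivity)
    (Finset.sum_nonneg fun r _ => le_max_right _ _)
  have hexp : SuperpolynomialDecay atTop (fun L : ℕ => (L : ℝ))
      (fun L : ℕ => Real.exp (-1 * (L : ℝ) ^ β)) :=
    superpolynomialDecay_exp_neg_mul_rpow one_pos hβ
  refine ⟨fun L => (J * Real.exp 1 + 1) * Real.exp (-1 * (L : ℝ) ^ β) + (J * (2 * T)) * η L,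
    fun L => add_nonneg (by positivity) (mul_nonneg (by positivity) (hη0 L)),
    (hexp.const_mul _).add (hηd.const_mul _), ?_⟩
  have hηlim : Tendsto (fun L => 2 * η L * T) atTop (𝓝 0) := by
    have h0 : Tendsto η atTop (𝓝 0) := by simpa using hηd 0
    simpa using (h0.const_mul 2).mul_const T
  set v : ℝ := 6 * 5 ^ d * F * T with hv
  have hfl : Tendsto (fun L : ℕ => ⌊(L : ℝ) ^ β⌋₊) atTop atTop :=
    tendsto_nat_floor_atTop.comp (tendsto_natCast_rpow_atTop hβ)
  filter_upwards [hfl.eventually_ge_atTop (max R 1),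
    hfl.eventually_ge_atTop ⌈Real.exp 2 * v⌉₊, hηlim.eventually_le_const one_pos] with L h1 h2 h3
  intro m U hU x A hA hAJ
  set ℓ := ⌊(L : ℝ) ^ β⌋₊ with hℓ
  have hℓ1 : 1 ≤ ℓ := (le_max_right _ _).trans h1
  have hℓv : Real.exp 2 * v ≤ ℓ := (Nat.le_ceil _).trans (by exact_mod_cast h2)
  obtain ⟨A', hA', hd⟩ := hU.exists_supportedOn_near hT (ℓ := ℓ) (F := F) (η := η L) (hF _)
    (mul_le_mul_of_nonneg_left (Finset.sum_le_sum fun r _ => le_max_left _ _) (by positivity))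
    h3 (ℓ ^ (d + 1)) (x := x) (a := A)
    (hA.mono (disk_subset_disk (by rw [torusDist_self]; omega)))
    (Real.exp_pos (-1 * (L : ℝ) ^ β))
  refine ⟨A', hA', hd.trans ?_⟩
  have h4 : (6 * ((4 * ℓ + 1 : ℕ) : ℝ) ^ d * F * T) ^ (ℓ ^ (d + 1)) / (ℓ ^ (d + 1)).factorial ≤
      Real.exp 1 * Real.exp (-1 * (L : ℝ) ^ β) := by
    have h5 : Real.exp 2 * (6 * ((4 * ℓ + 1 : ℕ) : ℝ) ^ d * F * T) ≤ ((ℓ ^ (d + 1) : ℕ) : ℝ) := by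
      have h6 : ((4 * ℓ + 1 : ℕ) : ℝ) ≤ 5 * ℓ := by exact_mod_cast (by omega)
      calc _ ≤ Real.exp 2 * (6 * (5 * (ℓ : ℝ)) ^ d * F * T) := by gcongr
        _ = (Real.exp 2 * v) * (ℓ : ℝ) ^ d := by rw [hv, mul_pow]; ring
        _ ≤ ℓ * (ℓ : ℝ) ^ d := by gcongr
        _ = _ := by push_cast; ring
    refine (pow_div_factorial_le_exp_neg (by positivity) h5).trans ?_
    rw [← Real.exp_add]
    refine Real.exp_le_exp.2 ?_
    have h7 : (ℓ : ℝ) ≤ ((ℓ ^ (d + 1) : ℕ) : ℝ) := by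
      exact_mod_cast Nat.le_self_pow (Nat.succ_ne_zero d) ℓ
    have h8 := (Nat.lt_floor_add_one ((L : ℝ) ^ β)).le
    rw [← hℓ] at h8
    linarith
  have h9 : 0 ≤ η L * T := mul_nonneg (hη0 L) hT
  calc _ ≤ J * (Real.exp 1 * Real.exp (-1 * (L : ℝ) ^ β) + 2 * (η L * T)) +
        Real.exp (-1 * (L : ℝ) ^ β) := by gcongr
    _ = _ := by ring

theorem spreadRadius_le (d ρ : ℕ) {β : ℝ} {L : ℕ} (hL : 1 ≤ ⌊(L : ℝ) ^ β⌋₊) :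
    (((2 * (2 * spreadRadius d β L + ρ) + 1) ^ d : ℕ) : ℝ) ≤
      (13 + 2 * ρ : ℕ) ^ d * (L : ℝ) ^ (β * ((d + 2) * d : ℕ)) := by
  set ℓ := ⌊(L : ℝ) ^ β⌋₊ with hℓ
  have h1 : ℓ ≤ ℓ ^ (d + 2) := Nat.le_self_pow (by omega) ℓ
  have h2 : 1 ≤ ℓ ^ (d + 2) := Nat.one_le_pow _ _ hL
  have h3 : 2 * (2 * spreadRadius d β L + ρ) + 1 ≤ (13 + 2 * ρ) * ℓ ^ (d + 2) := by
    have e : spreadRadius d β L = ℓ + 2 * ℓ ^ (d + 2) := by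
      rw [spreadRadius, ← hℓ]; ring
    have h4 : ρ ≤ ρ * ℓ ^ (d + 2) := Nat.le_mul_of_pos_right _ h2
    rw [e]
    linarith
  have h5 : (ℓ : ℝ) ≤ (L : ℝ) ^ β := Nat.floor_le (by positivity)
  calc (((2 * (2 * spreadRadius d β L + ρ) + 1) ^ d : ℕ) : ℝ)
      ≤ (((13 + 2 * ρ) * ℓ ^ (d + 2)) ^ d : ℕ) := by exact_mod_cast Nat.pow_le_pow_left h3 d
    _ = ((13 + 2 * ρ : ℕ) : ℝ) ^ d * (ℓ : ℝ) ^ ((d + 2) * d) := by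
        push_cast; rw [mul_pow, pow_mul]
    _ ≤ (13 + 2 * ρ : ℕ) ^ d * ((L : ℝ) ^ β) ^ ((d + 2) * d) := by gcongr
    _ = _ := by rw [Real.rpow_mul (Nat.cast_nonneg L), Real.rpow_natCast]

theorem superpolynomialDecay_finsetSum {ι : Type*} (s : Finset ι) {e : ι → ℕ → ℝ}
    (h : ∀ i ∈ s, SuperpolynomialDecay atTop (fun L : ℕ => (L : ℝ)) (e i)) :
    SuperpolynomialDecay atTop (fun L : ℕ => (L : ℝ)) fun L => ∑ i ∈ s, e i L := by
  intro q
  simp_rw [Finset.mul_sum]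
  simpa using tendsto_finsetSum s fun i hi => h i hi q

/-- The error of local indistinguishability stays small when it is multiplied by the dimension of
the algebra of a region of radius `L ^ β`, for all small `β`. -/
theorem GappedPhase.LocallyIndistinguishable.eventually_exists_superpolynomialDecay {d : ℕ}
    {P : GappedPhase d} (hP : P.LocallyIndistinguishable) (ρ : ℕ) {D : ℕ} (hD : 0 < D) {N : ℕ → ℕ}
    (hN : ∀ L, L ≤ N L) :
    ∀ᶠ β in 𝓝[>] (0 : ℝ), ∃ δ e : ℕ → ℝ,
      SuperpolynomialDecay atTop (fun L : ℕ => (L : ℝ)) e ∧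
      ∀ᶠ L in atTop, ((D : ℝ) ^ ((2 * (2 * spreadRadius d β L + ρ) + 1) ^ d)) ^ 2 * δ L ≤ e L ∧
        ∀ g ∈ P.groundSpace (N L), IsUnitVec g → ∀ y (E : Op fun _ : Torus d (N L) => P.D),
          SupportedOn (disk y (2 * spreadRadius d β L + ρ)) E → ‖E‖ ≤ 1 →
          ∃ c : ℂ, ‖c‖ ≤ 1 ∧
            ‖specProj (P.eigenBasis (N L)) (P.lowLabels (N L)) * E *
              specProj (P.eigenBasis (N L)) (P.lowLabels (N L)) -
              c • specProj (P.eigenBasis (N L)) (P.lowLabels (N L))‖ ≤ δ L := by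
  obtain ⟨C, c, α, L₀, hC, hc, hα, h⟩ := hP
  have hβ0 : ∀ᶠ β in 𝓝[>] (0 : ℝ), 0 < β := eventually_mem_nhdsWithin
  have hβ1 : ∀ᶠ β in 𝓝[>] (0 : ℝ), β * ((d + 2) * d : ℕ) ≤ α / 2 := by
    have ht : Tendsto (fun β : ℝ => β * ((d + 2) * d : ℕ)) (𝓝[>] 0) (𝓝 0) := by
      have : Tendsto (fun β : ℝ => β * ((d + 2) * d : ℕ)) (𝓝 0) (𝓝 (0 * ((d + 2) * d : ℕ))) :=
        tendsto_id.mul_const _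
      rw [zero_mul] at this
      exact this.mono_left nhdsWithin_le_nhds
    exact ht.eventually_le_const (by linarith)
  filter_upwards [hβ0, hβ1] with β hβ hβα
  -- with this `β` the disk has at most `K * L ^ (α / 2)` sites, which `L ^ α` outgrows
  set K : ℝ := ((13 + 2 * ρ : ℕ) : ℝ) ^ d with hK
  refine ⟨fun L => 8 * (C * Real.exp (-c * (L : ℝ) ^ α)),
    fun L => (8 * C) * Real.exp (-(c / 2) * (L : ℝ) ^ α),
    (superpolynomialDecay_exp_neg_mul_rpow (half_pos hc) hα).const_mul _, ?_⟩
  have hfl : Tendsto (fun L : ℕ => ⌊(L : ℝ) ^ β⌋₊) atTop atTop :=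
    tendsto_nat_floor_atTop.comp (tendsto_natCast_rpow_atTop hβ)
  have hy := tendsto_natCast_rpow_atTop (half_pos hα)
  have hlogD : 0 ≤ Real.log D := Real.log_natCast_nonneg D
  filter_upwards [eventually_ge_atTop (max L₀ 1), hfl.eventually_ge_atTop 1,
    hy.eventually_ge_atTop K, hy.eventually_ge_atTop (4 * K * Real.log D / c)] with L hL h1 h2 h3
  have hL1 : 1 ≤ L := (le_max_right _ _).trans hL
  have hLN : (L : ℝ) ≤ N L := by exact_mod_cast hN L
  set y' := (L : ℝ) ^ (α / 2) with hydef
  have hy0 : 0 ≤ y' := by positivity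
  have hyy : (L : ℝ) ^ α = y' * y' := by
    rw [hydef, ← Real.rpow_add (by exact_mod_cast hL1), add_halves]
  have hrad : (((2 * (2 * spreadRadius d β L + ρ) + 1) ^ d : ℕ) : ℝ) ≤ K * y' :=
    (spreadRadius_le d ρ h1).trans (mul_le_mul_of_nonneg_left
      (Real.rpow_le_rpow_of_exponent_le (by exact_mod_cast hL1) hβα) (by positivity))
  constructor
  · have hDpos : (0 : ℝ) < D := by exact_mod_cast hD
    have h4 : ((D : ℝ) ^ ((2 * (2 * spreadRadius d β L + ρ) + 1) ^ d)) ^ 2 =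
        Real.exp (2 * ((((2 * (2 * spreadRadius d β L + ρ) + 1) ^ d : ℕ) : ℝ) * Real.log D)) := by
      rw [← Real.log_pow, ← Real.log_rpow (by positivity), Real.exp_log (by positivity)]
      norm_cast
    rw [h4]
    calc _ ≤ Real.exp (2 * (K * y' * Real.log D)) *
          (8 * (C * Real.exp (-c * (L : ℝ) ^ α))) := by gcongr
      _ = (8 * C) * Real.exp (2 * (K * y' * Real.log D) + -c * (L : ℝ) ^ α) := by
          rw [Real.exp_add]; ring
      _ ≤ _ := by
          rw [div_le_iff₀ hc] at h3
          have h5 := mul_le_mul_of_nonneg_right h3 hy0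
          gcongr
          rw [hyy]
          linarith
  · intro g hg hg1 x E hE hE1
    have hexp : C * Real.exp (-c * (N L : ℝ) ^ α) ≤ C * Real.exp (-c * (L : ℝ) ^ α) := by
      have h6 : (L : ℝ) ^ α ≤ (N L : ℝ) ^ α := by gcongr
      have h7 := mul_le_mul_of_nonneg_left h6 hc.le
      exact mul_le_mul_of_nonneg_left (Real.exp_le_exp.2 (by linarith)) hC.le
    refine P.exists_norm_compression_le (by positivity) (fun g hg g' hg' hg1 hg1' hgg' y O hO hO1 =>
      ?_) hg hg1 x E hE hE1
    have hcard : ((disk y (2 * spreadRadius d β L + ρ)).card : ℝ) ≤ (N L : ℝ) ^ α := by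
      calc _ ≤ (((2 * (2 * spreadRadius d β L + ρ) + 1) ^ d : ℕ) : ℝ) := by
            exact_mod_cast card_disk_le y _
        _ ≤ K * y' := hrad
        _ ≤ y' * y' := by gcongr
        _ = (L : ℝ) ^ α := hyy.symm
        _ ≤ _ := by gcongr
    obtain ⟨h8, h9⟩ := h (N L) (((le_max_left _ _).trans hL).trans (hN L)) g hg g' hg' hg1 hg1' hgg'
      y _ hcard O hO hO1
    exact ⟨h8.trans_le hexp, h9.trans_le (by gcongr)⟩

end Asymptotics

/-! ### Comparison of the degeneracies -/

section Comparison

open Filter Topology Asymptotics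

universe u v

/-- The sources, as systems placed on the torus of size `2L`. -/
def Intercalation.inputPlacement {d : ℕ} {ι : Type*} {P : ι → GappedPhase d} {Q : GappedPhase d}
    {L ρ : ℕ} (S : Intercalation P Q L ρ) :
    Placement (d := d) (fun k => (P k).D) L (2 * L) (2 * ρ) where
  loc := S.loc
  dist_loc_le k y y' := by
    have h1 := torusDist_triangle (S.loc k y) (double y) (S.loc k y')
    have h2 := torusDist_triangle (double y) (double y') (S.loc k y')
    have h3 := S.loc_near k y
    have h4 := S.loc_near k y'
    rw [torusDist_comm] at h4
    rw [torusDist_double] at h2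
    omega
  le_dist_loc k y y' := by
    have h1 := torusDist_triangle (double y) (S.loc k y) (double y')
    have h2 := torusDist_triangle (S.loc k y) (S.loc k y') (double y')
    have h3 := S.loc_near k y
    have h4 := S.loc_near k y'
    rw [torusDist_comm] at h3
    rw [torusDist_double] at h1
    omega
  dim := S.dim
  aux := S.auxIn
  equiv := S.input

/-- The output phase, as a single system placed on the torus of size `2L`. -/
def Intercalation.outputPlacement {d : ℕ} {ι : Type*} {P : ι → GappedPhase d} {Q : GappedPhase d}
    {L ρ : ℕ} (S : Intercalation P Q L ρ) :
    Placement (d := d) (fun _ : Unit => Q.D) (2 * L) (2 * L) 0 where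
  loc _ y := y
  dist_loc_le _ y y' := by omega
  le_dist_loc _ y y' := le_rfl
  dim := S.dim
  aux := S.auxOut
  -- exactly one system site lies at `x`
  equiv x :=
    haveI : Unique {p : Unit × Torus d (2 * L) // p.2 = x} :=
      ⟨⟨⟨((), x), rfl⟩⟩, fun p => Subtype.ext (Prod.ext rfl p.2)⟩
    (S.output x).trans (Equiv.prodCongr (Equiv.funUnique _ _).symm (Equiv.refl _))

theorem Intercalation.tensVec_inputPlacement {d : ℕ} {ι : Type*} [Fintype ι]
    {P : ι → GappedPhase d} {Q : GappedPhase d}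
    {L ρ : ℕ} (S : Intercalation P Q L ρ) (φ : ∀ k, (P k).State L)
    (a : ∀ x, Fin (S.auxIn x) → ℂ) :
    tensVec S.inputPlacement.split (piVec φ) (piVec a) = S.inputState φ a :=
  rfl

theorem Intercalation.tensVec_outputPlacement {d : ℕ} {ι : Type*}
    {P : ι → GappedPhase d} {Q : GappedPhase d}
    {L ρ : ℕ} (S : Intercalation P Q L ρ) (ψ : Q.State (2 * L))
    (b : ∀ x, Fin (S.auxOut x) → ℂ) :
    tensVec S.outputPlacement.split (piVec fun _ : Unit => ψ) (piVec b) = S.outputState ψ b := by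
  funext w
  change (∏ _k : Unit, _) * _ = _
  rw [Fintype.prod_unique]
  rfl

theorem isUnitVec_tensVec_piVec {n κ κ' : Type*} [Fintype n] [Fintype κ] [Fintype κ']
    [DecidableEq κ] [DecidableEq κ'] {α : κ → Type*} {α' : κ' → Type*} [∀ k, Fintype (α k)]
    [∀ k, Fintype (α' k)] (s : n ≃ (∀ k, α k) × ∀ k, α' k) {φ : ∀ k, α k → ℂ} {a : ∀ k, α' k → ℂ}
    (hφ : ∀ k, IsUnitVec (φ k)) (ha : ∀ k, IsUnitVec (a k)) :
    IsUnitVec (tensVec s (piVec φ) (piVec a)) := by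
  rw [IsUnitVec, star_tensVec_dotProduct, star_piVec_dotProduct, star_piVec_dotProduct,
    Finset.prod_eq_one fun k _ => hφ k, Finset.prod_eq_one fun k _ => ha k, mul_one]

theorem IsGappedSubspace.mono {d M : ℕ} {m : Torus d M → ℕ} {V : Submodule ℂ (Cfg m → ℂ)} {R : ℕ}
    {J Δ : ℝ} {n n' : ℕ} (h : IsGappedSubspace.{u} V R J Δ n) (hn : n ≤ n') :
    IsGappedSubspace.{u} V R J Δ n' := by
  obtain ⟨B, S, ev, E, κ, _, h, c, h1, h2, h3, h4, h5, h6⟩ := h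
  exact ⟨B, S, ev, E, κ, _, h, c, h1, h2, h3, h4, h5.trans hn, h6⟩

theorem exists_pos_forall_le {ι : Type*} [Finite ι] (f : ι → ℝ) (hf : ∀ i, 0 < f i) :
    ∃ ε, 0 < ε ∧ ε ≤ 1 ∧ ∀ i, ε ≤ f i := by
  cases nonempty_fintype ι
  obtain ⟨M, hM⟩ := Finite.exists_le fun i => (f i)⁻¹
  refine ⟨(max M 1)⁻¹, by positivity, inv_le_one_of_one_le₀ (le_max_right _ _), fun i => ?_⟩
  exact inv_le_of_inv_le₀ (hf i) ((hM i).trans (le_max_left _ _))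

/-- The asymptotic form of `Placement.exists_groundSpace`: uniform constants for the gap, and a
superpolynomially small error of the local indistinguishability on the scale `L ^ β`. -/
theorem eventually_exists_groundSpace {d : ℕ} {ι : Type u} [Fintype ι] [DecidableEq ι]
    (P : ι → GappedPhase d) (hP : ∀ k, (P k).LocallyIndistinguishable) {N : ℕ → ℕ}
    (hN : ∀ L, L ≤ N L) (hN2 : ∀ L, N L ≤ 2 * L) (ρ : ℕ) :
    ∃ (Δ J : ℝ) (R K : ℕ), 0 < Δ ∧ 0 ≤ J ∧ ∀ᶠ β in 𝓝[>] (0 : ℝ), ∃ e : ℕ → ℝ, (∀ L, 0 ≤ e L) ∧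
      SuperpolynomialDecay atTop (fun L : ℕ => (L : ℝ)) e ∧ ∀ᶠ L in atTop,
      ∀ (pl : Placement (d := d) (fun k => (P k).D) (N L) (2 * L) ρ)
        (a : ∀ x, Fin (pl.aux x) → ℂ), (∀ x, IsUnitVec (a x)) →
        ∀ φ : ∀ k, (P k).State (N L), (∀ k, φ k ∈ (P k).groundSpace (N L) ∧ IsUnitVec (φ k)) →
        ∃ V : Submodule ℂ (Cfg pl.dim → ℂ),
          Module.finrank ℂ V = ∏ k, (P k).degeneracy (N L) ∧
          tensVec pl.split (piVec φ) (piVec a) ∈ V ∧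
          IsGappedSubspace.{u} V R J Δ (K * (2 * L) ^ d) ∧
          ∀ x (O : Op pl.dim), SupportedOn (disk x (spreadRadius d β L)) O → ∃ μ : ℂ,
            ∀ v ∈ V, IsUnitVec v → ‖star v ⬝ᵥ (O *ᵥ v) - μ‖ ≤ e L * ‖O‖ := by
  obtain ⟨Δ, hΔ0, hΔ1, hΔ⟩ := exists_pos_forall_le (fun k => (P k).Δ) fun k => (P k).Δ_pos
  obtain ⟨J, hJ⟩ := Finite.exists_le fun k => (P k).J
  obtain ⟨R, hR⟩ := Finite.exists_le fun k => 2 * (P k).R + ρ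
  obtain ⟨L₀, hL₀⟩ := Finite.exists_le fun k => (P k).L₀
  refine ⟨Δ, max J 1, R, Fintype.card ι + 1, hΔ0, by positivity, ?_⟩
  have hD : 0 < ∏ k, (P k).D := Finset.prod_pos fun k _ => (P k).D_pos
  have hNlim : Tendsto N atTop atTop := tendsto_atTop_mono hN tendsto_id
  have hsplit : ∀ᶠ L in atTop, ∑ k, (P k).splitting (N L) ≤ Δ / 2 := by
    have h1 : Tendsto (fun L => ∑ k, (P k).splitting (N L)) atTop (𝓝 (∑ _k : ι, 0)) := by
      refine tendsto_finsetSum _ fun k _ => Tendsto.comp (g := (P k).splitting) ?_ hNlim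
      have h2 := superpolynomialDecay_exp_neg_mul_rpow (P k).c_pos (P k).α_pos 0
      simp only [pow_zero, one_mul] at h2
      have h3 := h2.const_mul (P k).C
      rwa [mul_zero] at h3
    rw [Finset.sum_const_zero] at h1
    exact h1.eventually_le_const (by linarith)
  have hLI := eventually_all.2 fun k =>
    (hP k).eventually_exists_superpolynomialDecay ρ hD hN
  filter_upwards [hLI] with β hβ
  choose δ e he hδ using hβ
  refine ⟨fun L => |∑ k, e k L|, fun L => abs_nonneg _,
    (superpolynomialDecay_finsetSum Finset.univ fun k _ => he k).trans_abs_le fun L => by simp, ?_⟩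
  filter_upwards [eventually_all.2 hδ, hsplit, eventually_ge_atTop (max L₀ 1)] with L hL hw hLL
  intro pl a ha φ hφ
  have hL1 : 1 ≤ L := (le_max_right _ _).trans hLL
  obtain ⟨V, hV1, hV2, hV3, hV4⟩ := pl.exists_groundSpace ha
  refine ⟨V, hV1, hV2 φ fun k => (hφ k).1, ?_, fun x O hO => ?_⟩
  · refine (hV3 Δ (max J 1) R hΔ1 (le_max_right _ _) (fun k => ⟨?_, hΔ k,
      (hJ k).trans (le_max_left _ _), hR k⟩) hw).mono ?_
    · exact (hL₀ k).trans (((le_max_left _ _).trans hLL).trans (hN L))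
    · rw [add_mul, one_mul]
      gcongr
      exact hN2 L
  · obtain ⟨μ, hμ⟩ := hV4 (spreadRadius d β L) (fun k => δ k L) (hL1.trans (hN L))
      (fun k y E hE hE1 => (hL k).2 (φ k) (hφ k).1 (hφ k).2 y E hE hE1) x O hO
    refine ⟨μ, fun v hv hv1 => (hμ v hv hv1).trans ?_⟩
    gcongr
    rw [Finset.mul_sum]
    exact (Finset.sum_le_sum fun k _ => (hL k).1).trans (le_abs_self _)

/-- Superpolynomially small errors of every single term remain small after the summation over the
polynomially many terms of a local Hamiltonian. -/
theorem eventually_error_lt {d K : ℕ} {J Δ : ℝ} (hΔ : 0 < Δ) {e₁ e₂ : ℕ → ℝ}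
    (h₁ : SuperpolynomialDecay atTop (fun L : ℕ => (L : ℝ)) e₁)
    (h₂ : SuperpolynomialDecay atTop (fun L : ℕ => (L : ℝ)) e₂) :
    ∀ᶠ L in atTop, ((K * (2 * L) ^ d : ℕ) : ℝ) * (2 * e₁ L + 2 * (e₂ L * (J + e₁ L))) < Δ / 2 := by
  have h0 : Tendsto e₁ atTop (𝓝 0) := by simpa using h₁ 0
  have h3 := (((h₁ d).const_mul 2).add (((h₂ d).mul (h0.const_add J)).const_mul 2)).const_mul
    ((K : ℝ) * 2 ^ d)
  simp only [mul_zero, zero_mul, add_zero] at h3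
  filter_upwards [h3.eventually_lt_const (half_pos hΔ)] with L hL
  refine lt_of_eq_of_lt ?_ hL
  push_cast
  ring

/-- The ground state degeneracy of a constructible phase is the product of those of its sources: the
dimension bound is applied to `U` and to `Uᴴ`. -/
theorem ConstructibleFrom.eventually_degeneracy_eq {d : ℕ} {ι : Type u} [Fintype ι]
    {P : ι → GappedPhase d} {Q : GappedPhase d} (h : ConstructibleFrom P Q)
    (hP : ∀ k, (P k).LocallyIndistinguishable) (hQ : Q.LocallyIndistinguishable) :
    ∃ L₁ : ℕ, ∀ L ≥ L₁, Q.degeneracy (2 * L) = ∏ k, (P k).degeneracy L := by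
  classical
  obtain ⟨L₀, ρ, T, f, hT, hf, hU⟩ := h
  obtain ⟨Δ, J, R, K, hΔ, hJ, hin⟩ := eventually_exists_groundSpace P hP (N := fun L => L)
    (fun L => le_rfl) (fun L => by omega) (2 * ρ)
  obtain ⟨Δ', J', R', K', hΔ', hJ', hout⟩ := eventually_exists_groundSpace (fun _ : Unit => Q)
    (fun _ => hQ) (N := fun L => 2 * L) (fun L => by omega) (fun L => le_rfl) 0
  have hβ0 : ∀ᶠ β in 𝓝[>] (0 : ℝ), 0 < β := eventually_mem_nhdsWithin
  obtain ⟨β, hβ, ⟨e, he0, he, hin⟩, ⟨e', he0', he', hout⟩⟩ := (hβ0.and (hin.and hout)).exists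
  obtain ⟨ε, hε0, hε, hloc⟩ :=
    exists_superpolynomialDecay_of_isQuasiLocalUnitary d hT hf hβ R hJ
  obtain ⟨ε', hε0', hε', hloc'⟩ :=
    exists_superpolynomialDecay_of_isQuasiLocalUnitary d hT hf hβ R' hJ'
  rw [← eventually_atTop]
  filter_upwards [hin, hout, hloc, hloc', eventually_error_lt (K := K) (d := d) (J := J) hΔ hε he',
    eventually_error_lt (K := K') (d := d) (J := J') hΔ' hε' he, eventually_ge_atTop L₀]
    with L hin hout hloc hloc' hsm hsm' hL
  obtain ⟨S, U, φ, a, ψ, b, hql, hφ, ha, hψ, hb, hUv⟩ := hU L hL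
  obtain ⟨V, hV1, hV2, hV3, hV4⟩ := hin S.inputPlacement a ha φ hφ
  obtain ⟨V', hV1', hV2', hV3', hV4'⟩ := hout S.outputPlacement b hb (fun _ => ψ) (fun _ => hψ)
  rw [S.tensVec_inputPlacement] at hV2
  rw [S.tensVec_outputPlacement] at hV2'
  have hUu := hql.mem_unitary hT
  have hUU : Uᴴ * U = 1 := (Unitary.mem_iff.1 hUu).1
  have hv : IsUnitVec (S.inputState φ a) :=
    isUnitVec_tensVec_piVec S.inputPlacement.split (fun k => (hφ k).2) ha
  have hv' : IsUnitVec (S.outputState ψ b) := hUv ▸ isUnitVec_mulVec hUu hv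
  have hback : Uᴴ *ᵥ S.outputState ψ b = S.inputState φ a := by
    rw [← hUv, Matrix.mulVec_mulVec, hUU, Matrix.one_mulVec]
  have h1 : Module.finrank ℂ V ≤ Module.finrank ℂ V' :=
    finrank_le_of_isGappedSubspace hV3' (he0 L) hJ' hV4 hUu
      (fun x A hA hAJ => hloc' _ U hql x A hA hAJ) hV2 hv (hUv ▸ hV2') (hε0' L) hsm'
  have h2 : Module.finrank ℂ V' ≤ Module.finrank ℂ V :=
    finrank_le_of_isGappedSubspace hV3 (he0' L) hJ hV4' (hql.conjTranspose hT |>.mem_unitary hT)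
      (fun x A hA hAJ => hloc _ Uᴴ (hql.conjTranspose hT) x A hA hAJ) hV2' hv' (hback ▸ hV2)
      (hε0 L) hsm
  have h3 := le_antisymm h1 h2
  rw [hV1, hV1', Fintype.prod_unique fun _ : Unit => Q.degeneracy (2 * L)] at h3
  exact h3.symm

end Comparison

end SourceRG

end

theorem mainTheorem7 (d : ℕ) (hd : 0 < d) :
    (∀ (P : SourceRG.GappedPhase d) (s : ℕ),
      P.LocallyIndistinguishable → SourceRG.IsSourceFixedPoint P s →
      ∃ L₁ : ℕ, ∀ L ≥ L₁, P.degeneracy (2 * L) = P.degeneracy L ^ s) ∧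
    (∀ (Λ : Type*) (P : Λ → SourceRG.GappedPhase d) (s : Λ → Λ →₀ ℕ),
      (∀ j, (P j).LocallyIndistinguishable) →
      ∀ i, SourceRG.IsGeneralizedSourceFixedPoint P s i →
      ∃ L₁ : ℕ, ∀ L ≥ L₁,
        (P i).degeneracy (2 * L) = (s i).prod fun j n => (P j).degeneracy L ^ n) := by

  constructor
  · intro P s hP h
    obtain ⟨L₁, hL₁⟩ := SourceRG.ConstructibleFrom.eventually_degeneracy_eq h (fun _ => hP) hP
    exact ⟨L₁, fun L hL => by rw [hL₁ L hL, Finset.prod_const, Finset.card_univ, Fintype.card_fin]⟩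
  · intro Λ P s hP i h
    obtain ⟨L₁, hL₁⟩ := SourceRG.ConstructibleFrom.eventually_degeneracy_eq h
      (fun k => hP k.1) (hP i)
    refine ⟨L₁, fun L hL => ?_⟩
    rw [hL₁ L hL, Fintype.prod_sigma, Finsupp.prod, ← Finset.prod_coe_sort (s i).support]
    refine Fintype.prod_congr _ _ fun j => ?_
    change ∏ _y : Fin (s i j), (P j).degeneracy L = _
    rw [Finset.prod_const, Finset.card_univ, Fintype.card_fin]
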